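/- Let $n\ge 2$ and let $S\subset\mathbb{R}^n$ be a smooth embedded hypersurface, either without boundary or compact with (possibly empty) smooth boundary, with smooth unit normal field (Gauss map) $N:S\to\mathbb{S}^{n-1}$, surface measure $\mathrm{d}\sigma$ and tangent spaces $T_uS=\langle N(u)\rangle^\perp$. Suppose that $S$ is strictly convex, in the sense that the shape operator $\mathrm{d}N_u:T_uS\to T_uS$ is positive definite for every $u\in S$ and the Gauss map is injective; that $N(S)$ is geodesically convex, i.e. its intersection with every great circle is connected; and that $N(u)\cdot N(u')\ge\frac12$ for all $u,u'\in S$. Let the curvature quotient $Q(S)\in[0,\infty]$ be the smallest $c$ such that $\lambda_j(u)\le c\,\lambda_k(u')$ for all $u,u'\in S$ and $1\le j,k\le n-1$, where $\lambda_1(u),\dots,\lambda_{n-1}(u)$ are the principal curvatures of $S$ at $u$ (the eigenvalues of $\mathrm{d}N_u$). For $u,u'\in S$ with $u'\ne u$ let $R_uu'$ be the (unique, if it exists) point $u''\in S$ with $u''\neq u'$, $(u'-u'')\cdot N(u)=0$ and $N(u)\wedge N(u')\wedge N(u'')=0$; put $R_uu=u$. Let $J(u,u')$ be the Jacobian at $u$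 of the map $u\mapsto R_uu'$, so that $\mathrm{d}\sigma(R_uu')=J(u,u')\,\mathrm{d}\sigma(u)$ for each fixed $u'$. For $f_1,f_2:S\to[0,\infty)$ define $$M_S(f_1,f_2)(u)=\sup_{0<\delta<1}\delta^{-(n-1)}\int_{|u'-R_uu'|<\delta}f_1(u')f_2(R_uu')J(u,u')\,\mathrm{d}\sigma(u'),$$ the integral being over those $u'\in S$ for which $R_uu'$ exists. If $Q(S)<\infty$, then $M_S$ maps $L^2(S)\times L^2(S)$ boundedly into $L^{1,\infty}(S)$, with a bound depending only on $n$ and $Q(S)$. More precisely: for every $n\ge 2$ and every $Q\in[0,\infty)$ there is a finite constant $C=C(n,Q)$ such that, for all $S$ as above with $Q(S)\le Q$ and all nonnegative $f_1,f_2\in L^2(S)$, the function $M_S(f_1,f_2)$ is $\sigma$-measurable and $$\lambda\,\sigma\big(\{u\in S: M_S(f_1,f_2)(u)>\lambda\}\big)\le C\,\|f_1\|_{L^2(S)}\|f_2\|_{L^2(S)}\qquad\text{for all }\lambda\ge 0 .$$ -/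

import Mathlib

open scoped ContDiff ENNReal NNReal InnerProductSpace
open MeasureTheory

noncomputable section

namespace SurfaceMaximal

/-- `ℝⁿ` with its Euclidean norm. -/
abbrev Eucl (n : ℕ) : Type := EuclideanSpace ℝ (Fin n)

/-- `S` is a smooth embedded hypersurface of `ℝⁿ` without boundary, and `N` restricts to a smooth
unit normal field on `S`: near each of its points `S` is the zero set of a smooth function `F`
with nonvanishing gradient on `S`, and `N = ∇F / |∇F|` there. (Given a continuous unit normal
field, every local defining function has this property up to sign.) -/
def IsHypersurface {n : ℕ} (S : Set (Eucl n)) (N : Eucl n → Eucl n) : Prop :=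
  ∀ p ∈ S, ∃ (V : Set (Eucl n)) (F : Eucl n → ℝ),
    IsOpen V ∧ p ∈ V ∧ ContDiffOn ℝ ∞ F V ∧
    S ∩ V = {x ∈ V | F x = 0} ∧
    ∀ x ∈ S ∩ V, gradient F x ≠ 0 ∧ N x = ‖gradient F x‖⁻¹ • gradient F x

/-- `S` is a smooth embedded hypersurface of `ℝⁿ` with (possibly empty) smooth boundary, and `N`
restricts to a smooth unit normal field on `S`: near each of its points `S` is
`{F = 0, G ≥ 0}`, where `∇F ≠ 0` on `S` and `∇F, ∇G` are linearly independent at the boundary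
points, i.e. those with `G = 0`. -/
def IsHypersurfaceWithBoundary {n : ℕ} (S : Set (Eucl n)) (N : Eucl n → Eucl n) : Prop :=
  ∀ p ∈ S, ∃ (V : Set (Eucl n)) (F G : Eucl n → ℝ),
    IsOpen V ∧ p ∈ V ∧ ContDiffOn ℝ ∞ F V ∧ ContDiffOn ℝ ∞ G V ∧
    S ∩ V = {x ∈ V | F x = 0 ∧ 0 ≤ G x} ∧
    ∀ x ∈ S ∩ V, gradient F x ≠ 0 ∧ N x = ‖gradient F x‖⁻¹ • gradient F x ∧
      (G x = 0 → LinearIndependent ℝ ![gradient F x, gradient G x])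

/-- The tangent space `T_u S = ⟨N(u)⟩^⊥`. -/
def tangentSpace {n : ℕ} (N : Eucl n → Eucl n) (u : Eucl n) : Submodule ℝ (Eucl n) :=
  (Submodule.span ℝ {N u})ᗮ

/-- The shape operator `dN_u`. Only its restriction to `T_u S`, which is the differential at `u`
of the Gauss map `N : S → 𝕊ⁿ⁻¹`, is ever used. -/
def shapeOperator {n : ℕ} (S : Set (Eucl n)) (N : Eucl n → Eucl n) (u : Eucl n) :
    Eucl n →L[ℝ] Eucl n :=
  fderivWithin ℝ N S u

/-- `κ` is a principal curvature of `S` at `u`: an eigenvalue of the shape operator on `T_u S`. -/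
def IsPrincipalCurvature {n : ℕ} (S : Set (Eucl n)) (N : Eucl n → Eucl n) (u : Eucl n)
    (κ : ℝ) : Prop :=
  ∃ v ∈ tangentSpace N u, v ≠ 0 ∧ shapeOperator S N u v = κ • v

/-- The curvature quotient `Q(S)`: the smallest `c` with `λ_j(u) ≤ c λ_k(u')` for all
`u, u' ∈ S` and all principal curvatures `λ_j(u)`, `λ_k(u')`; it is `∞` if there is no finite
such `c`. (Principal curvatures are positive on the surfaces considered.) -/
def curvatureQuotient {n : ℕ} (S : Set (Eucl n)) (N : Eucl n → Eucl n) : ℝ≥0∞ :=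
  sInf {c : ℝ≥0∞ | ∀ u ∈ S, ∀ u' ∈ S, ∀ κ κ' : ℝ,
    IsPrincipalCurvature S N u κ → IsPrincipalCurvature S N u' κ' →
      ENNReal.ofReal κ ≤ c * ENNReal.ofReal κ'}

/-- Smooth strictly convex hypersurfaces with Gauss map `N`, in the setting considered here. -/
structure IsStrictlyConvexSurface {n : ℕ} (S : Set (Eucl n)) (N : Eucl n → Eucl n) : Prop where
  /-- `S` is a smooth hypersurface, either without boundary or compact with boundary. -/
  smooth : IsHypersurface S N ∨ (IsCompact S ∧ IsHypersurfaceWithBoundary S N)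
  /-- The shape operator is strictly positive definite at all points. -/
  shape_pos : ∀ u ∈ S, ∀ v ∈ tangentSpace N u, v ≠ 0 → 0 < ⟪shapeOperator S N u v, v⟫_ℝ
  /-- The Gauss map is injective. -/
  gauss_injOn : Set.InjOn N S
  /-- `N(S)` is geodesically convex: its intersection with every great circle is connected.
  (A great circle is the intersection of the unit sphere with a two-dimensional subspace.) -/
  geodesically_convex : ∀ P : Submodule ℝ (Eucl n), Module.finrank ℝ P = 2 →
    IsPreconnected ((N '' S) ∩ (P : Set (Eucl n)))
  /-- The normals lie in a cone of fixed aperture. -/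
  cone : ∀ u ∈ S, ∀ u' ∈ S, (1 / 2 : ℝ) ≤ ⟪N u, N u'⟫_ℝ

/-- Surface measure `dσ` on `S`: the `(n-1)`-dimensional Hausdorff measure on `S`, normalised so
that it agrees with Lebesgue measure on `(n-1)`-dimensional affine subspaces. -/
def surfaceMeasure {n : ℕ} (S : Set (Eucl n)) : Measure (Eucl n) :=
  (μHE[n - 1] : Measure (Eucl n)).restrict S

/-- The conditions on `u'' = R_u u'` for `u' ≠ u`: `u'' ∈ S`, `u'' ≠ u'`,
`(u' - u'') · N(u) = 0` and `N(u) ∧ N(u') ∧ N(u'') = 0`. -/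
def IsReflection {n : ℕ} (S : Set (Eucl n)) (N : Eucl n → Eucl n) (u u' u'' : Eucl n) : Prop :=
  u'' ∈ S ∧ u'' ≠ u' ∧ ⟪u' - u'', N u⟫_ℝ = 0 ∧ ¬ LinearIndependent ℝ ![N u, N u', N u'']

/-- The points `u' ∈ S`, `u' ≠ u`, for which a point `u''` as above exists. (The omitted point
`u' = u` has measure zero.) -/
def reflectionDomain {n : ℕ} (S : Set (Eucl n)) (N : Eucl n → Eucl n) (u : Eucl n) :
    Set (Eucl n) :=
  {u' ∈ S | u' ≠ u ∧ ∃ u'', IsReflection S N u u' u''}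

open Classical in
/-- The point `R_u u'`, with `R_u u = u`; the value is irrelevant where no `u''` exists. -/
def reflection {n : ℕ} (S : Set (Eucl n)) (N : Eucl n → Eucl n) (u u' : Eucl n) : Eucl n :=
  if h : u' ≠ u ∧ ∃ u'', IsReflection S N u u' u'' then h.2.choose else u'

/-- The Jacobian `√det((L|_T)* L|_T)` of a linear map `L` restricted to a subspace `T`. -/
def restrictedJacobian {n : ℕ} (T : Submodule ℝ (Eucl n)) (L : Eucl n →L[ℝ] Eucl n) : ℝ :=
  √(LinearMap.det
    (LinearMap.adjoint (L.toLinearMap ∘ₗ T.subtype) ∘ₗ (L.toLinearMap ∘ₗ T.subtype)))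

/-- The Jacobian `J(u,u')`, `dσ(R_u u') = J(u,u') dσ(u)` for fixed `u'`, that is, the density for
which `∫ Φ(R_u u') J(u,u') dσ(u) = ∫ Φ dσ`: the Jacobian at `u` of the map `u ↦ R_u u'`, whose
domain is `{x ∈ S | x ≠ u', R_x u' exists}`. -/
def reflectionJacobian {n : ℕ} (S : Set (Eucl n)) (N : Eucl n → Eucl n) (u u' : Eucl n) : ℝ :=
  restrictedJacobian (tangentSpace N u)
    (fderivWithin ℝ (fun x => reflection S N x u') {x ∈ S | u' ∈ reflectionDomain S N x} u)

/-- The averaging operator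
`A_{S,δ}(f₁,f₂)(u) = δ^{-(n-1)} ∫_{|u'-R_u u'|<δ} f₁(u') f₂(R_u u') J(u,u') dσ(u')`
for nonnegative `f₁, f₂`, with values in `[0,∞]`; the integral is over those `u'` for which
`R_u u'` exists. -/
def averagingOperator {n : ℕ} (S : Set (Eucl n)) (N : Eucl n → Eucl n) (δ : ℝ)
    (f₁ f₂ : Eucl n → ℝ) (u : Eucl n) : ℝ≥0∞ :=
  ENNReal.ofReal ((δ ^ (n - 1))⁻¹) *
    ∫⁻ u' in {u' ∈ reflectionDomain S N u | ‖u' - reflection S N u u'‖ < δ},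
      ENNReal.ofReal (f₁ u') * ENNReal.ofReal (f₂ (reflection S N u u')) *
        ENNReal.ofReal (reflectionJacobian S N u u') ∂(surfaceMeasure S)

/-- The maximal operator `M_S(f₁,f₂)(u) = sup_{0<δ<1} A_{S,δ}(f₁,f₂)(u)`. -/
def maximalOperator {n : ℕ} (S : Set (Eucl n)) (N : Eucl n → Eucl n)
    (f₁ f₂ : Eucl n → ℝ) (u : Eucl n) : ℝ≥0∞ :=
  ⨆ δ ∈ Set.Ioo (0 : ℝ) 1, averagingOperator S N δ f₁ f₂ u

end SurfaceMaximal

end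

/-! Parametrise `S` by its normals, rescaled into the hyperplane `⟪a, e⟫ = 1`, where `e` is one
fixed normal. Geodesic convexity of `N(S)` makes the parameter set `A` convex. The inverse Gauss map
`X : A → S` is bi-Lipschitz with constants `l` and `L` whose ratio is controlled by `Q(S)` alone,
since its derivative inverts the shape operator on tangent vectors. Three normals are linearly
dependent exactly when their parameters are collinear, so reflecting `b` in `a` means finding `c = a
+ s (a - b)`, `s > 0`, with `⟪X b - X c, a⟫ = 0`.

The height `⟪X a - X x, a⟫` over the tangent plane at `X a` is comparable to `‖a - x‖²` and strictly
increasing along rays from `a`. Hence `c` is unique, `s` is bounded above and below (`refl_bounds`),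
and `c` is a Lipschitz function of `b` and of `a` (`refl_lipschitz_left`, `refl_lipschitz_right`),
with constants depending only on a `K ≥ 1` satisfying `L ≤ K * l`. On the surface: `u'` and `R_u u'`
lie within `K ‖u' - R_u u'‖` of `u`; the Jacobian is at most `(45 K ^ 5) ^ (n - 1)`; and `R_u`, a
Lipschitz involution, distorts surface measure by at most the same factor.

By Cauchy–Schwarz the average at scale `δ` is then at most `C δ^{-(n-1)}` times the product of the
`L²` norms of `f₁` and `f₂` on the ball of radius `K δ` about `u`
(`lintegral_averagingIntegrand_le`). Vitali covering, the bound `r^{n-1}` for the measure of balls,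
and a second Cauchy–Schwarz over disjoint balls give the weak-type estimate
(`weak_type_of_local_bound`).

For measurability the reflection is known only as a chosen point depending in a Lipschitz way on the
data. The graphs of the reflection and of its derivative are shown to be Borel, Lusin–Souslin turns
this into measurability of the functions, and the supremum is reduced to rational `δ`. Parameters on
the relative boundary of `A` form a null set and are discarded; at the remaining points every
tangent vector is the velocity of a curve in `S`, so derivatives within `S` are determined on the
tangent space. -/

noncomputable section

namespace SurfaceMaximal

/-! ### Metric geometry of the reflection in Gauss coordinates. -/

section Chart

variable {E : Type*} [NormedAddCommGroup E] [InnerProductSpace ℝ E]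

/-- An inverse Gauss map `X`, parametrised by a convex set `A` of (unnormalised) normals in the
affine hyperplane `⟪a, e⟫ = 1`: the normal to the surface at `X a` is `a / ‖a‖`. -/
structure IsGaussChart (A : Set E) (X : E → E) (e : E) (l L : ℝ) : Prop where
  convex : Convex ℝ A
  affine : ∀ a ∈ A, ⟪a, e⟫_ℝ = 1
  norm_e : ‖e‖ = 1
  norm_le : ∀ a ∈ A, ‖a‖ ≤ 2
  pos : 0 < l
  lip : ∀ a ∈ A, ∀ b ∈ A, ‖X a - X b‖ ≤ L * ‖a - b‖
  mono : ∀ a ∈ A, ∀ b ∈ A, l * ‖a - b‖ ^ 2 ≤ ⟪X a - X b, a - b⟫_ℝ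
  support : ∀ a ∈ A, ∀ b ∈ A, 0 ≤ ⟪X a - X b, a⟫_ℝ

namespace IsGaussChart

variable {A : Set E} {X : E → E} {e : E} {l L : ℝ}

theorem antilip (h : IsGaussChart A X e l L) {a b : E} (ha : a ∈ A) (hb : b ∈ A) :
    l * ‖a - b‖ ≤ ‖X a - X b‖ := by
  rcases eq_or_ne a b with rfl | hab
  · simp
  · have h0 : 0 < ‖a - b‖ := norm_pos_iff.2 (sub_ne_zero.2 hab)
    have h1 := h.mono a ha b hb
    have h2 := real_inner_le_norm (X a - X b) (a - b)
    have : (l * ‖a - b‖) * ‖a - b‖ ≤ ‖X a - X b‖ * ‖a - b‖ := by nlinarith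
    exact le_of_mul_le_mul_right this h0

theorem injOn (h : IsGaussChart A X e l L) : Set.InjOn X A := by
  intro a ha b hb hab
  have h1 := h.antilip ha hb
  rw [hab, sub_self, norm_zero] at h1
  have h2 : ‖a - b‖ ≤ 0 := by
    by_contra hc
    push Not at hc
    have := mul_pos h.pos hc
    linarith
  exact sub_eq_zero.1 (norm_le_zero_iff.1 h2)

theorem continuousOn (h : IsGaussChart A X e l L) : ContinuousOn X A := by
  have : LipschitzOnWith (Real.toNNReal (max L 0)) X A := by
    apply LipschitzOnWith.of_dist_le_mul
    intro a ha b hb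
    rw [dist_eq_norm, dist_eq_norm, Real.coe_toNNReal _ (le_max_right _ _)]
    exact (h.lip a ha b hb).trans (by gcongr; exact le_max_left _ _)
  exact this.continuousOn

theorem midpoint_mem (h : IsGaussChart A X e l L) {a b : E} (ha : a ∈ A) (hb : b ∈ A) :
    (1 / 2 : ℝ) • a + (1 / 2 : ℝ) • b ∈ A :=
  h.convex ha hb (by norm_num) (by norm_num) (by norm_num)

/-- `support` alone gives only nonnegativity. Passing through the midpoint `c` and writing `a = c +
(c - b)` brings in `mono` for the pair `c`, `b`, whence the factor `1 / 4`. -/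
theorem inner_lower (h : IsGaussChart A X e l L) {a b : E} (ha : a ∈ A) (hb : b ∈ A) :
    l / 4 * ‖a - b‖ ^ 2 ≤ ⟪X a - X b, a⟫_ℝ := by
  set c := (1 / 2 : ℝ) • a + (1 / 2 : ℝ) • b with hc
  have hcA : c ∈ A := h.midpoint_mem ha hb
  have h1 := h.support a ha c hcA
  have h2 := h.support c hcA b hb
  have h3 := h.mono c hcA b hb
  have e1 : c - b = (1 / 2 : ℝ) • (a - b) := by rw [hc]; module
  have e2 : a = c + (c - b) := by rw [hc]; module
  have e3 : ⟪X a - X b, a⟫_ℝ = ⟪X a - X c, a⟫_ℝ + (⟪X c - X b, c⟫_ℝ + ⟪X c - X b, c - b⟫_ℝ) := by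
    rw [← inner_add_right, ← e2, ← inner_add_left]; congr 1; abel
  have e4 : ‖c - b‖ = 1 / 2 * ‖a - b‖ := by rw [e1, norm_smul]; norm_num
  rw [e4] at h3
  rw [e3]
  nlinarith

theorem inner_upper (h : IsGaussChart A X e l L) {a b : E} (ha : a ∈ A) (hb : b ∈ A) :
    ⟪X a - X b, a⟫_ℝ ≤ L * ‖a - b‖ ^ 2 := by
  have h1 := h.support b hb a ha
  have h2 := real_inner_le_norm (X a - X b) (a - b)
  have h3 := h.lip a ha b hb
  have e1 : ⟪X a - X b, a⟫_ℝ = ⟪X a - X b, a - b⟫_ℝ - ⟪X b - X a, b⟫_ℝ := by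
    simp only [inner_sub_left, inner_sub_right]; ring
  have : ‖X a - X b‖ * ‖a - b‖ ≤ L * ‖a - b‖ * ‖a - b‖ := by gcongr
  rw [e1]
  nlinarith

/-- Replacing `a` by `b` costs `L ‖c - b‖ ‖a - b‖`, and `⟪X c - X b, b⟫` is quadratic by
`inner_upper`. The gain over mere Lipschitz continuity matches the degeneration of `inner_ray` near
`a`. -/
theorem inner_cross (h : IsGaussChart A X e l L) (a : E) {b c : E} (hb : b ∈ A)
    (hc : c ∈ A) : |⟪X c - X b, a⟫_ℝ| ≤ L * ‖c - b‖ * (‖a - b‖ + ‖c - b‖) := by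
  have h1 := abs_real_inner_le_norm (X c - X b) (a - b)
  have h2 := h.lip c hc b hb
  have h3 := h.support b hb c hc
  have h4 := h.inner_upper hb hc
  rw [norm_sub_rev b c] at h4
  have e1 : ⟪X c - X b, a⟫_ℝ = ⟪X c - X b, a - b⟫_ℝ - ⟪X b - X c, b⟫_ℝ := by
    simp only [inner_sub_left, inner_sub_right]; ring
  have h5 : ‖X c - X b‖ * ‖a - b‖ ≤ L * ‖c - b‖ * ‖a - b‖ := by gcongr
  rw [abs_le] at h1 ⊢
  rw [e1]
  constructor <;> nlinarith [h1.1, h1.2]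

/-- Write `a = p - σ v` with `p` the nearer point: the pairing with `p` is nonnegative by `support`,
and the remaining `σ ⟪X c - X p, v⟫` is bounded below by `mono`. -/
theorem inner_ray (h : IsGaussChart A X e l L) {a v : E} {σ τ : ℝ} (hσ : 0 ≤ σ) (hστ : σ ≤ τ)
    (hp : a + σ • v ∈ A) (hc : a + τ • v ∈ A) :
    l * (τ - σ) * σ * ‖v‖ ^ 2 ≤ ⟪X (a + σ • v) - X (a + τ • v), a⟫_ℝ := by
  rcases hστ.eq_or_lt with rfl | hlt
  · simp
  set p := a + σ • v with hpdef
  set c := a + τ • v with hcdef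
  have h1 := h.support p hp c hc
  have h2 := h.mono c hc p hp
  have e1 : c - p = (τ - σ) • v := by rw [hpdef, hcdef]; module
  have e2 : a = p - σ • v := by rw [hpdef]; abel
  have e3 : ⟪X p - X c, a⟫_ℝ = ⟪X p - X c, p⟫_ℝ + σ * ⟪X c - X p, v⟫_ℝ := by
    conv_lhs => rw [e2]
    simp only [inner_sub_left, inner_sub_right, inner_smul_right]; ring
  have hd : 0 < τ - σ := by linarith
  rw [e1, norm_smul, Real.norm_of_nonneg hd.le, inner_smul_right] at h2
  have h3 : l * (τ - σ) * ‖v‖ ^ 2 ≤ ⟪X c - X p, v⟫_ℝ := by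
    have : (τ - σ) * (l * (τ - σ) * ‖v‖ ^ 2) ≤ (τ - σ) * ⟪X c - X p, v⟫_ℝ := by nlinarith
    exact le_of_mul_le_mul_left this hd
  rw [e3]
  have := mul_le_mul_of_nonneg_left h3 hσ
  nlinarith

theorem inner_ray_pos (h : IsGaussChart A X e l L) {a v : E} {σ τ : ℝ} (hσ : 0 < σ) (hστ : σ < τ)
    (hv : v ≠ 0) (hp : a + σ • v ∈ A) (hc : a + τ • v ∈ A) :
    0 < ⟪X (a + σ • v) - X (a + τ • v), a⟫_ℝ := by
  refine lt_of_lt_of_le ?_ (h.inner_ray hσ.le hστ.le hp hc)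
  have := norm_pos_iff.2 hv
  have := h.pos
  have : 0 < τ - σ := by linarith
  positivity

/-- The reflected parameter `a + s (a - b)` of `b` in `a` is determined by this condition. -/
def Refl (X : E → E) (a b : E) (s : ℝ) : Prop :=
  0 < s ∧ ⟪X b - X (a + s • (a - b)), a⟫_ℝ = 0

/-- The point and its reflection have the same height over the tangent plane at `X a`, and these
heights are comparable to `‖a - b‖²` and `s² ‖a - b‖²`. -/
theorem refl_bounds (h : IsGaussChart A X e l L) {K : ℝ} (hK : 1 ≤ K) (hLK : L ≤ K * l)
    {a b : E} {s : ℝ} (ha : a ∈ A) (hb : b ∈ A) (hc : a + s • (a - b) ∈ A) (hab : a ≠ b)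
    (hs : Refl X a b s) : 1 ≤ 2 * K * s ∧ s ≤ 2 * K := by
  have h0 : 0 < ‖a - b‖ ^ 2 := by
    have := norm_pos_iff.2 (sub_ne_zero.2 hab); positivity
  have e1 : ⟪X a - X (a + s • (a - b)), a⟫_ℝ = ⟪X a - X b, a⟫_ℝ := by
    have := hs.2
    simp only [inner_sub_left] at this ⊢
    linarith
  have e2 : ‖a - (a + s • (a - b))‖ ^ 2 = s ^ 2 * ‖a - b‖ ^ 2 := by
    rw [sub_add_cancel_left, norm_neg, norm_smul, mul_pow, Real.norm_eq_abs, sq_abs]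
  have h1 := h.inner_lower ha hb
  have h2 := h.inner_upper ha hb
  have h3 := h.inner_lower ha hc
  have h4 := h.inner_upper ha hc
  rw [e1, e2] at h3 h4
  have hl := h.pos
  have hs0 := hs.1
  have k1 : l / 4 * ‖a - b‖ ^ 2 ≤ (K * l * s ^ 2) * ‖a - b‖ ^ 2 := by
    have : L * (s ^ 2 * ‖a - b‖ ^ 2) ≤ K * l * (s ^ 2 * ‖a - b‖ ^ 2) := by gcongr
    nlinarith
  have k2 : (l / 4 * s ^ 2) * ‖a - b‖ ^ 2 ≤ K * l * ‖a - b‖ ^ 2 := by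
    have : L * (‖a - b‖ ^ 2) ≤ K * l * (‖a - b‖ ^ 2) := by gcongr
    nlinarith
  have k3 := le_of_mul_le_mul_right k1 h0
  have k4 := le_of_mul_le_mul_right k2 h0
  have k5 : 1 ≤ 4 * K * s ^ 2 := by
    have : l * 1 ≤ l * (4 * K * s ^ 2) := by linarith
    exact le_of_mul_le_mul_left this hl
  have k6 : s ^ 2 ≤ 4 * K := by
    have : l * s ^ 2 ≤ l * (4 * K) := by linarith
    exact le_of_mul_le_mul_left this hl
  -- `K ≥ 1` turns `1 ≤ 4 K s²` and `s² ≤ 4 K` into the linear bounds.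
  constructor
  · by_contra hc
    push Not at hc
    nlinarith [mul_pos (by linarith : (0:ℝ) < K) hs0]
  · by_contra hc
    push Not at hc
    nlinarith

theorem refl_unique (h : IsGaussChart A X e l L) {a b : E} {s t : ℝ}
    (hab : a ≠ b) (hs : Refl X a b s) (ht : Refl X a b t) (hsA : a + s • (a - b) ∈ A)
    (htA : a + t • (a - b) ∈ A) : s = t := by
  have key : ∀ s t : ℝ, Refl X a b s → Refl X a b t → a + s • (a - b) ∈ A →
      a + t • (a - b) ∈ A → ¬ s < t := by
    intro s t hs ht hsA htA hst
    have h1 := h.inner_ray_pos hs.1 hst (sub_ne_zero.2 hab) hsA htA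
    have h2 := hs.2
    have h3 := ht.2
    simp only [inner_sub_left] at h1 h2 h3
    linarith
  exact le_antisymm (not_lt.1 (key t s ht hs htA hsA)) (not_lt.1 (key s t hs ht hsA htA))

/-- Compare with `a + s₁ • (a - b₂)`, which is on the ray of the second reflection and, because `s₁
≤ s₂`, in `A`. By `inner_ray`, `s₂ - s₁` is controlled by the height difference between this point
and the second reflection; `inner_cross` bounds that difference by a multiple of `‖b₁ - b₂‖`. -/
theorem refl_lipschitz_left_aux (h : IsGaussChart A X e l L) {K : ℝ} (hK : 1 ≤ K)
    (hLK : L ≤ K * l) {a b₁ b₂ : E} {s₁ s₂ : ℝ} (ha : a ∈ A) (hb₁ : b₁ ∈ A) (hb₂ : b₂ ∈ A)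
    (hc₁ : a + s₁ • (a - b₁) ∈ A) (hc₂ : a + s₂ • (a - b₂) ∈ A) (h₁ : a ≠ b₁) (h₂ : a ≠ b₂)
    (hs₁ : Refl X a b₁ s₁) (hs₂ : Refl X a b₂ s₂) (h12 : s₁ ≤ s₂) :
    ‖(a + s₁ • (a - b₁)) - (a + s₂ • (a - b₂))‖ ≤ 40 * K ^ 4 * ‖b₁ - b₂‖ := by
  obtain ⟨l1, u1⟩ := h.refl_bounds hK hLK ha hb₁ hc₁ h₁ hs₁
  obtain ⟨l2, u2⟩ := h.refl_bounds hK hLK ha hb₂ hc₂ h₂ hs₂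
  have hs1 := hs₁.1
  have hs2 := hs₂.1
  have hl := h.pos
  have hcA : a + s₁ • (a - b₂) ∈ A := by
    have := h.convex ha hc₂ (a := 1 - s₁ / s₂) (b := s₁ / s₂)
      (by rw [sub_nonneg, div_le_one hs2]; exact h12) (by positivity) (by ring)
    convert this using 1
    rw [smul_add, smul_smul, div_mul_cancel₀ _ hs2.ne']
    module
  set Δ := ‖b₁ - b₂‖ with hΔ
  set β := ‖a - b₂‖ with hβ
  have hΔ0 : 0 ≤ Δ := norm_nonneg _
  have hβ0 : 0 ≤ β := norm_nonneg _
  have hab1 : ‖a - b₁‖ ≤ β + Δ := by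
    have : a - b₁ = (a - b₂) - (b₁ - b₂) := by abel
    rw [this]; exact norm_sub_le _ _
  have hK4 : K ≤ K ^ 4 := le_self_pow₀ hK (by norm_num)
  have hK24 : K ^ 2 ≤ K ^ 4 := pow_le_pow_right₀ hK (by norm_num)
  -- If `β < Δ`, both reflections are within a multiple of `Δ` of `a` and there is nothing to
  -- compare. Otherwise `‖a - b₁‖ ≤ 2 β`, and the quadratic estimates can be divided by `β`.
  rcases lt_or_ge β Δ with hlt | hge
  · have : (a + s₁ • (a - b₁)) - (a + s₂ • (a - b₂)) = s₁ • (a - b₁) - s₂ • (a - b₂) := by abel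
    rw [this]
    refine (norm_sub_le _ _).trans ?_
    rw [norm_smul, norm_smul, Real.norm_of_nonneg hs1.le, Real.norm_of_nonneg hs2.le]
    have i1 : s₁ * ‖a - b₁‖ ≤ 2 * K * (2 * Δ) := by gcongr; linarith
    have i2 : s₂ * ‖a - b₂‖ ≤ 2 * K * Δ := by gcongr
    have i3 : K * Δ ≤ K ^ 4 * Δ := by gcongr
    linarith [mul_nonneg (pow_nonneg (zero_le_one.trans hK) 4) hΔ0]
  · have hL0 : 0 ≤ L := by
      have h1 := h.inner_lower ha hb₁
      have h2 := h.inner_upper ha hb₁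
      have h3 : 0 < ‖a - b₁‖ ^ 2 := by
        have := norm_pos_iff.2 (sub_ne_zero.2 h₁); positivity
      by_contra hneg
      push Not at hneg
      nlinarith
    have ray := h.inner_ray hs1.le h12 hcA hc₂
    have x1 := h.inner_cross a hc₁ hcA
    have x2 := h.inner_cross a hb₂ hb₁
    have e1 : (a + s₁ • (a - b₂)) - (a + s₁ • (a - b₁)) = s₁ • (b₁ - b₂) := by module
    have e2 : a - (a + s₁ • (a - b₁)) = -(s₁ • (a - b₁)) := by abel
    rw [e1, e2, norm_neg, norm_smul, norm_smul, Real.norm_of_nonneg hs1.le] at x1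
    have e3 : ⟪X (a + s₁ • (a - b₂)) - X (a + s₂ • (a - b₂)), a⟫_ℝ =
        ⟪X (a + s₁ • (a - b₂)) - X (a + s₁ • (a - b₁)), a⟫_ℝ + ⟪X b₁ - X b₂, a⟫_ℝ := by
      have := hs₁.2
      have := hs₂.2
      simp only [inner_sub_left] at *
      linarith
    rw [e3] at ray
    have x1' := (abs_le.1 x1).2
    have x2' := (abs_le.1 x2).2
    rw [← hΔ] at x1' x2'
    rw [← hβ] at x2'
    have y1 : L * (s₁ * Δ) * (s₁ * ‖a - b₁‖ + s₁ * Δ) ≤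
        K * l * (2 * K * Δ) * (2 * K * (2 * β) + 2 * K * β) := by
      gcongr
      linarith
    have y2 : L * Δ * (β + Δ) ≤ K * l * Δ * (β + β) := by gcongr
    have y3 : l * ((s₂ - s₁) * s₁ * β ^ 2) ≤ l * (14 * K ^ 3 * Δ * β) := by
      have : K * l * Δ * (β + β) ≤ l * (2 * K ^ 3 * Δ * β) := by
        have : K ≤ K ^ 3 := le_self_pow₀ hK (by norm_num)
        have h5 : 0 ≤ l * Δ * β := by positivity
        nlinarith
      nlinarith
    have y4 := le_of_mul_le_mul_left y3 hl
    have hβpos : 0 < β := norm_pos_iff.2 (sub_ne_zero.2 h₂)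
    have y5 : (s₂ - s₁) * s₁ * β ≤ 14 * K ^ 3 * Δ := by
      have : ((s₂ - s₁) * s₁ * β) * β ≤ (14 * K ^ 3 * Δ) * β := by linarith
      exact le_of_mul_le_mul_right this hβpos
    -- The lower bound `1 ≤ 2 K s₁` removes the factor `s₁` at the price of one power of `K`.
    have y6 : (s₂ - s₁) * β ≤ 28 * K ^ 4 * Δ := by
      have h5 : 0 ≤ (s₂ - s₁) * β := mul_nonneg (by linarith) hβ0
      have h6 : (s₂ - s₁) * β * 1 ≤ (s₂ - s₁) * β * (2 * K * s₁) := by gcongr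
      have h7 : 2 * K * ((s₂ - s₁) * s₁ * β) ≤ 2 * K * (14 * K ^ 3 * Δ) := by gcongr
      have h8 : 2 * K * (14 * K ^ 3 * Δ) = 28 * K ^ 4 * Δ := by ring
      linarith
    have e4 : (a + s₁ • (a - b₁)) - (a + s₂ • (a - b₂)) =
        -(s₁ • (b₁ - b₂) + (s₂ - s₁) • (a - b₂)) := by module
    rw [e4, norm_neg]
    refine (norm_add_le _ _).trans ?_
    rw [norm_smul, norm_smul, Real.norm_of_nonneg hs1.le,
      Real.norm_of_nonneg (by linarith : 0 ≤ s₂ - s₁), ← hΔ, ← hβ]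
    have i1 : s₁ * Δ ≤ 2 * K * Δ := by gcongr
    have i2 : K * Δ ≤ K ^ 4 * Δ := by gcongr
    linarith [mul_nonneg (pow_nonneg (zero_le_one.trans hK) 4) hΔ0]

theorem refl_lipschitz_left (h : IsGaussChart A X e l L) {K : ℝ} (hK : 1 ≤ K)
    (hLK : L ≤ K * l) {a b₁ b₂ : E} {s₁ s₂ : ℝ} (ha : a ∈ A) (hb₁ : b₁ ∈ A) (hb₂ : b₂ ∈ A)
    (hc₁ : a + s₁ • (a - b₁) ∈ A) (hc₂ : a + s₂ • (a - b₂) ∈ A) (h₁ : a ≠ b₁) (h₂ : a ≠ b₂)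
    (hs₁ : Refl X a b₁ s₁) (hs₂ : Refl X a b₂ s₂) :
    ‖(a + s₁ • (a - b₁)) - (a + s₂ • (a - b₂))‖ ≤ 40 * K ^ 4 * ‖b₁ - b₂‖ := by
  rcases le_total s₁ s₂ with h12 | h12
  · exact h.refl_lipschitz_left_aux hK hLK ha hb₁ hb₂ hc₁ hc₂ h₁ h₂ hs₁ hs₂ h12
  · rw [norm_sub_rev, norm_sub_rev b₁]
    exact h.refl_lipschitz_left_aux hK hLK ha hb₂ hb₁ hc₂ hc₁ h₂ h₁ hs₂ hs₁ h12

/-- The same comparison, through `a₂ + s₁ • (a₂ - b)`. Moving the centre also changes the normal in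
the reflection condition, which produces the extra pairing with `a₂ - a₁`. -/
theorem refl_lipschitz_right_aux (h : IsGaussChart A X e l L) {K : ℝ} (hK : 1 ≤ K)
    (hLK : L ≤ K * l) {b a₁ a₂ : E} {s₁ s₂ : ℝ} (hb : b ∈ A) (ha₁ : a₁ ∈ A) (ha₂ : a₂ ∈ A)
    (hc₁ : a₁ + s₁ • (a₁ - b) ∈ A) (hc₂ : a₂ + s₂ • (a₂ - b) ∈ A) (h₁ : a₁ ≠ b) (h₂ : a₂ ≠ b)
    (hs₁ : Refl X a₁ b s₁) (hs₂ : Refl X a₂ b s₂) (h12 : s₁ ≤ s₂) :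
    ‖(a₁ + s₁ • (a₁ - b)) - (a₂ + s₂ • (a₂ - b))‖ ≤ 45 * K ^ 4 * ‖a₁ - a₂‖ := by
  obtain ⟨l1, u1⟩ := h.refl_bounds hK hLK ha₁ hb hc₁ h₁ hs₁
  obtain ⟨l2, u2⟩ := h.refl_bounds hK hLK ha₂ hb hc₂ h₂ hs₂
  have hs1 := hs₁.1
  have hs2 := hs₂.1
  have hl := h.pos
  have hcA : a₂ + s₁ • (a₂ - b) ∈ A := by
    have := h.convex ha₂ hc₂ (a := 1 - s₁ / s₂) (b := s₁ / s₂)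
      (by rw [sub_nonneg, div_le_one hs2]; exact h12) (by positivity) (by ring)
    convert this using 1
    rw [smul_add, smul_smul, div_mul_cancel₀ _ hs2.ne']
    module
  set Δ := ‖a₁ - a₂‖ with hΔ
  set β := ‖a₂ - b‖ with hβ
  have hΔ0 : 0 ≤ Δ := norm_nonneg _
  have hβ0 : 0 ≤ β := norm_nonneg _
  have hab1 : ‖a₁ - b‖ ≤ β + Δ := by
    have : a₁ - b = (a₂ - b) + (a₁ - a₂) := by abel
    rw [this]; exact norm_add_le _ _
  have hK4 : K ≤ K ^ 4 := le_self_pow₀ hK (by norm_num)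
  have hK24 : K ^ 2 ≤ K ^ 4 := pow_le_pow_right₀ hK (by norm_num)
  have hK0 : 0 < K := by linarith
  rcases lt_or_ge β Δ with hlt | hge
  · have : (a₁ + s₁ • (a₁ - b)) - (a₂ + s₂ • (a₂ - b)) =
        (1 + s₁) • (a₁ - b) - (1 + s₂) • (a₂ - b) := by module
    rw [this]
    refine (norm_sub_le _ _).trans ?_
    rw [norm_smul, norm_smul, Real.norm_of_nonneg (by linarith), Real.norm_of_nonneg (by linarith)]
    have i1 : (1 + s₁) * ‖a₁ - b‖ ≤ 3 * K * (2 * Δ) := by gcongr <;> linarith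
    have i2 : (1 + s₂) * ‖a₂ - b‖ ≤ 3 * K * Δ := by
      rw [← hβ]; gcongr; linarith
    have i3 : K * Δ ≤ K ^ 4 * Δ := by gcongr
    linarith [mul_nonneg (pow_nonneg (zero_le_one.trans hK) 4) hΔ0]
  · have hL0 : 0 ≤ L := by
      have h1 := h.inner_lower ha₁ hb
      have h2 := h.inner_upper ha₁ hb
      have h3 : 0 < ‖a₁ - b‖ ^ 2 := by
        have := norm_pos_iff.2 (sub_ne_zero.2 h₁); positivity
      by_contra hneg
      push Not at hneg
      nlinarith
    have ray := h.inner_ray hs1.le h12 hcA hc₂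
    have x1 := h.inner_cross a₂ hcA hc₁
    have e1 : (a₁ + s₁ • (a₁ - b)) - (a₂ + s₁ • (a₂ - b)) = (1 + s₁) • (a₁ - a₂) := by module
    have e2 : a₂ - (a₂ + s₁ • (a₂ - b)) = -(s₁ • (a₂ - b)) := by abel
    rw [e1, e2, norm_neg, norm_smul, norm_smul, Real.norm_of_nonneg hs1.le,
      Real.norm_of_nonneg (by linarith), ← hΔ, ← hβ] at x1
    have x2 := abs_real_inner_le_norm (X (a₁ + s₁ • (a₁ - b)) - X b) (a₂ - a₁)
    have x3 := h.lip _ hc₁ b hb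
    have e4 : (a₁ + s₁ • (a₁ - b)) - b = (1 + s₁) • (a₁ - b) := by module
    rw [e4, norm_smul, Real.norm_of_nonneg (by linarith)] at x3
    rw [norm_sub_rev a₂ a₁, ← hΔ] at x2
    have e3 : ⟪X (a₂ + s₁ • (a₂ - b)) - X (a₂ + s₂ • (a₂ - b)), a₂⟫_ℝ =
        -⟪X (a₁ + s₁ • (a₁ - b)) - X (a₂ + s₁ • (a₂ - b)), a₂⟫_ℝ +
        ⟪X (a₁ + s₁ • (a₁ - b)) - X b, a₂ - a₁⟫_ℝ := by
      have := hs₁.2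
      have := hs₂.2
      simp only [inner_sub_left, inner_sub_right] at *
      linarith
    rw [e3] at ray
    have x1' := (abs_le.1 x1).1
    have x2' := (abs_le.1 x2).2
    have y1 : L * ((1 + s₁) * Δ) * (s₁ * β + (1 + s₁) * Δ) ≤
        K * l * (3 * K * Δ) * (2 * K * β + 3 * K * β) := by
      gcongr <;> linarith
    have y2 : ‖X (a₁ + s₁ • (a₁ - b)) - X b‖ * Δ ≤ K * l * (3 * K * (β + β)) * Δ := by
      have i1 : L * ((1 + s₁) * ‖a₁ - b‖) ≤ K * l * (3 * K * (β + β)) := by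
        gcongr <;> linarith
      gcongr
      linarith
    have y3 : l * ((s₂ - s₁) * s₁ * β ^ 2) ≤ l * (21 * K ^ 3 * Δ * β) := by
      have : K * l * (3 * K * (β + β)) * Δ ≤ l * (6 * K ^ 3 * Δ * β) := by
        have : K ^ 2 ≤ K ^ 3 := pow_le_pow_right₀ hK (by norm_num)
        have h5 : 0 ≤ l * Δ * β := by positivity
        nlinarith
      nlinarith
    have y4 := le_of_mul_le_mul_left y3 hl
    have hβpos : 0 < β := norm_pos_iff.2 (sub_ne_zero.2 h₂)
    have y5 : (s₂ - s₁) * s₁ * β ≤ 21 * K ^ 3 * Δ := by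
      have : ((s₂ - s₁) * s₁ * β) * β ≤ (21 * K ^ 3 * Δ) * β := by linarith
      exact le_of_mul_le_mul_right this hβpos
    have y6 : (s₂ - s₁) * β ≤ 42 * K ^ 4 * Δ := by
      have h5 : 0 ≤ (s₂ - s₁) * β := mul_nonneg (by linarith) hβ0
      have h6 : (s₂ - s₁) * β * 1 ≤ (s₂ - s₁) * β * (2 * K * s₁) := by gcongr
      have h7 : 2 * K * ((s₂ - s₁) * s₁ * β) ≤ 2 * K * (21 * K ^ 3 * Δ) := by gcongr
      have h8 : 2 * K * (21 * K ^ 3 * Δ) = 42 * K ^ 4 * Δ := by ring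
      linarith
    have e5 : (a₁ + s₁ • (a₁ - b)) - (a₂ + s₂ • (a₂ - b)) =
        (1 + s₁) • (a₁ - a₂) - (s₂ - s₁) • (a₂ - b) := by module
    rw [e5]
    refine (norm_sub_le _ _).trans ?_
    rw [norm_smul, norm_smul, Real.norm_of_nonneg (by linarith : 0 ≤ 1 + s₁),
      Real.norm_of_nonneg (by linarith : 0 ≤ s₂ - s₁), ← hΔ, ← hβ]
    have i1 : (1 + s₁) * Δ ≤ 3 * K * Δ := by gcongr; linarith
    have i2 : K * Δ ≤ K ^ 4 * Δ := by gcongr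
    linarith

theorem refl_lipschitz_right (h : IsGaussChart A X e l L) {K : ℝ} (hK : 1 ≤ K)
    (hLK : L ≤ K * l) {b a₁ a₂ : E} {s₁ s₂ : ℝ} (hb : b ∈ A) (ha₁ : a₁ ∈ A) (ha₂ : a₂ ∈ A)
    (hc₁ : a₁ + s₁ • (a₁ - b) ∈ A) (hc₂ : a₂ + s₂ • (a₂ - b) ∈ A) (h₁ : a₁ ≠ b) (h₂ : a₂ ≠ b)
    (hs₁ : Refl X a₁ b s₁) (hs₂ : Refl X a₂ b s₂) :
    ‖(a₁ + s₁ • (a₁ - b)) - (a₂ + s₂ • (a₂ - b))‖ ≤ 45 * K ^ 4 * ‖a₁ - a₂‖ := by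
  rcases le_total s₁ s₂ with h12 | h12
  · exact h.refl_lipschitz_right_aux hK hLK hb ha₁ ha₂ hc₁ hc₂ h₁ h₂ hs₁ hs₂ h12
  · rw [norm_sub_rev, norm_sub_rev a₁]
    exact h.refl_lipschitz_right_aux hK hLK hb ha₂ ha₁ hc₂ hc₁ h₂ h₁ hs₂ hs₁ h12

end IsGaussChart

end Chart

end SurfaceMaximal

end

/-! ### Level sets of smooth functions: curves in them and their unit normals. -/

noncomputable section

namespace SurfaceMaximal

section LocalGeometry

open Filter Topology Set

variable {E : Type*} [NormedAddCommGroup E] [InnerProductSpace ℝ E]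

/-- One-sided, because at a boundary point of a surface a curve may enter it for positive times
only. -/
theorem _root_.HasFDerivWithinAt.comp_curve {F : Type*} [NormedAddCommGroup F] [NormedSpace ℝ F]
    {f : E → F} {L : E →L[ℝ] F} {s : Set E} {γ : ℝ → E} {w : E}
    (hf : HasFDerivWithinAt f L s (γ 0)) (hγ : HasDerivAt γ w 0)
    (hs : ∀ᶠ t in 𝓝[>] (0 : ℝ), γ t ∈ s) : HasDerivWithinAt (f ∘ γ) (L w) (Ioi 0) 0 := by
  have h1 : HasDerivWithinAt γ w (Ioi 0 ∩ γ ⁻¹' s) 0 := hγ.hasDerivWithinAt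
  have h2 : HasDerivWithinAt (f ∘ γ) (L w) (Ioi 0 ∩ γ ⁻¹' s) 0 :=
    hf.comp_hasDerivWithinAt 0 h1 (fun t ht => ht.2)
  refine h2.mono_of_mem_nhdsWithin ?_
  filter_upwards [hs, self_mem_nhdsWithin] with t h1 h2 using ⟨h2, h1⟩

/-- Two derivatives within a set agree along curves in the set. -/
theorem _root_.HasFDerivWithinAt.eq_of_curve {F : Type*} [NormedAddCommGroup F] [NormedSpace ℝ F]
    {f : E → F} {L L' : E →L[ℝ] F} {s : Set E} {γ : ℝ → E} {w : E}
    (hf : HasFDerivWithinAt f L s (γ 0)) (hf' : HasFDerivWithinAt f L' s (γ 0))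
    (hγ : HasDerivAt γ w 0) (hs : ∀ᶠ t in 𝓝[>] (0 : ℝ), γ t ∈ s) : L w = L' w :=
  (uniqueDiffWithinAt_Ioi 0).eq_deriv _ (hf.comp_curve hγ hs) (hf'.comp_curve hγ hs)

variable [FiniteDimensional ℝ E]

/-- The curve is the image of the line `t • w` in the kernel under the implicit function, whose
derivative at `0` is the inclusion of the kernel. -/
theorem exists_level_curve {F : E → ℝ} {F' : E →L[ℝ] ℝ} {p w : E} (hF : HasStrictFDerivAt F F' p)
    (hF' : F' ≠ 0) (hw : F' w = 0) :
    ∃ γ : ℝ → E, γ 0 = p ∧ HasDerivAt γ w 0 ∧ ∀ᶠ t in 𝓝 (0 : ℝ), F (γ t) = F p := by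
  have hsurj : F'.range = ⊤ := by
    rw [LinearMap.range_eq_top]
    apply LinearMap.surjective
    intro h0
    apply hF'
    ext v
    exact congrArg (fun f : E →ₗ[ℝ] ℝ => f v) h0
  let w' : F'.ker := ⟨w, hw⟩
  have hline : HasDerivAt (fun t : ℝ => t • w') w' 0 := by
    simpa using (hasDerivAt_id (0 : ℝ)).smul_const w'
  refine ⟨fun t => hF.implicitFunction F F' hsurj (F p) (t • w'), ?_, ?_, ?_⟩
  · simp
  · have h := (hF.to_implicitFunction hsurj).hasFDerivAt
    have h2 := HasFDerivAt.comp_hasDerivAt (x := (0 : ℝ)) (f := fun t : ℝ => t • w')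
      (l := hF.implicitFunction F F' hsurj (F p)) (by simpa using h) hline
    simpa [Function.comp_def, w'] using h2
  · have h := hF.map_implicitFunction_eq hsurj
    have hc : Tendsto (fun t : ℝ => ((F p, t • w') : ℝ × F'.ker)) (𝓝 0) (𝓝 (F p, 0)) := by
      have : Continuous (fun t : ℝ => ((F p, t • w') : ℝ × F'.ker)) := by fun_prop
      simpa using this.tendsto 0
    exact hc.eventually h

/-- The unit normal field of the level sets of `F`. -/
def unitNormal (F : E → ℝ) (x : E) : E := ‖gradient F x‖⁻¹ • gradient F x

theorem norm_unitNormal {F : E → ℝ} {x : E} (h : gradient F x ≠ 0) : ‖unitNormal F x‖ = 1 := by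
  rw [unitNormal, norm_smul, norm_inv, norm_norm, inv_mul_cancel₀ (norm_ne_zero_iff.2 h)]

theorem contDiffAt_gradient {F : E → ℝ} {p : E} (hF : ContDiffAt ℝ ∞ F p) :
    ContDiffAt ℝ 1 (gradient F) p := by
  have h1 : ContDiffAt ℝ 1 (fderiv ℝ F) p := hF.fderiv_right (m := 1) (by norm_cast)
  have : gradient F = fun x => (InnerProductSpace.toDual ℝ E).symm (fderiv ℝ F x) := rfl
  rw [this]
  exact ((InnerProductSpace.toDual ℝ E).symm.contDiff (n := 1)).contDiffAt.comp p h1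

theorem contDiffAt_unitNormal {F : E → ℝ} {p : E} (hF : ContDiffAt ℝ ∞ F p)
    (h0 : gradient F p ≠ 0) : ContDiffAt ℝ 1 (unitNormal F) p := by
  have h := contDiffAt_gradient hF
  exact ((h.norm ℝ h0).inv (norm_ne_zero_iff.2 h0)).smul h

theorem inner_gradient_eq (F : E → ℝ) (x v : E) : ⟪gradient F x, v⟫_ℝ = fderiv ℝ F x v := by
  simp [gradient]

theorem inner_fderiv_unitNormal_self {F : E → ℝ} {p : E} (hF : ContDiffAt ℝ ∞ F p)
    (h0 : gradient F p ≠ 0) (v : E) : ⟪fderiv ℝ (unitNormal F) p v, unitNormal F p⟫_ℝ = 0 := by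
  have hd : HasFDerivAt (unitNormal F) (fderiv ℝ (unitNormal F) p) p :=
    ((contDiffAt_unitNormal hF h0).differentiableAt (by norm_num)).hasFDerivAt
  have h1 := hd.inner ℝ hd
  have hev : (fun x => ⟪unitNormal F x, unitNormal F x⟫_ℝ) =ᶠ[𝓝 p] fun _ => (1 : ℝ) := by
    have hne : ∀ᶠ x in 𝓝 p, gradient F x ≠ 0 :=
      (contDiffAt_gradient hF).continuousAt.eventually_ne h0
    filter_upwards [hne] with x hx
    rw [real_inner_self_eq_norm_sq, norm_unitNormal hx, one_pow]
  have h2 := (hasFDerivAt_const (𝕜 := ℝ) (1 : ℝ) p).congr_of_eventuallyEq hev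
  have h3 := congrArg (fun L : E →L[ℝ] ℝ => L v) (HasFDerivAt.unique h1 h2)
  simp [real_inner_comm] at h3
  rw [real_inner_comm]
  linarith

/-- In the product rule the derivative of `‖∇F‖⁻¹` is multiplied by `⟪∇F, w⟫ = 0`, so only the
Hessian survives; its symmetry will be that of the shape operator. -/
theorem inner_fderiv_unitNormal {F : E → ℝ} {p : E} (hF : ContDiffAt ℝ ∞ F p)
    (h0 : gradient F p ≠ 0) (v : E) {w : E} (hw : ⟪gradient F p, w⟫_ℝ = 0) :
    ⟪fderiv ℝ (unitNormal F) p v, w⟫_ℝ = ‖gradient F p‖⁻¹ * fderiv ℝ (fderiv ℝ F) p v w := by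
  have hg := contDiffAt_gradient hF
  have hn : HasFDerivAt (fun x => ‖gradient F x‖⁻¹) (fderiv ℝ (fun x => ‖gradient F x‖⁻¹) p) p :=
    (((hg.norm ℝ h0).inv (norm_ne_zero_iff.2 h0)).differentiableAt (by norm_num)).hasFDerivAt
  have h1 : HasFDerivAt (fderiv ℝ F) (fderiv ℝ (fderiv ℝ F) p) p :=
    ((hF.fderiv_right (m := 1) (by norm_cast)).differentiableAt (by norm_num)).hasFDerivAt
  have h2 : HasFDerivAt (fun x => ⟪unitNormal F x, w⟫_ℝ)
      (‖gradient F p‖⁻¹ • (ContinuousLinearMap.apply ℝ ℝ w ∘L fderiv ℝ (fderiv ℝ F) p) +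
        fderiv ℝ F p w • fderiv ℝ (fun x => ‖gradient F x‖⁻¹) p) p := by
    have : (fun x => ⟪unitNormal F x, w⟫_ℝ) = fun x => ‖gradient F x‖⁻¹ * fderiv ℝ F x w := by
      funext x
      rw [unitNormal, real_inner_smul_left, inner_gradient_eq]
    rw [this]
    exact hn.mul ((ContinuousLinearMap.apply ℝ ℝ w).hasFDerivAt.comp p h1)
  have hd : HasFDerivAt (unitNormal F) (fderiv ℝ (unitNormal F) p) p :=
    ((contDiffAt_unitNormal hF h0).differentiableAt (by norm_num)).hasFDerivAt
  have h3 := hd.inner ℝ (hasFDerivAt_const w p)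
  have h4 := congrArg (fun L : E →L[ℝ] ℝ => L v) (h3.unique h2)
  rw [inner_gradient_eq] at hw
  simpa [hw] using h4

theorem fderiv_unitNormal_symm {F : E → ℝ} {p : E} (hF : ContDiffAt ℝ ∞ F p)
    (h0 : gradient F p ≠ 0) {v w : E} (hv : ⟪gradient F p, v⟫_ℝ = 0)
    (hw : ⟪gradient F p, w⟫_ℝ = 0) :
    ⟪fderiv ℝ (unitNormal F) p v, w⟫_ℝ = ⟪v, fderiv ℝ (unitNormal F) p w⟫_ℝ := by
  rw [real_inner_comm _ v, inner_fderiv_unitNormal hF h0 v hw, inner_fderiv_unitNormal hF h0 w hv]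
  have := hF.isSymmSndFDerivAt (by simp; norm_cast)
  rw [this.eq v w]

end LocalGeometry

end SurfaceMaximal

end

/-! ### Local structure of `S`, its shape operator and the inverse Gauss map. -/

noncomputable section

namespace SurfaceMaximal

section Hypersurface

open Filter Topology Set

variable {n : ℕ} {S : Set (Eucl n)} {N : Eucl n → Eucl n}

/-- `w` is the velocity at `p` of a curve running into `S`. -/
def IsCurveDirection (S : Set (Eucl n)) (p w : Eucl n) : Prop :=
  ∃ γ : ℝ → Eucl n, γ 0 = p ∧ HasDerivAt γ w 0 ∧ ∀ᶠ t in 𝓝[>] (0 : ℝ), γ t ∈ S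

/-- `F` is a local defining function of `S` near `p`; up to a multiple of a fixed vector all tangent
vectors are directions of curves in `S`. -/
structure IsDefiningFunction (S : Set (Eucl n)) (N : Eucl n → Eucl n) (p : Eucl n)
    (F : Eucl n → ℝ) : Prop where
  contDiffAt : ContDiffAt ℝ ∞ F p
  gradient_ne : gradient F p ≠ 0
  eq_zero : F p = 0
  eventually_eq : ∀ᶠ x in 𝓝[S] p, F x = 0 ∧ N x = unitNormal F x
  curve : ∃ w₀ : Eucl n, ⟪gradient F p, w₀⟫_ℝ = 0 ∧ ∀ w : Eucl n, ⟪gradient F p, w⟫_ℝ = 0 →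
    ∀ᶠ t : ℝ in atTop, IsCurveDirection S p (w + t • w₀)

theorem fderiv_ne_zero_of_gradient {F : Eucl n → ℝ} {p : Eucl n} (h : gradient F p ≠ 0) :
    fderiv ℝ F p ≠ 0 := by
  intro h0
  apply h
  simp [gradient, h0]

theorem IsHypersurface.exists_definingFunction (h : IsHypersurface S N) {p : Eucl n} (hp : p ∈ S) :
    ∃ F, IsDefiningFunction S N p F ∧ ∀ᶠ x in 𝓝 p, F x = 0 → x ∈ S := by
  obtain ⟨V, F, hV, hpV, hF, hSV, hN⟩ := h p hp
  have hVp : V ∈ 𝓝 p := hV.mem_nhds hpV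
  have hFp : ContDiffAt ℝ ∞ F p := hF.contDiffAt hVp
  have mem : ∀ x, x ∈ V → (x ∈ S ↔ F x = 0) := by
    intro x hx
    have : x ∈ S ∩ V ↔ x ∈ {x ∈ V | F x = 0} := by rw [hSV]
    simpa [hx] using this
  have h0 := (hN p ⟨hp, hpV⟩).1
  have hFp0 : F p = 0 := (mem p hpV).1 hp
  refine ⟨F, ⟨hFp, h0, hFp0, ?_, 0, by simp, ?_⟩, ?_⟩
  · filter_upwards [self_mem_nhdsWithin, mem_nhdsWithin_of_mem_nhds hVp] with x hx hxV
    exact ⟨(mem x hxV).1 hx, (hN x ⟨hx, hxV⟩).2⟩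
  · intro w hw
    refine Eventually.of_forall fun t => ?_
    rw [inner_gradient_eq] at hw
    obtain ⟨γ, h1, h2, h3⟩ := exists_level_curve (hFp.hasStrictFDerivAt (by norm_num))
      (fderiv_ne_zero_of_gradient h0) hw
    refine ⟨γ, h1, by simpa using h2, ?_⟩
    have hγV : ∀ᶠ t in 𝓝 (0 : ℝ), γ t ∈ V := h2.continuousAt (by rw [h1]; exact hVp)
    filter_upwards [mem_nhdsWithin_of_mem_nhds h3, mem_nhdsWithin_of_mem_nhds hγV] with t h3 h4
    exact (mem _ h4).2 (h3.trans hFp0)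
  · filter_upwards [hVp] with x hx h using (mem x hx).2 h

/-- At a boundary point take for `w₀` the component of `∇G` orthogonal to `∇F`, nonzero by linear
independence. `G` grows along `w₀`, so `w + t • w₀` points into `S` for large `t`, whatever the
tangent vector `w`. Where `G p > 0`, `w₀ = 0` serves. -/
theorem IsHypersurfaceWithBoundary.exists_definingFunction (h : IsHypersurfaceWithBoundary S N)
    {p : Eucl n} (hp : p ∈ S) : ∃ F, IsDefiningFunction S N p F := by
  obtain ⟨V, F, G, hV, hpV, hF, hG, hSV, hN⟩ := h p hp
  have hVp : V ∈ 𝓝 p := hV.mem_nhds hpV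
  have hFp : ContDiffAt ℝ ∞ F p := hF.contDiffAt hVp
  have hGp : ContDiffAt ℝ ∞ G p := hG.contDiffAt hVp
  have mem : ∀ x, x ∈ V → (x ∈ S ↔ F x = 0 ∧ 0 ≤ G x) := by
    intro x hx
    have : x ∈ S ∩ V ↔ x ∈ {x ∈ V | F x = 0 ∧ 0 ≤ G x} := by rw [hSV]
    simpa [hx] using this
  obtain ⟨h0, -, hlin⟩ := hN p ⟨hp, hpV⟩
  obtain ⟨hFp0, hGp0⟩ := (mem p hpV).1 hp
  have hcurve : ∀ w : Eucl n, ⟪gradient F p, w⟫_ℝ = 0 → (0 < G p ∨ 0 < ⟪gradient G p, w⟫_ℝ) →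
      IsCurveDirection S p w := by
    intro w hw hwG
    rw [inner_gradient_eq] at hw
    obtain ⟨γ, h1, h2, h3⟩ := exists_level_curve (hFp.hasStrictFDerivAt (by norm_num))
      (fderiv_ne_zero_of_gradient h0) hw
    refine ⟨γ, h1, h2, ?_⟩
    have hγV : ∀ᶠ t in 𝓝 (0 : ℝ), γ t ∈ V := h2.continuousAt (by rw [h1]; exact hVp)
    have hGγ : ∀ᶠ t in 𝓝[>] (0 : ℝ), 0 ≤ G (γ t) := by
      rcases hwG with hpos | hpos
      · have : ContinuousAt (G ∘ γ) 0 :=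
          ContinuousAt.comp (by rw [h1]; exact hGp.continuousAt) h2.continuousAt
        have := this.eventually_const_lt (u := 0) (by simpa [h1] using hpos)
        filter_upwards [mem_nhdsWithin_of_mem_nhds this] with t ht using ht.le
      · have hd : HasDerivAt (G ∘ γ) ⟪gradient G p, w⟫_ℝ 0 := by
          rw [inner_gradient_eq]
          refine HasFDerivAt.comp_hasDerivAt (x := (0 : ℝ)) ?_ h2
          rw [h1]
          exact (hGp.differentiableAt (by norm_num)).hasFDerivAt
        have := (hasDerivAt_iff_tendsto_slope.1 hd).mono_left
          (nhdsWithin_mono _ (fun t ht => ne_of_gt ht : Ioi (0 : ℝ) ⊆ {0}ᶜ))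
        filter_upwards [this.eventually_const_lt hpos, self_mem_nhdsWithin] with t ht ht0
        rw [slope_def_field, Function.comp_apply, Function.comp_apply, h1, sub_zero,
          lt_div_iff₀ ht0] at ht
        linarith
    filter_upwards [mem_nhdsWithin_of_mem_nhds h3, mem_nhdsWithin_of_mem_nhds hγV, hGγ]
      with t h3 h4 h5
    exact (mem _ h4).2 ⟨h3.trans hFp0, h5⟩
  refine ⟨F, hFp, h0, hFp0, ?_, ?_⟩
  · filter_upwards [self_mem_nhdsWithin, mem_nhdsWithin_of_mem_nhds hVp] with x hx hxV
    exact ⟨((mem x hxV).1 hx).1, (hN x ⟨hx, hxV⟩).2.1⟩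
  · rcases hGp0.eq_or_lt with hG0 | hpos
    · have hli := hlin hG0.symm
      set f := gradient F p
      set g := gradient G p
      set w₀ := g - (⟪f, g⟫_ℝ / ‖f‖ ^ 2) • f with hw₀
      have hf0 : ‖f‖ ^ 2 ≠ 0 := by have := norm_ne_zero_iff.2 h0; positivity
      have hfw : ⟪f, w₀⟫_ℝ = 0 := by
        rw [hw₀, inner_sub_right, inner_smul_right, real_inner_self_eq_norm_sq]
        field_simp
        ring
      have hw0 : w₀ ≠ 0 := by
        intro hz
        rw [LinearIndependent.pair_iff] at hli
        have := hli (-(⟪f, g⟫_ℝ / ‖f‖ ^ 2)) 1 (by rw [← hz, hw₀]; module)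
        exact one_ne_zero this.2
      have hgw : 0 < ⟪g, w₀⟫_ℝ := by
        have : g = w₀ + (⟪f, g⟫_ℝ / ‖f‖ ^ 2) • f := by rw [hw₀]; abel
        rw [this, inner_add_left, real_inner_smul_left, hfw, mul_zero, add_zero]
        exact real_inner_self_pos.2 hw0
      refine ⟨w₀, hfw, fun w hw => ?_⟩
      have : Tendsto (fun t : ℝ => ⟪g, w⟫_ℝ + t * ⟪g, w₀⟫_ℝ) atTop atTop :=
        tendsto_atTop_add_const_left _ _ (tendsto_id.atTop_mul_const hgw)
      filter_upwards [this.eventually_gt_atTop 0] with t ht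
      refine hcurve _ ?_ (Or.inr ?_)
      · rw [inner_add_right, inner_smul_right, hw, hfw]; simp
      · rw [inner_add_right, inner_smul_right]; exact ht
    · exact ⟨0, by simp, fun w hw => Eventually.of_forall fun t =>
        hcurve _ (by simpa using hw) (Or.inl hpos)⟩

namespace IsDefiningFunction

variable {p : Eucl n} {F : Eucl n → ℝ}

theorem hasStrictFDerivAt_unitNormal (h : IsDefiningFunction S N p F) :
    HasStrictFDerivAt (unitNormal F) (fderiv ℝ (unitNormal F) p) p :=
  (contDiffAt_unitNormal h.contDiffAt h.gradient_ne).hasStrictFDerivAt (by norm_num)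

theorem normal_eq (h : IsDefiningFunction S N p F) (hp : p ∈ S) : N p = unitNormal F p :=
  (h.eventually_eq.self_of_nhdsWithin hp).2

theorem norm_normal (h : IsDefiningFunction S N p F) (hp : p ∈ S) : ‖N p‖ = 1 := by
  rw [h.normal_eq hp, norm_unitNormal h.gradient_ne]

theorem gradient_eq (h : IsDefiningFunction S N p F) (hp : p ∈ S) :
    gradient F p = ‖gradient F p‖ • N p := by
  rw [h.normal_eq hp, unitNormal, smul_smul, mul_inv_cancel₀ (norm_ne_zero_iff.2 h.gradient_ne),
    one_smul]

theorem inner_gradient_eq_zero_iff (h : IsDefiningFunction S N p F) (hp : p ∈ S) {w : Eucl n} :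
    ⟪gradient F p, w⟫_ℝ = 0 ↔ ⟪N p, w⟫_ℝ = 0 := by
  rw [h.gradient_eq hp, real_inner_smul_left, mul_eq_zero]
  simp [h.gradient_ne]

theorem hasFDerivWithinAt_normal (h : IsDefiningFunction S N p F) (hp : p ∈ S) :
    HasFDerivWithinAt N (fderiv ℝ (unitNormal F) p) S p :=
  h.hasStrictFDerivAt_unitNormal.hasFDerivAt.hasFDerivWithinAt.congr_of_eventuallyEq
    (h.eventually_eq.mono fun _ hx => hx.2) (h.normal_eq hp)

/-- Two derivatives within `S` agree on velocities of curves in `S`. At a boundary point `w` need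
not be one, but `w + a • w₀` and `w + (a + 1) • w₀` are for large `a`; subtracting gives agreement
on `w₀`, then on `w`. -/
theorem shapeOperator_apply (h : IsDefiningFunction S N p F) (hp : p ∈ S) {w : Eucl n}
    (hw : ⟪N p, w⟫_ℝ = 0) : shapeOperator S N p w = fderiv ℝ (unitNormal F) p w := by
  have h1 := h.hasFDerivWithinAt_normal hp
  have h2 : HasFDerivWithinAt N (shapeOperator S N p) S p :=
    h1.differentiableWithinAt.hasFDerivWithinAt
  obtain ⟨w₀, -, hw₀⟩ := h.curve
  have h3 := hw₀ w ((h.inner_gradient_eq_zero_iff hp).2 hw)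
  have key : ∀ v, IsCurveDirection S p v →
      shapeOperator S N p v = fderiv ℝ (unitNormal F) p v := by
    rintro v ⟨γ, rfl, hγ, hγS⟩
    exact h2.eq_of_curve h1 hγ hγS
  obtain ⟨a, ha⟩ := Filter.eventually_atTop.1 h3
  have e1 := key _ (ha a le_rfl)
  have e2 := key _ (ha (a + 1) (by linarith))
  simp only [map_add, map_smul, add_smul, one_smul] at e1 e2
  have e3 : shapeOperator S N p w₀ = fderiv ℝ (unitNormal F) p w₀ := by
    rw [← add_assoc, ← add_assoc, e1] at e2
    exact add_left_cancel e2
  rw [e3] at e1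
  exact add_right_cancel e1

theorem inner_shapeOperator_normal (h : IsDefiningFunction S N p F) (hp : p ∈ S) {w : Eucl n}
    (hw : ⟪N p, w⟫_ℝ = 0) : ⟪N p, shapeOperator S N p w⟫_ℝ = 0 := by
  rw [h.shapeOperator_apply hp hw, h.normal_eq hp, real_inner_comm]
  exact inner_fderiv_unitNormal_self h.contDiffAt h.gradient_ne w

theorem shapeOperator_symm (h : IsDefiningFunction S N p F) (hp : p ∈ S) {v w : Eucl n}
    (hv : ⟪N p, v⟫_ℝ = 0) (hw : ⟪N p, w⟫_ℝ = 0) :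
    ⟪shapeOperator S N p v, w⟫_ℝ = ⟪v, shapeOperator S N p w⟫_ℝ := by
  rw [h.shapeOperator_apply hp hv, h.shapeOperator_apply hp hw]
  exact fderiv_unitNormal_symm h.contDiffAt h.gradient_ne
    ((h.inner_gradient_eq_zero_iff hp).2 hv) ((h.inner_gradient_eq_zero_iff hp).2 hw)

end IsDefiningFunction

theorem mem_tangentSpace {u w : Eucl n} : w ∈ tangentSpace N u ↔ ⟪N u, w⟫_ℝ = 0 := by
  rw [tangentSpace, Submodule.mem_orthogonal_singleton_iff_inner_right]

namespace IsStrictlyConvexSurface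

theorem exists_definingFunction (hS : IsStrictlyConvexSurface S N) {p : Eucl n} (hp : p ∈ S) :
    ∃ F, IsDefiningFunction S N p F ∧ (IsCompact S ∨ ∀ᶠ x in 𝓝 p, F x = 0 → x ∈ S) := by
  rcases hS.smooth with h | ⟨hc, h⟩
  · obtain ⟨F, h1, h2⟩ := h.exists_definingFunction hp
    exact ⟨F, h1, Or.inr h2⟩
  · obtain ⟨F, h1⟩ := h.exists_definingFunction hp
    exact ⟨F, h1, Or.inl hc⟩

theorem norm_normal (hS : IsStrictlyConvexSurface S N) {p : Eucl n} (hp : p ∈ S) : ‖N p‖ = 1 := by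
  obtain ⟨F, h, -⟩ := hS.exists_definingFunction hp
  exact h.norm_normal hp

theorem continuousOn_normal (hS : IsStrictlyConvexSurface S N) : ContinuousOn N S := by
  intro p hp
  obtain ⟨F, h, -⟩ := hS.exists_definingFunction hp
  exact (h.hasFDerivWithinAt_normal hp).continuousWithinAt

/-- The Gauss map extends near each point of `S` to a local diffeomorphism of `ℝⁿ`, which can be
chosen to take values off the unit sphere outside of `S` if there is no boundary. -/
theorem exists_gauss_extension (hS : IsStrictlyConvexSurface S N) {p : Eucl n} (hp : p ∈ S) :
    ∃ (Φ : Eucl n → Eucl n) (Φ' : Eucl n ≃L[ℝ] Eucl n),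
      HasStrictFDerivAt Φ (Φ' : Eucl n →L[ℝ] Eucl n) p ∧ (∀ᶠ x in 𝓝[S] p, Φ x = N x) ∧
      (∀ w, ⟪N p, w⟫_ℝ = 0 → Φ' w = shapeOperator S N p w) ∧
      (∀ w, ⟪N p, Φ' w⟫_ℝ = 0 → ⟪N p, w⟫_ℝ = 0) ∧
      (IsCompact S ∨ ∀ᶠ x in 𝓝 p, ‖Φ x‖ = 1 → x ∈ S) := by
  obtain ⟨F, h, hc⟩ := hS.exists_definingFunction hp
  have hF : HasStrictFDerivAt F (fderiv ℝ F p) p := h.contDiffAt.hasStrictFDerivAt (by norm_num)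
  set D := fderiv ℝ (unitNormal F) p with hD
  have hG : HasStrictFDerivAt (unitNormal F) D p := h.hasStrictFDerivAt_unitNormal
  -- The factor `1 + F` makes the derivative invertible across `S` and makes `‖Φ x‖ = 1` equivalent
  -- to `F x = 0` near `p`.
  let Φ : Eucl n → Eucl n := fun x => (1 + F x) • unitNormal F x
  let M : Eucl n →L[ℝ] Eucl n := D + (fderiv ℝ F p).smulRight (N p)
  have hΦ : HasStrictFDerivAt Φ M p := by
    have := (hF.const_add 1).smul hG
    rw [h.eq_zero, add_zero, one_smul, ← h.normal_eq hp] at this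
    exact this
  have hNM : ∀ w, ⟪N p, M w⟫_ℝ = ‖gradient F p‖ * ⟪N p, w⟫_ℝ := by
    intro w
    have e1 : ⟪N p, D w⟫_ℝ = 0 := by
      rw [h.normal_eq hp, real_inner_comm]
      exact inner_fderiv_unitNormal_self h.contDiffAt h.gradient_ne w
    have e2 : fderiv ℝ F p w = ‖gradient F p‖ * ⟪N p, w⟫_ℝ := by
      rw [← inner_gradient_eq]
      conv_lhs => rw [h.gradient_eq hp]
      rw [real_inner_smul_left]
    simp only [M, _root_.add_apply, ContinuousLinearMap.smulRight_apply,
      inner_add_right, inner_smul_right, e1, e2, real_inner_self_eq_norm_sq, h.norm_normal hp]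
    ring
  have hM1 : ∀ w, ⟪N p, M w⟫_ℝ = 0 → ⟪N p, w⟫_ℝ = 0 := by
    intro w hw
    rw [hNM] at hw
    simpa [h.gradient_ne] using hw
  have hM2 : ∀ w, ⟪N p, w⟫_ℝ = 0 → M w = shapeOperator S N p w := by
    intro w hw
    rw [h.shapeOperator_apply hp hw]
    have : fderiv ℝ F p w = 0 := by
      rw [← inner_gradient_eq]; exact (h.inner_gradient_eq_zero_iff hp).2 hw
    simp [M, this, hD]
  have hinj : Function.Injective M := by
    rw [injective_iff_map_eq_zero]
    intro w hw
    have h1 : ⟪N p, w⟫_ℝ = 0 := hM1 w (by rw [hw, inner_zero_right])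
    by_contra hne
    have h2 := hS.shape_pos p hp w (mem_tangentSpace.2 h1) hne
    rw [← hM2 w h1, hw, inner_zero_left] at h2
    exact lt_irrefl _ h2
  let Φ' : Eucl n ≃L[ℝ] Eucl n :=
    (LinearEquiv.ofInjectiveEndo (M : Eucl n →ₗ[ℝ] Eucl n) hinj).toContinuousLinearEquiv
  have hΦ'M : (Φ' : Eucl n →L[ℝ] Eucl n) = M := by ext1 x; rfl
  have hΦ'a : ∀ w, Φ' w = M w := fun w => rfl
  refine ⟨Φ, Φ', hΦ'M ▸ hΦ, ?_, hM2, hM1, ?_⟩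
  · filter_upwards [h.eventually_eq] with x hx
    simp [Φ, hx.1, hx.2]
  · refine hc.imp id fun hc => ?_
    have hFc : ContinuousAt F p := h.contDiffAt.continuousAt
    have h1 : ∀ᶠ x in 𝓝 p, -1 < F x := hFc.eventually_const_lt (by rw [h.eq_zero]; norm_num)
    have h2 : ∀ᶠ x in 𝓝 p, gradient F x ≠ 0 :=
      (contDiffAt_gradient h.contDiffAt).continuousAt.eventually_ne h.gradient_ne
    filter_upwards [hc, h1, h2] with x hx h1 h2 h3
    apply hx
    simp only [Φ, norm_smul, norm_unitNormal h2, mul_one] at h3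
    rw [Real.norm_of_nonneg (by linarith)] at h3
    linarith

/-- The inverse Gauss map. -/
def _root_.SurfaceMaximal.invGauss (S : Set (Eucl n)) (N : Eucl n → Eucl n) : Eucl n → Eucl n :=
  Function.invFunOn N S

theorem invGauss_mem {ν : Eucl n} (hν : ν ∈ N '' S) :
    invGauss S N ν ∈ S := Function.invFunOn_mem hν

theorem normal_invGauss {ν : Eucl n} (hν : ν ∈ N '' S) :
    N (invGauss S N ν) = ν := Function.invFunOn_eq hν

theorem invGauss_normal (hS : IsStrictlyConvexSurface S N) {p : Eucl n} (hp : p ∈ S) :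
    invGauss S N (N p) = p := hS.gauss_injOn.leftInvOn_invFunOn hp

/-- On compact `S` a continuous injection has a continuous inverse; the argument is by ultrafilters.
Otherwise `S` may fail to be closed, and the local extension `Φ` is used: a normal near `N p` equals
`Φ x` for some `x` near `p`, unit length puts `x` into `S`, and injectivity of `N` makes `x` its
preimage. -/
theorem continuousWithinAt_invGauss (hS : IsStrictlyConvexSurface S N) {p : Eucl n} (hp : p ∈ S) :
    ContinuousWithinAt (invGauss S N) (N '' S) (N p) := by
  obtain ⟨Φ, Φ', hΦ, hΦN, -, -, hc⟩ := hS.exists_gauss_extension hp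
  rcases hc with hc | hc
  · rw [ContinuousWithinAt, hS.invGauss_normal hp]
    refine tendsto_iff_ultrafilter _ _ _ |>.2 fun g hg => ?_
    have hmem : ∀ᶠ ν in (g : Filter (Eucl n)), ν ∈ N '' S := hg self_mem_nhdsWithin
    obtain ⟨q, hq, hle⟩ := hc.ultrafilter_le_nhds (g.map (invGauss S N)) (by
      rw [le_principal_iff]
      exact hmem.mono fun ν hν => invGauss_mem hν)
    have h1 : Tendsto (invGauss S N) g (𝓝[S] q) :=
      tendsto_nhdsWithin_iff.2 ⟨hle, hmem.mono fun ν hν => invGauss_mem hν⟩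
    have h2 : Tendsto (fun ν => N (invGauss S N ν)) g (𝓝 (N q)) :=
      (hS.continuousOn_normal q hq).tendsto.comp h1
    have h3 : Tendsto (fun ν => N (invGauss S N ν)) g (𝓝 (N p)) := by
      have : Tendsto id (g : Filter (Eucl n)) (𝓝 (N p)) := hg.trans nhdsWithin_le_nhds
      refine this.congr' ?_
      filter_upwards [hmem] with ν hν using (normal_invGauss hν).symm
    have h4 : q = p := hS.gauss_injOn hq hp (tendsto_nhds_unique h2 h3)
    rw [← h4]
    exact hle
  · rw [ContinuousWithinAt, hS.invGauss_normal hp]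
    intro U hU
    have hΦNp : Φ p = N p := hΦN.self_of_nhdsWithin hp
    have hΦN' : ∀ᶠ x in 𝓝 p, x ∈ S → Φ x = N x := eventually_nhdsWithin_iff.1 hΦN
    have hmap := hΦ.map_nhds_eq_of_equiv
    rw [hΦNp] at hmap
    have him : Φ '' {x | x ∈ U ∧ (‖Φ x‖ = 1 → x ∈ S) ∧ (x ∈ S → Φ x = N x)} ∈ 𝓝 (N p) := by
      rw [← hmap]
      refine image_mem_map ?_
      filter_upwards [hU, hc, hΦN'] with x h1 h2 h3 using ⟨h1, h2, h3⟩
    have himS : ∀ᶠ ν in 𝓝[N '' S] (N p), ν ∈ N '' S := self_mem_nhdsWithin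
    have hgoal : ∀ᶠ ν in 𝓝[N '' S] (N p), ν ∈ invGauss S N ⁻¹' U := by
      filter_upwards [mem_nhdsWithin_of_mem_nhds him, himS] with ν hν1 hν2
      obtain ⟨x, ⟨hxU, hx1, hx2⟩, rfl⟩ := hν1
      obtain ⟨y, hy, hyx⟩ := hν2
      have hxS : x ∈ S := hx1 (by rw [← hyx]; exact hS.norm_normal hy)
      rw [hx2 hxS, mem_preimage, hS.invGauss_normal hxS]
      exact hxU
    exact hgoal

theorem exists_hasFDerivWithinAt_invGauss (hS : IsStrictlyConvexSurface S N) {p : Eucl n}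
    (hp : p ∈ S) : ∃ D : Eucl n →L[ℝ] Eucl n,
      HasFDerivWithinAt (invGauss S N) D (N '' S) (N p) ∧
      (∀ w, ⟪N p, w⟫_ℝ = 0 → D (shapeOperator S N p w) = w) ∧
      (∀ z, ⟪N p, z⟫_ℝ = 0 → ⟪N p, D z⟫_ℝ = 0 ∧ shapeOperator S N p (D z) = z) := by
  obtain ⟨Φ, Φ', hΦ, hΦN, h1, h2, -⟩ := hS.exists_gauss_extension hp
  refine ⟨Φ'.symm, ?_, ?_, ?_⟩
  · have hX : Tendsto (invGauss S N) (𝓝[N '' S] (N p)) (𝓝[S] p) := by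
      have := hS.continuousWithinAt_invGauss hp
      rw [ContinuousWithinAt, hS.invGauss_normal hp] at this
      exact tendsto_nhdsWithin_iff.2 ⟨this, eventually_mem_nhdsWithin.mono
        fun ν hν => invGauss_mem hν⟩
    refine HasFDerivWithinAt.of_local_left_inverse (f := Φ) (t := S) ?_ ?_
      (mem_image_of_mem N hp) ?_
    · rw [hS.invGauss_normal hp]; exact hX
    · rw [hS.invGauss_normal hp]; exact hΦ.hasFDerivAt.hasFDerivWithinAt
    · have hev : ∀ᶠ ν in 𝓝[N '' S] (N p), Φ (invGauss S N ν) = N (invGauss S N ν) :=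
        hX.eventually hΦN
      filter_upwards [hev, self_mem_nhdsWithin] with ν h1 h2
      rw [h1, normal_invGauss h2]
  · intro w hw
    rw [← h1 w hw]
    exact Φ'.symm_apply_apply w
  · intro z hz
    have h3 : ⟪N p, Φ'.symm z⟫_ℝ = 0 := h2 _ (by rw [Φ'.apply_symm_apply]; exact hz)
    exact ⟨h3, by
      have := h1 _ h3
      rw [Φ'.apply_symm_apply] at this
      exact this.symm⟩

end IsStrictlyConvexSurface

end Hypersurface

end SurfaceMaximal

end

/-! ### Uniform bounds for the shape operators, and the derivative of normalisation. -/

noncomputable section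

namespace SurfaceMaximal

section Ellipticity

variable {T : Type*} [NormedAddCommGroup T] [InnerProductSpace ℝ T] [FiniteDimensional ℝ T]

/-- In an orthonormal eigenbasis all quantities are sums of the squared coordinates of `w`, weighted
by powers of the eigenvalues. -/
theorem _root_.LinearMap.IsSymmetric.inner_bounds {f : T →ₗ[ℝ] T} (hf : f.IsSymmetric) {m M : ℝ}
    (hm : 0 ≤ m) (h : ∀ κ : ℝ, ∀ v, v ≠ 0 → f v = κ • v → m ≤ κ ∧ κ ≤ M) (w : T) :
    m * ‖w‖ ^ 2 ≤ ⟪f w, w⟫_ℝ ∧ ‖f w‖ ^ 2 ≤ M ^ 2 * ‖w‖ ^ 2 := by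
  let b := hf.eigenvectorBasis rfl
  let κ := hf.eigenvalues rfl
  have hfb : ∀ i, f (b i) = κ i • b i := fun i => hf.apply_eigenvectorBasis rfl i
  have hκ : ∀ i, m ≤ κ i ∧ κ i ≤ M := fun i => h _ _ (b.orthonormal.ne_zero i) (hfb i)
  have h1 : ∀ i, ⟪b i, f w⟫_ℝ = κ i * ⟪b i, w⟫_ℝ := by
    intro i
    rw [← hf, hfb, real_inner_smul_left]
  have h2 : ⟪f w, w⟫_ℝ = ∑ i, κ i * ⟪b i, w⟫_ℝ ^ 2 := by
    rw [← b.sum_inner_mul_inner]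
    refine Finset.sum_congr rfl fun i _ => ?_
    rw [real_inner_comm, h1]
    ring
  have h3 : ‖f w‖ ^ 2 = ∑ i, κ i ^ 2 * ⟪b i, w⟫_ℝ ^ 2 := by
    rw [← b.sum_sq_norm_inner_right]
    refine Finset.sum_congr rfl fun i _ => ?_
    rw [h1, Real.norm_eq_abs, sq_abs]
    ring
  have h4 : ‖w‖ ^ 2 = ∑ i, ⟪b i, w⟫_ℝ ^ 2 := by
    rw [← b.sum_sq_norm_inner_right]
    refine Finset.sum_congr rfl fun i _ => ?_
    rw [Real.norm_eq_abs, sq_abs]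
  rw [h2, h3, h4, Finset.mul_sum, Finset.mul_sum]
  constructor
  · gcongr with i
    exact (hκ i).1
  · gcongr with i
    · exact hm.trans (hκ i).1
    · exact (hκ i).2

end Ellipticity

section Curvature

open Filter Topology Set

variable {n : ℕ} {S : Set (Eucl n)} {N : Eucl n → Eucl n}

namespace IsStrictlyConvexSurface

/-- The shape operator as an endomorphism of the tangent space. -/
def shapeEnd (hS : IsStrictlyConvexSurface S N) {u : Eucl n} (hu : u ∈ S) :
    tangentSpace N u →ₗ[ℝ] tangentSpace N u :=
  (shapeOperator S N u : Eucl n →ₗ[ℝ] Eucl n).restrict (p := tangentSpace N u)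
    (q := tangentSpace N u) (by
      intro w hw
      obtain ⟨F, h, -⟩ := hS.exists_definingFunction hu
      exact mem_tangentSpace.2 (h.inner_shapeOperator_normal hu (mem_tangentSpace.1 hw)))

theorem coe_shapeEnd (hS : IsStrictlyConvexSurface S N) {u : Eucl n} (hu : u ∈ S)
    (w : tangentSpace N u) : (hS.shapeEnd hu w : Eucl n) = shapeOperator S N u w := rfl

theorem shapeEnd_isSymmetric (hS : IsStrictlyConvexSurface S N) {u : Eucl n} (hu : u ∈ S) :
    (hS.shapeEnd hu).IsSymmetric := by
  intro v w
  obtain ⟨F, h, -⟩ := hS.exists_definingFunction hu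
  exact h.shapeOperator_symm hu (mem_tangentSpace.1 v.2) (mem_tangentSpace.1 w.2)

theorem isPrincipalCurvature_of_shapeEnd (hS : IsStrictlyConvexSurface S N) {u : Eucl n}
    (hu : u ∈ S) {κ : ℝ} {v : tangentSpace N u} (hv : v ≠ 0) (h : hS.shapeEnd hu v = κ • v) :
    IsPrincipalCurvature S N u κ :=
  ⟨v, v.2, fun h0 => hv (Subtype.ext h0), by rw [← hS.coe_shapeEnd hu, h]; rfl⟩

theorem principalCurvature_pos (hS : IsStrictlyConvexSurface S N) {u : Eucl n} (hu : u ∈ S)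
    {κ : ℝ} (hκ : IsPrincipalCurvature S N u κ) : 0 < κ := by
  obtain ⟨v, hv, hv0, h⟩ := hκ
  have h1 := hS.shape_pos u hu v hv hv0
  rw [h, real_inner_smul_left] at h1
  exact pos_of_mul_pos_left h1 real_inner_self_nonneg

theorem exists_principalCurvature (hn : 2 ≤ n) (hS : IsStrictlyConvexSurface S N) {u : Eucl n}
    (hu : u ∈ S) : ∃ κ, IsPrincipalCurvature S N u κ := by
  have hN0 : N u ≠ 0 := by
    intro h
    have := hS.norm_normal hu
    rw [h, norm_zero] at this
    exact zero_ne_one this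
  have hdim : Module.finrank ℝ (tangentSpace N u) = n - 1 := by
    have h1 := (Submodule.span ℝ {N u}).finrank_add_finrank_orthogonal
    rw [finrank_span_singleton hN0, finrank_euclideanSpace, Fintype.card_fin] at h1
    rw [tangentSpace]
    omega
  let b := (hS.shapeEnd_isSymmetric hu).eigenvectorBasis hdim
  let i : Fin (n - 1) := ⟨0, by omega⟩
  exact ⟨_, hS.isPrincipalCurvature_of_shapeEnd hu (b.orthonormal.ne_zero i)
    ((hS.shapeEnd_isSymmetric hu).apply_eigenvectorBasis hdim i)⟩

theorem principalCurvature_le (hS : IsStrictlyConvexSurface S N) {Q : ℝ≥0}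
    (hQ : curvatureQuotient S N ≤ Q) {u u' : Eucl n} (hu : u ∈ S) (hu' : u' ∈ S) {κ κ' : ℝ}
    (hκ : IsPrincipalCurvature S N u κ) (hκ' : IsPrincipalCurvature S N u' κ') : κ ≤ Q * κ' := by
  have hpos := hS.principalCurvature_pos hu' hκ'
  have h1 : ENNReal.ofReal κ / ENNReal.ofReal κ' ≤ Q := by
    refine le_trans (le_sInf fun c hc => ?_) hQ
    exact ENNReal.div_le_of_le_mul (hc u hu u' hu' κ κ' hκ hκ')
  rw [ENNReal.div_le_iff (by simpa using hpos) (by simp)] at h1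
  rw [← ENNReal.ofReal_coe_nnreal, ← ENNReal.ofReal_mul Q.coe_nonneg] at h1
  exact (ENNReal.ofReal_le_ofReal_iff (by positivity)).1 h1

/-- Uniform two-sided bounds for the shape operators. -/
theorem exists_shapeOperator_bounds (hn : 2 ≤ n) (hS : IsStrictlyConvexSurface S N) {Q : ℝ≥0}
    (hQ : curvatureQuotient S N ≤ Q) (hne : S.Nonempty) :
    ∃ m M : ℝ, 0 < m ∧ 0 < M ∧ M = Q ^ 2 * m ∧ ∀ u ∈ S, ∀ w, ⟪N u, w⟫_ℝ = 0 →
      m * ‖w‖ ^ 2 ≤ ⟪shapeOperator S N u w, w⟫_ℝ ∧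
      ‖shapeOperator S N u w‖ ^ 2 ≤ M ^ 2 * ‖w‖ ^ 2 := by
  obtain ⟨u₀, hu₀⟩ := hne
  obtain ⟨κ, hκ⟩ := exists_principalCurvature hn hS hu₀
  have hκ0 := hS.principalCurvature_pos hu₀ hκ
  have hQ1 := hS.principalCurvature_le hQ hu₀ hu₀ hκ hκ
  have hQ0 : (0 : ℝ) < Q := by
    by_contra hc
    have : (Q : ℝ) = 0 := le_antisymm (not_lt.1 hc) Q.2
    rw [this, zero_mul] at hQ1
    linarith
  -- `κ` is one principal curvature at one point; all others lie between `κ / Q` and `Q κ`.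
  refine ⟨κ / Q, Q * κ, by positivity, by positivity, by field_simp, fun u hu w hw => ?_⟩
  refine (hS.shapeEnd_isSymmetric hu).inner_bounds (m := κ / Q) (M := Q * κ) (by positivity) ?_
    ⟨w, mem_tangentSpace.2 hw⟩
  intro κ' v hv hv'
  have hκ' := hS.isPrincipalCurvature_of_shapeEnd hu hv hv'
  refine ⟨?_, hS.principalCurvature_le hQ hu hu₀ hκ' hκ⟩
  rw [div_le_iff₀ hQ0, mul_comm]
  exact hS.principalCurvature_le hQ hu₀ hu hκ hκ'

end IsStrictlyConvexSurface

end Curvature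

section Normalize

open Filter Topology Set

variable {E : Type*} [NormedAddCommGroup E] [InnerProductSpace ℝ E]

/-- The derivative of `‖x‖⁻¹` is read off by differentiating the identity that a normalised vector
has length one. -/
theorem exists_hasFDerivAt_normalize {a : E} (ha : a ≠ 0) :
    ∃ D : E →L[ℝ] E, HasFDerivAt (fun x : E => ‖x‖⁻¹ • x) D a ∧
      ∀ v, D v = ‖a‖⁻¹ • (v - (⟪a, v⟫_ℝ / ‖a‖ ^ 2) • a) := by
  have h1 : DifferentiableAt ℝ (fun x : E => ‖x‖⁻¹) a :=
    (((contDiffAt_norm ℝ ha).differentiableAt (n := 1) (by norm_num)).inv (norm_ne_zero_iff.2 ha))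
  have h2 := h1.hasFDerivAt.smul (hasFDerivAt_id a)
  have ha' : ‖a‖ ≠ 0 := norm_ne_zero_iff.2 ha
  refine ⟨_, h2, fun v => ?_⟩
  have h3 := h2.inner ℝ h2
  have hev : (fun x : E => ⟪((fun x : E => ‖x‖⁻¹) • id) x, ((fun x : E => ‖x‖⁻¹) • id) x⟫_ℝ) =ᶠ[𝓝 a]
      fun _ => (1 : ℝ) := by
    filter_upwards [continuousAt_id.eventually_ne ha] with x hx
    have hx' : ‖x‖ ≠ 0 := norm_ne_zero_iff.2 hx
    simp only [Pi.smul_apply', id, real_inner_smul_left, inner_smul_right,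
      real_inner_self_eq_norm_sq]
    field_simp
  have h4 := (hasFDerivAt_const (𝕜 := ℝ) (1 : ℝ) a).congr_of_eventuallyEq hev
  have h5 := congrArg (fun L : E →L[ℝ] ℝ => L v) (HasFDerivAt.unique h3 h4)
  simp [inner_add_left, inner_add_right, inner_smul_right, real_inner_comm] at h5
  have h6 : fderiv ℝ (fun x : E => ‖x‖⁻¹) a v = - ‖a‖⁻¹ * (⟪a, v⟫_ℝ / ‖a‖ ^ 2) := by
    rw [real_inner_comm v a] at *
    field_simp at h5 ⊢
    linarith
  simp only [_root_.add_apply, ContinuousLinearMap.smulRight_apply, h6, id, _root_.smul_apply,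
    ContinuousLinearMap.id_apply]
  module

end Normalize

end SurfaceMaximal

end

/-! ### Construction of the Gauss chart of `S`. -/

noncomputable section

namespace SurfaceMaximal

section ChartConstruction

open Filter Topology Set

variable {n : ℕ} {S : Set (Eucl n)} {N : Eucl n → Eucl n}

/-- The normals of `S`, rescaled to lie in the affine hyperplane `⟪a, e⟫ = 1`. -/
def normalParams (S : Set (Eucl n)) (N : Eucl n → Eucl n) (e : Eucl n) : Set (Eucl n) :=
  {a | ⟪a, e⟫_ℝ = 1 ∧ ‖a‖⁻¹ • a ∈ N '' S}

/-- The point of `S` with normal `a / ‖a‖`. -/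
def gaussParam (S : Set (Eucl n)) (N : Eucl n → Eucl n) (a : Eucl n) : Eucl n :=
  invGauss S N (‖a‖⁻¹ • a)

theorem ne_zero_of_inner_eq_one {a e : Eucl n} (h : ⟪a, e⟫_ℝ = 1) : a ≠ 0 := by
  rintro rfl
  simp at h

namespace IsStrictlyConvexSurface

theorem gaussParam_mem {e a : Eucl n} (ha : a ∈ normalParams S N e) : gaussParam S N a ∈ S :=
  invGauss_mem ha.2

theorem normal_gaussParam {e a : Eucl n} (ha : a ∈ normalParams S N e) :
    N (gaussParam S N a) = ‖a‖⁻¹ • a :=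
  normal_invGauss ha.2

theorem inner_pos (hS : IsStrictlyConvexSurface S N) {u u' : Eucl n} (hu : u ∈ S) (hu' : u' ∈ S) :
    0 < ⟪N u, N u'⟫_ℝ := by
  linarith [hS.cone u hu u' hu']

/-- The parameter of a point of `S`. -/
theorem param_mem (hS : IsStrictlyConvexSurface S N) {u₀ u : Eucl n} (hu₀ : u₀ ∈ S) (hu : u ∈ S) :
    (⟪N u, N u₀⟫_ℝ)⁻¹ • N u ∈ normalParams S N (N u₀) ∧
      gaussParam S N ((⟪N u, N u₀⟫_ℝ)⁻¹ • N u) = u := by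
  have hpos := hS.inner_pos hu hu₀
  have h1 : ‖(⟪N u, N u₀⟫_ℝ)⁻¹ • N u‖⁻¹ • ((⟪N u, N u₀⟫_ℝ)⁻¹ • N u) = N u := by
    rw [norm_smul, hS.norm_normal hu, mul_one, Real.norm_of_nonneg (by positivity), inv_inv,
      smul_smul, mul_inv_cancel₀ hpos.ne', one_smul]
  refine ⟨⟨?_, ?_⟩, ?_⟩
  · rw [real_inner_smul_left, inv_mul_cancel₀ hpos.ne']
  · rw [h1]; exact mem_image_of_mem N hu
  · rw [gaussParam, h1, hS.invGauss_normal hu]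

theorem image_gaussParam (hS : IsStrictlyConvexSurface S N) {u₀ : Eucl n} (hu₀ : u₀ ∈ S) :
    gaussParam S N '' normalParams S N (N u₀) = S := by
  ext u
  constructor
  · rintro ⟨a, ha, rfl⟩
    exact gaussParam_mem ha
  · intro hu
    exact ⟨_, (hS.param_mem hu₀ hu).1, (hS.param_mem hu₀ hu).2⟩

/-- Geodesic convexity makes the cone over `N(S)` convex. -/
theorem normalize_mem_of_comb (hS : IsStrictlyConvexSurface S N) {u₁ u₂ : Eucl n} (hu₁ : u₁ ∈ S)
    (hu₂ : u₂ ∈ S) {s t : ℝ} (hs : 0 < s) (ht : 0 < t) :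
    ‖s • N u₁ + t • N u₂‖⁻¹ • (s • N u₁ + t • N u₂) ∈ N '' S := by
  rcases eq_or_ne u₁ u₂ with rfl | hne
  · rw [← add_smul, norm_smul, hS.norm_normal hu₁, mul_one, Real.norm_of_nonneg (by positivity),
      smul_smul, inv_mul_cancel₀ (by positivity), one_smul]
    exact mem_image_of_mem N hu₁
  set ν₁ := N u₁ with hν₁
  set ν₂ := N u₂ with hν₂
  have n1 : ‖ν₁‖ = 1 := hS.norm_normal hu₁
  have n2 : ‖ν₂‖ = 1 := hS.norm_normal hu₂
  have hν : ν₁ ≠ ν₂ := fun h => hne (hS.gauss_injOn hu₁ hu₂ h)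
  set c := ⟪ν₁, ν₂⟫_ℝ with hc
  have hc0 : 1 / 2 ≤ c := hS.cone u₁ hu₁ u₂ hu₂
  have hc1 : c < 1 := by
    rcases (real_inner_le_norm ν₁ ν₂).lt_or_eq with h | h
    · rwa [n1, n2, one_mul] at h
    · exact absurd ((inner_eq_one_iff_of_norm_eq_one n1 n2).1 (by rw [h, n1, n2, one_mul])) hν
  have hcc : 0 < 1 - c ^ 2 := by nlinarith
  have hli : LinearIndependent ℝ ![ν₁, ν₂] := by
    rw [LinearIndependent.pair_iff]
    intro x y hxy
    have h1 : ⟪ν₁, x • ν₁ + y • ν₂⟫_ℝ = 0 := by rw [hxy, inner_zero_right]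
    have h2 : ⟪ν₂, x • ν₁ + y • ν₂⟫_ℝ = 0 := by rw [hxy, inner_zero_right]
    rw [inner_add_right, inner_smul_right, inner_smul_right, real_inner_self_eq_norm_sq, n1,
      ← hc] at h1
    rw [inner_add_right, inner_smul_right, inner_smul_right, real_inner_self_eq_norm_sq, n2,
      real_inner_comm, ← hc] at h2
    have h3 : (1 - c ^ 2) * x = 0 := by linear_combination h1 - c * h2
    have h4 : (1 - c ^ 2) * y = 0 := by linear_combination h2 - c * h1
    exact ⟨(mul_eq_zero.1 h3).resolve_left hcc.ne', (mul_eq_zero.1 h4).resolve_left hcc.ne'⟩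
  let P : Submodule ℝ (Eucl n) := Submodule.span ℝ (Set.range ![ν₁, ν₂])
  have hP : Module.finrank ℝ P = 2 := by
    rw [finrank_span_eq_card hli, Fintype.card_fin]
  have hmem1 : ν₁ ∈ P := Submodule.subset_span ⟨0, rfl⟩
  have hmem2 : ν₂ ∈ P := Submodule.subset_span ⟨1, rfl⟩
  -- Within the plane `P`, `w` is orthogonal to `s • ν₁ + t • ν₂`, and its pairings with `ν₁` and
  -- `ν₂` have opposite signs. Connectedness of `N(S) ∩ P` therefore yields a normal orthogonal to
  -- `w`, that is, a multiple `r` of the combination.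
  set w : Eucl n := (s * c + t) • ν₁ - (s + t * c) • ν₂ with hw
  have hw1 : ⟪ν₁, w⟫_ℝ = t * (1 - c ^ 2) := by
    rw [hw, inner_sub_right, inner_smul_right, inner_smul_right, real_inner_self_eq_norm_sq, n1,
      ← hc]
    ring
  have hw2 : ⟪ν₂, w⟫_ℝ = -(s * (1 - c ^ 2)) := by
    rw [hw, inner_sub_right, inner_smul_right, inner_smul_right, real_inner_self_eq_norm_sq, n2,
      real_inner_comm, ← hc]
    ring
  obtain ⟨ν, ⟨hνS, hνP⟩, hν0⟩ := (hS.geodesically_convex P hP).intermediate_value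
    (a := ν₂) (b := ν₁) ⟨mem_image_of_mem N hu₂, hmem2⟩ ⟨mem_image_of_mem N hu₁, hmem1⟩
    (f := fun ν => ⟪ν, w⟫_ℝ) (by fun_prop)
    (show (0 : ℝ) ∈ Set.Icc _ _ from ⟨by rw [hw2]; nlinarith, by rw [hw1]; positivity⟩)
  have hνP' : ∃ x y : ℝ, x • ν₁ + y • ν₂ = ν := by
    have : ν ∈ Submodule.span ℝ {ν₁, ν₂} := by
      have := hνP
      simpa [P, Matrix.range_cons, Set.pair_comm] using this
    exact Submodule.mem_span_pair.1 this
  obtain ⟨x, y, rfl⟩ := hνP'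
  obtain ⟨u, hu, huν⟩ := hνS
  simp only [inner_add_left, real_inner_smul_left, hw1, hw2] at hν0
  have hxy : x * t = y * s := by
    have : (1 - c ^ 2) * (x * t - y * s) = 0 := by linear_combination hν0
    have := (mul_eq_zero.1 this).resolve_left hcc.ne'
    linarith
  set r := x / s with hr
  have hxr : x = r * s := by rw [hr]; field_simp
  have hyr : y = r * t := by rw [hr]; field_simp; linarith
  have hcomb : x • ν₁ + y • ν₂ = r • (s • ν₁ + t • ν₂) := by rw [hxr, hyr]; module
  have hpos : 0 < ⟪x • ν₁ + y • ν₂, ν₁⟫_ℝ := by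
    rw [← huν]; exact hS.inner_pos hu hu₁
  -- The cone condition rules out the antipodal point.
  have hrpos : 0 < r := by
    rw [hcomb, real_inner_smul_left, inner_add_left, real_inner_smul_left, real_inner_smul_left,
      real_inner_self_eq_norm_sq, n1, real_inner_comm ν₁ ν₂, ← hc] at hpos
    exact pos_of_mul_pos_left hpos (by positivity)
  have hnorm : ‖x • ν₁ + y • ν₂‖ = 1 := by rw [← huν]; exact hS.norm_normal hu
  rw [hcomb, norm_smul, Real.norm_of_nonneg hrpos.le] at hnorm
  have : ‖s • ν₁ + t • ν₂‖⁻¹ = r := (eq_inv_of_mul_eq_one_left hnorm).symm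
  rw [this, ← hcomb, ← huν]
  exact mem_image_of_mem N hu

theorem convex_normalParams (hS : IsStrictlyConvexSurface S N) (e : Eucl n) :
    Convex ℝ (normalParams S N e) := by
  refine convex_iff_forall_pos.2 ?_
  intro a ha b hb α β hα hβ hαβ
  refine ⟨?_, ?_⟩
  · rw [inner_add_left, real_inner_smul_left, real_inner_smul_left, ha.1, hb.1]
    linarith
  · have na : 0 < ‖a‖ := norm_pos_iff.2 (ne_zero_of_inner_eq_one ha.1)
    have nb : 0 < ‖b‖ := norm_pos_iff.2 (ne_zero_of_inner_eq_one hb.1)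
    have := hS.normalize_mem_of_comb (gaussParam_mem ha) (gaussParam_mem hb)
      (mul_pos hα na) (mul_pos hβ nb)
    rw [normal_gaussParam ha, normal_gaussParam hb, smul_smul, smul_smul,
      mul_inv_cancel_right₀ na.ne', mul_inv_cancel_right₀ nb.ne'] at this
    exact this

theorem norm_bounds (hS : IsStrictlyConvexSurface S N) {u₀ a : Eucl n} (hu₀ : u₀ ∈ S)
    (ha : a ∈ normalParams S N (N u₀)) : 1 ≤ ‖a‖ ∧ ‖a‖ ≤ 2 := by
  have h0 : 0 < ‖a‖ := norm_pos_iff.2 (ne_zero_of_inner_eq_one ha.1)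
  constructor
  · have := real_inner_le_norm a (N u₀)
    rwa [ha.1, hS.norm_normal hu₀, mul_one] at this
  · have := hS.cone _ (gaussParam_mem ha) u₀ hu₀
    rw [normal_gaussParam ha, real_inner_smul_left, ha.1, mul_one] at this
    rw [show (2 : ℝ) = (1 / 2)⁻¹ by norm_num]
    exact (le_inv_comm₀ (by norm_num) h0).1 this

/-- The derivative of the inverse Gauss map in the parameter `a`, expressed through the shape
operator. -/
theorem exists_hasFDerivWithinAt_gaussParam (hS : IsStrictlyConvexSurface S N) {u₀ a : Eucl n}
    (ha : a ∈ normalParams S N (N u₀)) :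
    ∃ D : Eucl n →L[ℝ] Eucl n,
      HasFDerivWithinAt (gaussParam S N) D (normalParams S N (N u₀)) a ∧
      (∀ v, ⟪a, D v⟫_ℝ = 0 ∧ shapeOperator S N (gaussParam S N a) (D v) =
        ‖a‖⁻¹ • (v - (⟪a, v⟫_ℝ / ‖a‖ ^ 2) • a)) ∧
      (∀ w, ⟪a, w⟫_ℝ = 0 → ∃ v, ⟪v, N u₀⟫_ℝ = 0 ∧ D v = w) := by
  have ha0 : a ≠ 0 := ne_zero_of_inner_eq_one ha.1
  have hna : ‖a‖ ≠ 0 := norm_ne_zero_iff.2 ha0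
  have hp := gaussParam_mem ha
  have hNp := normal_gaussParam ha
  have horth : ∀ w, ⟪N (gaussParam S N a), w⟫_ℝ = 0 ↔ ⟪a, w⟫_ℝ = 0 := by
    intro w
    rw [hNp, real_inner_smul_left, mul_eq_zero]
    simp [ha0]
  obtain ⟨D, hD, hD1, hD2⟩ := hS.exists_hasFDerivWithinAt_invGauss hp
  obtain ⟨R, hR, hR1⟩ := exists_hasFDerivAt_normalize ha0
  rw [hNp] at hD
  have hRa : ∀ v, ⟪a, R v⟫_ℝ = 0 := by
    intro v
    rw [hR1, inner_smul_right, inner_sub_right, inner_smul_right, real_inner_self_eq_norm_sq]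
    field_simp
    ring
  refine ⟨D ∘L R, HasFDerivWithinAt.comp (g := invGauss S N) (f := fun x => ‖x‖⁻¹ • x)
    (t := N '' S) a hD hR.hasFDerivWithinAt (fun x hx => hx.2), ?_, ?_⟩
  · intro v
    obtain ⟨h1, h2⟩ := hD2 (R v) ((horth _).2 (hRa v))
    exact ⟨(horth _).1 h1, by rw [ContinuousLinearMap.comp_apply, h2, hR1]⟩
  · intro w hw
    set z := shapeOperator S N (gaussParam S N a) w with hz
    have hz0 : ⟪a, z⟫_ℝ = 0 := by
      obtain ⟨F, h, -⟩ := hS.exists_definingFunction hp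
      exact (horth _).1 (h.inner_shapeOperator_normal hp ((horth _).2 hw))
    -- The multiple of `a` brings the vector into the direction space of the hyperplane; being
    -- radial, it is annihilated by the derivative of normalisation.
    refine ⟨‖a‖ • (z - ⟪z, N u₀⟫_ℝ • a), ?_, ?_⟩
    · rw [real_inner_smul_left, inner_sub_left, real_inner_smul_left, ha.1]
      ring
    · have : R (‖a‖ • (z - ⟪z, N u₀⟫_ℝ • a)) = z := by
        rw [hR1, inner_smul_right, inner_sub_right, inner_smul_right, hz0,
          real_inner_self_eq_norm_sq]
        have : ‖a‖ * (0 - ⟪z, N u₀⟫_ℝ * ‖a‖ ^ 2) / ‖a‖ ^ 2 = -(‖a‖ * ⟪z, N u₀⟫_ℝ) := by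
          field_simp
          ring
        have e : ‖a‖ • (z - ⟪z, N u₀⟫_ℝ • a) - (-(‖a‖ * ⟪z, N u₀⟫_ℝ)) • a = ‖a‖ • z := by module
        rw [this, e, smul_smul, inv_mul_cancel₀ hna, one_smul]
      rw [ContinuousLinearMap.comp_apply, this]
      exact hD1 w ((horth _).2 hw)

/-- Bounds for the derivative of the inverse Gauss map. -/
theorem derivative_bounds (hS : IsStrictlyConvexSurface S N) {u₀ a : Eucl n}
    (hu₀ : u₀ ∈ S) (ha : a ∈ normalParams S N (N u₀)) {m M : ℝ} (hm : 0 < m) (hM : 0 < M)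
    (hB : ∀ u ∈ S, ∀ w, ⟪N u, w⟫_ℝ = 0 → m * ‖w‖ ^ 2 ≤ ⟪shapeOperator S N u w, w⟫_ℝ ∧
      ‖shapeOperator S N u w‖ ^ 2 ≤ M ^ 2 * ‖w‖ ^ 2) {v w : Eucl n} (hv : ⟪v, N u₀⟫_ℝ = 0)
    (hw : ⟪a, w⟫_ℝ = 0) (hBw : shapeOperator S N (gaussParam S N a) w =
        ‖a‖⁻¹ • (v - (⟪a, v⟫_ℝ / ‖a‖ ^ 2) • a)) :
    ‖w‖ ≤ 1 / m * ‖v‖ ∧ m / (16 * M ^ 2) * ‖v‖ ^ 2 ≤ ⟪w, v⟫_ℝ := by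
  have ha0 : a ≠ 0 := ne_zero_of_inner_eq_one ha.1
  have hna : 0 < ‖a‖ := norm_pos_iff.2 ha0
  obtain ⟨ha1, ha2⟩ := hS.norm_bounds hu₀ ha
  have hNp := normal_gaussParam ha
  have hw' : ⟪N (gaussParam S N a), w⟫_ℝ = 0 := by
    rw [hNp, real_inner_smul_left, hw, mul_zero]
  obtain ⟨b1, b2⟩ := hB _ (gaussParam_mem ha) w hw'
  set z := shapeOperator S N (gaussParam S N a) w with hz
  have hzw : ⟪z, w⟫_ℝ = ‖a‖⁻¹ * ⟪w, v⟫_ℝ := by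
    rw [hBw, real_inner_smul_left, inner_sub_left, real_inner_smul_left, hw, mul_zero, sub_zero,
      real_inner_comm]
  have hz2 : ‖z‖ ^ 2 = (‖a‖ ^ 2)⁻¹ * (‖v‖ ^ 2 - ⟪a, v⟫_ℝ ^ 2 / ‖a‖ ^ 2) := by
    rw [hBw, norm_smul, mul_pow, norm_inv, norm_norm, inv_pow, norm_sub_sq_real, norm_smul,
      inner_smul_right, mul_pow, Real.norm_eq_abs, sq_abs, real_inner_comm]
    field_simp
    ring
  -- `v` is orthogonal to `N u₀`, so only `a - N u₀` pairs with it. This keeps `v` away from the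
  -- radial direction, which normalisation collapses.
  have hav : ⟪a, v⟫_ℝ ^ 2 ≤ (‖a‖ ^ 2 - 1) * ‖v‖ ^ 2 := by
    have e1 : ⟪a, v⟫_ℝ = ⟪a - N u₀, v⟫_ℝ := by
      rw [inner_sub_left, real_inner_comm v (N u₀), hv, sub_zero]
    have e2 : ‖a - N u₀‖ ^ 2 = ‖a‖ ^ 2 - 1 := by
      rw [norm_sub_sq_real, ha.1, hS.norm_normal hu₀]; ring
    rw [e1, ← e2, ← mul_pow]
    exact sq_le_sq' (neg_le_of_abs_le (abs_real_inner_le_norm _ _)) (real_inner_le_norm _ _)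
  have hz_up : ‖z‖ ≤ ‖v‖ := by
    refine (sq_le_sq₀ (norm_nonneg _) (norm_nonneg _)).1 ?_
    rw [hz2]
    have h1 : (‖a‖ ^ 2)⁻¹ ≤ 1 := inv_le_one_of_one_le₀ (by nlinarith)
    have h2 : 0 ≤ ⟪a, v⟫_ℝ ^ 2 / ‖a‖ ^ 2 := by positivity
    have h3 : 0 ≤ (‖a‖ ^ 2)⁻¹ := by positivity
    nlinarith [sq_nonneg ‖v‖, mul_nonneg h3 h2]
  -- In effect `‖z‖² ≥ ‖v‖² / ‖a‖⁴`, and `‖a‖ ≤ 2`.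
  have hz_low : ‖v‖ ^ 2 / 16 ≤ ‖z‖ ^ 2 := by
    have h1 : ‖v‖ ^ 2 / ‖a‖ ^ 2 ≤ ‖v‖ ^ 2 - ⟪a, v⟫_ℝ ^ 2 / ‖a‖ ^ 2 := by
      rw [div_le_iff₀ (by positivity), sub_mul, div_mul_cancel₀ _ (by positivity)]
      linarith
    have h2 : ‖v‖ ^ 2 / 4 ≤ ‖v‖ ^ 2 / ‖a‖ ^ 2 := by
      gcongr
      nlinarith
    have h3 : (1 : ℝ) / 4 ≤ (‖a‖ ^ 2)⁻¹ := by
      rw [one_div]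
      gcongr
      nlinarith
    rw [hz2]
    have h4 : 1 / 4 * (‖v‖ ^ 2 / 4) ≤ (‖a‖ ^ 2)⁻¹ * (‖v‖ ^ 2 - ⟪a, v⟫_ℝ ^ 2 / ‖a‖ ^ 2) := by
      gcongr
      exact h2.trans h1
    linarith
  have hzw_le := real_inner_le_norm z w
  constructor
  · have h1 : m * ‖w‖ ≤ ‖z‖ := by
      rcases (norm_nonneg w).eq_or_lt with h0 | h0
      · rw [← h0, mul_zero]; exact norm_nonneg _
      · have : (m * ‖w‖) * ‖w‖ ≤ ‖z‖ * ‖w‖ := by nlinarith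
        exact le_of_mul_le_mul_right this h0
    rw [one_div, ← div_eq_inv_mul, le_div_iff₀ hm, mul_comm]
    exact h1.trans hz_up
  · have h1 : ⟪w, v⟫_ℝ = ‖a‖ * ⟪z, w⟫_ℝ := by rw [hzw, mul_inv_cancel_left₀ hna.ne']
    have h0 : 0 ≤ ⟪z, w⟫_ℝ := le_trans (by positivity) b1
    have h2 : ⟪z, w⟫_ℝ ≤ ⟪w, v⟫_ℝ := by rw [h1]; nlinarith
    have h3 : ‖v‖ ^ 2 / 16 ≤ M ^ 2 * ‖w‖ ^ 2 := hz_low.trans b2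
    have h4 : m / (16 * M ^ 2) * ‖v‖ ^ 2 ≤ m * ‖w‖ ^ 2 := by
      have h5 : m / M ^ 2 * (‖v‖ ^ 2 / 16) ≤ m / M ^ 2 * (M ^ 2 * ‖w‖ ^ 2) := by gcongr
      have h6 : m / M ^ 2 * (M ^ 2 * ‖w‖ ^ 2) = m * ‖w‖ ^ 2 := by field_simp
      have h7 : m / M ^ 2 * (‖v‖ ^ 2 / 16) = m / (16 * M ^ 2) * ‖v‖ ^ 2 := by field_simp
      linarith
    linarith

/-- The derivative bounds integrate along the segment from `b` to `a`, which stays in `A`. For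
`support`, the velocity `w t` is orthogonal to `b + t • (a - b)`, so its pairing with `a` is `(1 -
t) ⟪w t, a - b⟫ ≥ 0`. -/
theorem isGaussChart (hS : IsStrictlyConvexSurface S N) {u₀ : Eucl n} (hu₀ : u₀ ∈ S)
    {m M : ℝ} (hm : 0 < m) (hM : 0 < M)
    (hB : ∀ u ∈ S, ∀ w, ⟪N u, w⟫_ℝ = 0 → m * ‖w‖ ^ 2 ≤ ⟪shapeOperator S N u w, w⟫_ℝ ∧
      ‖shapeOperator S N u w‖ ^ 2 ≤ M ^ 2 * ‖w‖ ^ 2) :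
    IsGaussChart (normalParams S N (N u₀)) (gaussParam S N) (N u₀) (m / (16 * M ^ 2)) (1 / m) := by
  set A := normalParams S N (N u₀) with hA
  have hconv : Convex ℝ A := hS.convex_normalParams _
  have key : ∀ a ∈ A, ∀ b ∈ A, ∃ w : ℝ → Eucl n,
      (∀ t ∈ Icc (0 : ℝ) 1, HasDerivWithinAt (fun t : ℝ => gaussParam S N (b + t • (a - b))) (w t)
        (Icc 0 1) t) ∧
      ∀ t ∈ Icc (0 : ℝ) 1, ⟪b + t • (a - b), w t⟫_ℝ = 0 ∧ ‖w t‖ ≤ 1 / m * ‖a - b‖ ∧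
        m / (16 * M ^ 2) * ‖a - b‖ ^ 2 ≤ ⟪w t, a - b⟫_ℝ := by
    intro a ha b hb
    have hmaps : MapsTo (fun t : ℝ => b + t • (a - b)) (Icc 0 1) A := by
      intro t ht
      have := hconv hb ha (a := 1 - t) (b := t) (by linarith [ht.2]) ht.1 (by ring)
      convert this using 1
      module
    have hv : ⟪a - b, N u₀⟫_ℝ = 0 := by rw [inner_sub_left, ha.1, hb.1, sub_self]
    have hex : ∀ t ∈ Icc (0 : ℝ) 1, ∃ w : Eucl n,
        HasDerivWithinAt (fun t : ℝ => gaussParam S N (b + t • (a - b))) w (Icc 0 1) t ∧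
        ⟪b + t • (a - b), w⟫_ℝ = 0 ∧ ‖w‖ ≤ 1 / m * ‖a - b‖ ∧
        m / (16 * M ^ 2) * ‖a - b‖ ^ 2 ≤ ⟪w, a - b⟫_ℝ := by
      intro t ht
      obtain ⟨D, hD, hD1, -⟩ := hS.exists_hasFDerivWithinAt_gaussParam (hmaps ht)
      have hline : HasDerivWithinAt (fun t : ℝ => b + t • (a - b)) (a - b) (Icc 0 1) t := by
        simpa using (((hasDerivAt_id t).smul_const (a - b)).const_add b).hasDerivWithinAt
      have h1 := hD.comp_hasDerivWithinAt t hline hmaps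
      obtain ⟨h2, h3⟩ := hD1 (a - b)
      exact ⟨_, h1, h2, hS.derivative_bounds hu₀ (hmaps ht) hm hM hB hv h2 h3⟩
    choose! w hw using hex
    exact ⟨w, fun t ht => (hw t ht).1, fun t ht => (hw t ht).2⟩
  have mvt : ∀ (φ φ' : ℝ → ℝ) (c : ℝ), (∀ t ∈ Icc (0 : ℝ) 1, HasDerivWithinAt φ (φ' t) (Icc 0 1) t) →
      (∀ t ∈ Icc (0 : ℝ) 1, c ≤ φ' t) → c ≤ φ 1 - φ 0 := by
    intro φ φ' c h1 h2
    obtain ⟨t, ht, h3⟩ := exists_hasDerivAt_eq_slope φ φ' zero_lt_one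
      (fun t ht => (h1 t ht).continuousWithinAt)
      (fun t ht => (h1 t (Ioo_subset_Icc_self ht)).hasDerivAt (Icc_mem_nhds ht.1 ht.2))
    have := h2 t (Ioo_subset_Icc_self ht)
    rw [h3] at this
    simpa using this
  refine ⟨hconv, fun a ha => ha.1, hS.norm_normal hu₀, fun a ha => (hS.norm_bounds hu₀ ha).2,
    by positivity, ?_, ?_, ?_⟩
  · intro a ha b hb
    obtain ⟨w, h1, h2⟩ := key a ha b hb
    have := norm_image_sub_le_of_norm_deriv_le_segment_01' h1
      (fun t ht => (h2 t (Ico_subset_Icc_self ht)).2.1)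
    simpa using this
  · intro a ha b hb
    obtain ⟨w, h1, h2⟩ := key a ha b hb
    have := mvt (fun t => ⟪gaussParam S N (b + t • (a - b)), a - b⟫_ℝ) (fun t => ⟪w t, a - b⟫_ℝ) _
      (fun t ht => by simpa using (h1 t ht).inner ℝ (hasDerivWithinAt_const t _ (a - b)))
      (fun t ht => (h2 t ht).2.2)
    rw [inner_sub_left]
    simpa using this
  · intro a ha b hb
    obtain ⟨w, h1, h2⟩ := key a ha b hb
    have := mvt (fun t => ⟪gaussParam S N (b + t • (a - b)), a⟫_ℝ) (fun t => ⟪w t, a⟫_ℝ) 0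
      (fun t ht => by simpa using (h1 t ht).inner ℝ (hasDerivWithinAt_const t _ a))
      (fun t ht => by
        obtain ⟨g1, -, g3⟩ := h2 t ht
        have e : a = (b + t • (a - b)) + (1 - t) • (a - b) := by module
        have e2 : ⟪w t, a⟫_ℝ = (1 - t) * ⟪w t, a - b⟫_ℝ := by
          conv_lhs => rw [e]
          rw [inner_add_right, inner_smul_right, real_inner_comm, g1, zero_add]
        change 0 ≤ ⟪w t, a⟫_ℝ
        rw [e2]
        exact mul_nonneg (by linarith [ht.2]) (le_trans (by positivity) g3))
    rw [inner_sub_left]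
    simpa using this

end IsStrictlyConvexSurface

end ChartConstruction

end SurfaceMaximal

end

/-! ### Hausdorff measure of Lipschitz images and of convex pieces of a hyperplane. -/

noncomputable section

namespace SurfaceMaximal

section HausdorffBounds

open Set

theorem _root_.LipschitzOnWith.euclideanHausdorffMeasure_image_le {X Y : Type*}
    [EMetricSpace X] [MeasurableSpace X] [BorelSpace X] [EMetricSpace Y]
    [MeasurableSpace Y] [BorelSpace Y] {K : ℝ≥0} {f : X → Y} {s : Set X}
    (h : LipschitzOnWith K f s) (d : ℕ) :
    (μHE[d] : Measure Y) (f '' s) ≤ (K : ℝ≥0∞) ^ d * (μHE[d] : Measure X) s := by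
  have h1 := h.hausdorffMeasure_image_le (d := (d : ℝ)) (by positivity)
  simp only [Measure.euclideanHausdorffMeasure_def, Measure.smul_apply,
    Measure.nnreal_smul_coe_apply]
  rw [ENNReal.rpow_natCast] at h1
  calc _ ≤ _ := mul_le_mul_right h1 _
    _ = _ := by ring

variable {n : ℕ}

/-- The volume of the unit ball in dimension `d`. -/
def unitBallVolume (d : ℕ) : ℝ≥0∞ :=
  ENNReal.ofReal (√Real.pi ^ d / Real.Gamma (d / 2 + 1))

theorem isometry_add_orthogonal (e : Eucl n) :
    Isometry (fun v : (Submodule.span ℝ {e})ᗮ => e + (v : Eucl n)) :=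
  Isometry.of_dist_eq fun v w => by rw [dist_add_left]; rfl

theorem finrank_orthogonal_singleton {e : Eucl n} (he : ‖e‖ = 1) :
    Module.finrank ℝ (Submodule.span ℝ {e})ᗮ = n - 1 := by
  have h1 := (Submodule.span ℝ {e}).finrank_add_finrank_orthogonal
  have he0 : e ≠ 0 := fun h => by rw [h, norm_zero] at he; exact zero_ne_one he
  rw [finrank_span_singleton he0, finrank_euclideanSpace, Fintype.card_fin] at h1
  omega

theorem exists_add_orthogonal {e a : Eucl n} (he : ‖e‖ = 1) (ha : ⟪a, e⟫_ℝ = 1) :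
    ∃ v : (Submodule.span ℝ {e})ᗮ, e + (v : Eucl n) = a := by
  refine ⟨⟨a - e, Submodule.mem_orthogonal_singleton_iff_inner_left.2 ?_⟩, by simp⟩
  rw [inner_sub_left, ha, real_inner_self_eq_norm_sq, he]
  norm_num

theorem euclideanHausdorffMeasure_hyperplane_ball_le {e a : Eucl n} (he : ‖e‖ = 1)
    (ha : ⟪a, e⟫_ℝ = 1) (r : ℝ) :
    (μHE[n - 1] : Measure (Eucl n)) {b | ⟪b, e⟫_ℝ = 1 ∧ ‖b - a‖ ≤ r} ≤
      ENNReal.ofReal r ^ (n - 1) * unitBallVolume (n - 1) := by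
  obtain ⟨v, rfl⟩ := exists_add_orthogonal he ha
  have hsub : {b | ⟪b, e⟫_ℝ = 1 ∧ ‖b - (e + (v : Eucl n))‖ ≤ r} ⊆
      (fun v : (Submodule.span ℝ {e})ᗮ => e + (v : Eucl n)) '' Metric.closedBall v r := by
    rintro b ⟨hb, hbr⟩
    obtain ⟨w, rfl⟩ := exists_add_orthogonal he hb
    refine ⟨w, ?_, rfl⟩
    rw [Metric.mem_closedBall, dist_eq_norm]
    simpa using hbr
  refine (measure_mono hsub).trans ?_
  rw [(isometry_add_orthogonal e).euclideanHausdorffMeasure_image]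
  have hd := finrank_orthogonal_singleton he
  have : (μHE[n - 1] : Measure (Submodule.span ℝ {e})ᗮ) = volume := by
    rw [← hd]; exact InnerProductSpace.euclideanHausdorffMeasure_eq_volume
  rw [this]
  -- The volume formula for balls requires a nontrivial space; a zero-dimensional one has total mass
  -- one.
  rcases eq_or_ne (n - 1) 0 with h0 | h0
  · have hsubs : Subsingleton (Submodule.span ℝ {e})ᗮ :=
      Module.finrank_zero_iff.1 (hd.trans h0)
    have h1 : (volume : Measure (Submodule.span ℝ {e})ᗮ) univ = 1 := by
      have h2 := (stdOrthonormalBasis ℝ (Submodule.span ℝ {e})ᗮ).volume_parallelepiped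
      have h3 : parallelepiped (stdOrthonormalBasis ℝ (Submodule.span ℝ {e})ᗮ) = univ :=
        Subsingleton.eq_univ_of_nonempty ⟨0, by
          rw [mem_parallelepiped_iff]
          exact ⟨0, by simp, Subsingleton.elim _ _⟩⟩
      rwa [h3] at h2
    rw [h0, pow_zero, one_mul]
    refine (measure_mono (subset_univ _)).trans (h1.le.trans ?_)
    simp [unitBallVolume]
  · have : Nontrivial (Submodule.span ℝ {e})ᗮ :=
      Module.finrank_pos_iff.1 (by rw [hd]; omega)
    rw [InnerProductSpace.volume_closedBall, hd, unitBallVolume]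

/-- The interior of `A` relative to the hyperplane `⟪a, e⟫ = 1`. -/
def relInterior (e : Eucl n) (A : Set (Eucl n)) : Set (Eucl n) :=
  {a ∈ A | ∃ r > 0, ∀ b, ⟪b, e⟫_ℝ = 1 → ‖b - a‖ < r → b ∈ A}

/-- In the linear hyperplane `e^⊥` this is contained in the frontier of a convex set, which is
Lebesgue null. It allows boundary points of `S` to be ignored without any description of the
boundary. -/
theorem euclideanHausdorffMeasure_diff_relInterior {e : Eucl n} {A : Set (Eucl n)} (he : ‖e‖ = 1)
    (hA : Convex ℝ A) (hAe : ∀ a ∈ A, ⟪a, e⟫_ℝ = 1) :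
    (μHE[n - 1] : Measure (Eucl n)) (A \ relInterior e A) = 0 := by
  let ι : (Submodule.span ℝ {e})ᗮ → Eucl n := fun v => e + (v : Eucl n)
  have hconv : Convex ℝ (ι ⁻¹' A) := by
    intro v hv w hw s t hs ht hst
    have := hA hv hw hs ht hst
    have e1 : ι (s • v + t • w) = s • ι v + t • ι w := by
      simp only [ι, Submodule.coe_add, Submodule.coe_smul]
      obtain rfl : t = 1 - s := by linarith
      module
    rw [mem_preimage, e1]
    exact this
  have hsub : A \ relInterior e A ⊆ ι '' frontier (ι ⁻¹' A) := by
    rintro a ⟨haA, ha⟩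
    obtain ⟨v, rfl⟩ := exists_add_orthogonal he (hAe a haA)
    refine ⟨v, ⟨subset_closure haA, fun hv => ha ⟨haA, ?_⟩⟩, rfl⟩
    rw [mem_interior_iff_mem_nhds, Metric.mem_nhds_iff] at hv
    obtain ⟨r, hr, hball⟩ := hv
    refine ⟨r, hr, fun b hb hbr => ?_⟩
    obtain ⟨w, rfl⟩ := exists_add_orthogonal he hb
    refine hball ?_
    rw [Metric.mem_ball, dist_eq_norm]
    simpa using hbr
  refine measure_mono_null hsub ?_
  rw [(isometry_add_orthogonal e).euclideanHausdorffMeasure_image,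
    ← finrank_orthogonal_singleton he]
  exact hconv.addHaar_frontier _

end HausdorffBounds

/-! ### The surface and its reflections seen in the chart. -/

section SurfaceChart

open Filter Topology Set

variable {n : ℕ}

/-- A Gauss chart of the surface `S`. -/
structure IsChartOf (S : Set (Eucl n)) (N : Eucl n → Eucl n) (A : Set (Eucl n))
    (X : Eucl n → Eucl n) (e : Eucl n) (l L : ℝ) : Prop extends IsGaussChart A X e l L where
  image_eq : X '' A = S
  normal : ∀ a ∈ A, N (X a) = ‖a‖⁻¹ • a
  continuousOn_normal : ContinuousOn N S
  normal_pos : ∀ u ∈ S, 0 < ⟪N u, e⟫_ℝ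
  deriv : ∀ a ∈ A, ∃ D : Eucl n →L[ℝ] Eucl n, HasFDerivWithinAt X D A a ∧
    ∀ w, ⟪a, w⟫_ℝ = 0 → ∃ v, ⟪v, e⟫_ℝ = 0 ∧ D v = w

theorem IsStrictlyConvexSurface.exists_chart (hn : 2 ≤ n) {S : Set (Eucl n)} {N : Eucl n → Eucl n}
    (hS : IsStrictlyConvexSurface S N) {Q : ℝ≥0} (hQ : curvatureQuotient S N ≤ Q)
    (hne : S.Nonempty) :
    ∃ A X e l L, IsChartOf S N A X e l L ∧ L ≤ (16 * Q ^ 4 + 1) * l := by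
  obtain ⟨m, M, hm, hM, hMm, hB⟩ := exists_shapeOperator_bounds hn hS hQ hne
  obtain ⟨u₀, hu₀⟩ := hne
  refine ⟨_, _, _, _, _, ⟨hS.isGaussChart hu₀ hm hM hB, hS.image_gaussParam hu₀,
    fun a ha => normal_gaussParam ha, hS.continuousOn_normal, fun u hu => hS.inner_pos hu hu₀,
    fun a ha => ?_⟩, ?_⟩
  · obtain ⟨D, h1, -, h3⟩ := hS.exists_hasFDerivWithinAt_gaussParam ha
    exact ⟨D, h1, h3⟩
  · have hQ0 : (Q : ℝ) ≠ 0 := by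
      intro h0
      rw [h0] at hMm
      simp at hMm
      linarith
    -- With `M = Q² m`, the ratio `L / l = 16 M² / m²` is `16 Q⁴`.
    have e1 : 1 / m = 16 * Q ^ 4 * (m / (16 * M ^ 2)) := by
      rw [hMm]
      field_simp
    rw [e1, add_mul, one_mul]
    have : 0 < m / (16 * M ^ 2) := by positivity
    linarith

namespace IsChartOf

variable {S : Set (Eucl n)} {N : Eucl n → Eucl n} {A : Set (Eucl n)} {X : Eucl n → Eucl n}
  {e : Eucl n} {l L : ℝ}

theorem ne_zero (h : IsChartOf S N A X e l L) {a : Eucl n} (ha : a ∈ A) : a ≠ 0 := by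
  rintro rfl
  have := h.affine 0 ha
  simp at this

theorem mem (h : IsChartOf S N A X e l L) {a : Eucl n} (ha : a ∈ A) : X a ∈ S := by
  rw [← h.image_eq]; exact mem_image_of_mem X ha

/-- The parameter of a point. -/
def param (N : Eucl n → Eucl n) (e u : Eucl n) : Eucl n := (⟪N u, e⟫_ℝ)⁻¹ • N u

theorem param_apply (h : IsChartOf S N A X e l L) {a : Eucl n} (ha : a ∈ A) :
    param N e (X a) = a := by
  have ha0 : ‖a‖ ≠ 0 := norm_ne_zero_iff.2 (h.ne_zero ha)
  rw [param, h.normal a ha, real_inner_smul_left, h.affine a ha, mul_one, inv_inv, smul_smul,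
    mul_inv_cancel₀ ha0, one_smul]

theorem continuousOn_param (h : IsChartOf S N A X e l L) : ContinuousOn (param N e) S :=
  ((h.continuousOn_normal.inner continuousOn_const).inv₀ fun u hu => (h.normal_pos u hu).ne').smul
    h.continuousOn_normal

theorem exists_param (h : IsChartOf S N A X e l L) {u : Eucl n} (hu : u ∈ S) :
    ∃ a ∈ A, X a = u := by
  rw [← h.image_eq] at hu
  exact hu

theorem inner_normal_eq_zero_iff (h : IsChartOf S N A X e l L) {a w : Eucl n} (ha : a ∈ A) :
    ⟪w, N (X a)⟫_ℝ = 0 ↔ ⟪w, a⟫_ℝ = 0 := by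
  rw [h.normal a ha, inner_smul_right, mul_eq_zero]
  simp [h.ne_zero ha]

theorem refl_inner_ne (h : IsChartOf S N A X e l L) {a b : Eucl n} (ha : a ∈ A) (hb : b ∈ A)
    (hab : a ≠ b) : 0 < ⟪X a - X b, a⟫_ℝ := by
  have h1 := h.inner_lower ha hb
  have h2 : 0 < ‖a - b‖ := norm_pos_iff.2 (sub_ne_zero.2 hab)
  have := h.pos
  exact lt_of_lt_of_le (by positivity) h1

/-- The reflection condition in the chart. -/
theorem isReflection_iff (h : IsChartOf S N A X e l L) {a b c : Eucl n} (ha : a ∈ A) (hb : b ∈ A)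
    (hc : c ∈ A) (hab : a ≠ b) :
    IsReflection S N (X a) (X b) (X c) ↔
      ∃ s, IsGaussChart.Refl X a b s ∧ c = a + s • (a - b) := by
  constructor
  · rintro ⟨-, hne, horth, hdep⟩
    rw [h.inner_normal_eq_zero_iff ha] at horth
    rw [Fintype.not_linearIndependent_iff] at hdep
    obtain ⟨g, hg, i, hi⟩ := hdep
    simp only [Fin.sum_univ_three, Matrix.cons_val_zero, Matrix.cons_val_one,
      Matrix.cons_val_two, Matrix.head_cons, Matrix.tail_cons, h.normal a ha, h.normal b hb,
      h.normal c hc, smul_smul] at hg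
    have na := norm_ne_zero_iff.2 (h.ne_zero ha)
    have nb := norm_ne_zero_iff.2 (h.ne_zero hb)
    have nc := norm_ne_zero_iff.2 (h.ne_zero hc)
    set α := g 0 * ‖a‖⁻¹ with hα
    set β := g 1 * ‖b‖⁻¹ with hβ
    set γ := g 2 * ‖c‖⁻¹ with hγ
    -- Pairing the dependence relation with `e` turns it into an affine relation: the parameters are
    -- collinear.
    have hsum : α + β + γ = 0 := by
      have := congrArg (fun x => ⟪x, e⟫_ℝ) hg
      simpa [inner_add_left, real_inner_smul_left, h.affine a ha, h.affine b hb,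
        h.affine c hc] using this
    have hγ0 : γ ≠ 0 := by
      intro h0
      have hβα : β = -α := by linarith
      have h1 : α • (a - b) = 0 := by
        rw [h0, hβα, zero_smul, add_zero] at hg
        rw [← hg]; module
      have hα0 : α = 0 := (smul_eq_zero.1 h1).resolve_right (sub_ne_zero.2 hab)
      have hβ0 : β = 0 := by rw [hβα, hα0, neg_zero]
      apply hi
      fin_cases i
      · exact (mul_eq_zero.1 hα0).resolve_right (inv_ne_zero na)
      · exact (mul_eq_zero.1 hβ0).resolve_right (inv_ne_zero nb)
      · exact (mul_eq_zero.1 h0).resolve_right (inv_ne_zero nc)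
    set s := β / γ with hs
    have hβs : β = s * γ := by rw [hs]; field_simp
    have hαs : α = -(1 + s) * γ := by linear_combination hsum - hβs
    have hcs : c = a + s • (a - b) := by
      have h1 : γ • (c - (a + s • (a - b))) = 0 := by
        rw [← hg, hαs, hβs]; module
      exact sub_eq_zero.1 ((smul_eq_zero.1 h1).resolve_left hγ0)
    refine ⟨s, ⟨?_, by rw [← hcs]; exact horth⟩, hcs⟩
    -- If `s = 0` then `c = a`, but the height at `b ≠ a` is positive. If `s < 0`, then `b` and `c`
    -- are on one ray from `a`, where equal heights force `c = b`.
    by_contra hs0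
    push Not at hs0
    rcases hs0.eq_or_lt with h0 | hneg
    · rw [h0, zero_smul, add_zero] at hcs
      rw [hcs, ← neg_sub, inner_neg_left] at horth
      have := h.refl_inner_ne ha hb hab
      linarith
    · have hb' : a + (1 : ℝ) • (b - a) = b := by module
      have hc' : a + (-s) • (b - a) = c := by rw [hcs]; module
      have hv : b - a ≠ 0 := sub_ne_zero.2 hab.symm
      rcases lt_trichotomy (-s) 1 with h1 | h1 | h1
      · have := h.inner_ray_pos (a := a) (by linarith) h1 hv (by rw [hc']; exact hc)
          (by rw [hb']; exact hb)
        rw [hb', hc', ← neg_sub, inner_neg_left] at this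
        linarith
      · rw [h1, hb'] at hc'
        exact hne (by rw [hc'])
      · have := h.inner_ray_pos (a := a) one_pos h1 hv (by rw [hb']; exact hb)
          (by rw [hc']; exact hc)
        rw [hb', hc'] at this
        linarith
  · rintro ⟨s, ⟨hs, horth⟩, rfl⟩
    refine ⟨h.mem hc, ?_, (h.inner_normal_eq_zero_iff ha).2 horth, ?_⟩
    · intro heq
      have h1 : a + s • (a - b) = b := h.injOn hc hb heq
      have h2 : (1 + s) • (a - b) = 0 := by
        rw [← sub_eq_zero] at h1
        rw [← h1]; module
      rcases smul_eq_zero.1 h2 with h3 | h3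
      · linarith
      · exact hab (sub_eq_zero.1 h3)
    · rw [Fintype.not_linearIndependent_iff]
      have na := norm_ne_zero_iff.2 (h.ne_zero ha)
      have nb := norm_ne_zero_iff.2 (h.ne_zero hb)
      have nc := norm_ne_zero_iff.2 (h.ne_zero hc)
      refine ⟨![(1 + s) * ‖a‖, -s * ‖b‖, -‖a + s • (a - b)‖], ?_, 2, by simpa using nc⟩
      simp only [Fin.sum_univ_three, Matrix.cons_val_zero, Matrix.cons_val_one,
        Matrix.cons_val_two, Matrix.head_cons, Matrix.tail_cons, h.normal a ha, h.normal b hb,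
        h.normal _ hc, smul_smul, mul_assoc, neg_mul,
        mul_inv_cancel₀ na, mul_inv_cancel₀ nb, mul_inv_cancel₀ nc]
      module

end IsChartOf

end SurfaceChart

end SurfaceMaximal

end

/-! ### The regular part of `S` and geometric bounds for the reflection. -/

noncomputable section

namespace SurfaceMaximal

open Filter Topology Set

variable {n : ℕ}

section RelInterior

variable {e : Eucl n} {A : Set (Eucl n)}

theorem relInterior_subset : relInterior e A ⊆ A := fun _ h => h.1

theorem exists_isOpen_relInterior (hA : ∀ a ∈ A, ⟪a, e⟫_ℝ = 1) :
    ∃ W : Set (Eucl n), IsOpen W ∧ relInterior e A = {a | ⟪a, e⟫_ℝ = 1} ∩ W := by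
  refine ⟨{x | ∃ r > 0, ∀ b, ⟪b, e⟫_ℝ = 1 → ‖b - x‖ < r → b ∈ A}, ?_, ?_⟩
  · rw [Metric.isOpen_iff]
    rintro x ⟨r, hr, hx⟩
    refine ⟨r / 2, by positivity, fun y hy => ⟨r / 2, by positivity, fun b hb hby => hx b hb ?_⟩⟩
    rw [Metric.mem_ball, dist_eq_norm] at hy
    calc ‖b - x‖ = ‖(b - y) + (y - x)‖ := by congr 1; abel
      _ ≤ ‖b - y‖ + ‖y - x‖ := norm_add_le _ _
      _ < r := by linarith
  · ext x
    constructor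
    · rintro ⟨h1, h2⟩
      exact ⟨hA x h1, h2⟩
    · rintro ⟨h1, r, hr, h2⟩
      exact ⟨h2 x h1 (by simpa using hr), r, hr, h2⟩

theorem relInterior_mem_nhdsWithin (hA : ∀ a ∈ A, ⟪a, e⟫_ℝ = 1) {a : Eucl n}
    (ha : a ∈ relInterior e A) : relInterior e A ∈ 𝓝[{a | ⟪a, e⟫_ℝ = 1}] a := by
  obtain ⟨W, hW, h⟩ := exists_isOpen_relInterior hA
  rw [h] at ha ⊢
  exact inter_mem self_mem_nhdsWithin (mem_nhdsWithin_of_mem_nhds (hW.mem_nhds ha.2))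

theorem measurableSet_relInterior (hA : ∀ a ∈ A, ⟪a, e⟫_ℝ = 1) :
    MeasurableSet (relInterior e A) := by
  obtain ⟨W, hW, h⟩ := exists_isOpen_relInterior hA
  rw [h]
  refine MeasurableSet.inter ?_ hW.measurableSet
  exact (isClosed_eq (by fun_prop) continuous_const).measurableSet

theorem convex_relInterior (hconv : Convex ℝ A) (hA : ∀ a ∈ A, ⟪a, e⟫_ℝ = 1) :
    Convex ℝ (relInterior e A) := by
  rintro a ⟨haA, r, hr, ha⟩ b ⟨hbA, r', hr', hb⟩ s t hs ht hst
  have hz := hconv haA hbA hs ht hst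
  refine ⟨hz, min r r', lt_min hr hr', fun y hy hyz => ?_⟩
  set z := s • a + t • b with hz'
  have hd : ⟪y - z, e⟫_ℝ = 0 := by rw [inner_sub_left, hy, hA z hz, sub_self]
  have h1 : a + (y - z) ∈ A := ha _ (by rw [inner_add_left, hd, hA a haA, add_zero])
    (by rw [add_sub_cancel_left]; exact hyz.trans_le (min_le_left _ _))
  have h2 : b + (y - z) ∈ A := hb _ (by rw [inner_add_left, hd, hA b hbA, add_zero])
    (by rw [add_sub_cancel_left]; exact hyz.trans_le (min_le_right _ _))
  have h3 := hconv h1 h2 hs ht hst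
  have h4 : s • (a + (y - z)) + t • (b + (y - z)) = y := by
    have : s • (a + (y - z)) + t • (b + (y - z)) = z + (s + t) • (y - z) := by
      rw [hz']; module
    rw [this, hst]; module
  rwa [h4] at h3

end RelInterior

/-- The part of the surface parametrised by the relative interior of the parameter domain. -/
def regularPart (X : Eucl n → Eucl n) (e : Eucl n) (A : Set (Eucl n)) : Set (Eucl n) :=
  X '' relInterior e A

namespace IsChartOf

variable {S : Set (Eucl n)} {N : Eucl n → Eucl n} {A : Set (Eucl n)} {X : Eucl n → Eucl n}
  {e : Eucl n} {l L K : ℝ}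

theorem regularPart_subset (h : IsChartOf S N A X e l L) : regularPart X e A ⊆ S := by
  rintro _ ⟨a, ha, rfl⟩
  exact h.mem ha.1

theorem measurableSet_regularPart (h : IsChartOf S N A X e l L) :
    MeasurableSet (regularPart X e A) :=
  (measurableSet_relInterior h.affine).image_of_continuousOn_injOn
    (h.continuousOn.mono relInterior_subset) (h.injOn.mono relInterior_subset)

theorem lip' (h : IsChartOf S N A X e l L) (hLK : L ≤ K * l) {a b : Eucl n} (ha : a ∈ A)
    (hb : b ∈ A) : ‖X a - X b‖ ≤ K * l * ‖a - b‖ :=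
  (h.lip a ha b hb).trans (by gcongr)

theorem lipschitzOnWith (h : IsChartOf S N A X e l L) (hK : 1 ≤ K) (hLK : L ≤ K * l) :
    LipschitzOnWith (Real.toNNReal (K * l)) X A := by
  have := h.pos
  apply LipschitzOnWith.of_dist_le_mul
  intro a ha b hb
  rw [dist_eq_norm, dist_eq_norm, Real.coe_toNNReal _ (by positivity)]
  exact h.lip' hLK ha hb

theorem lip_of_param (h : IsChartOf S N A X e l L) (hK : 1 ≤ K) (hLK : L ≤ K * l)
    {a b a' b' : Eucl n} {C : ℝ} (hC : 0 ≤ C) (ha : a ∈ A) (hb : b ∈ A) (ha' : a' ∈ A)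
    (hb' : b' ∈ A) (hab : ‖a' - b'‖ ≤ C * ‖a - b‖) : ‖X a' - X b'‖ ≤ C * K * ‖X a - X b‖ := by
  have hl := h.pos
  calc ‖X a' - X b'‖ ≤ K * l * ‖a' - b'‖ := h.lip' hLK ha' hb'
    _ ≤ K * l * (C * ‖a - b‖) := by gcongr
    _ = C * K * (l * ‖a - b‖) := by ring
    _ ≤ C * K * ‖X a - X b‖ := by gcongr; exact h.antilip ha hb

theorem exists_refl (h : IsChartOf S N A X e l L) {u u' u'' : Eucl n} (hu : u ∈ S) (hu' : u' ∈ S)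
    (hne : u' ≠ u) (hr : IsReflection S N u u' u'') :
    ∃ a ∈ A, ∃ b ∈ A, ∃ s, a ≠ b ∧ a + s • (a - b) ∈ A ∧ IsGaussChart.Refl X a b s ∧
      X a = u ∧ X b = u' ∧ X (a + s • (a - b)) = u'' := by
  obtain ⟨a, ha, rfl⟩ := h.exists_param hu
  obtain ⟨b, hb, rfl⟩ := h.exists_param hu'
  obtain ⟨c, hc, rfl⟩ := h.exists_param hr.1
  have hab : a ≠ b := fun h => hne (by rw [h])
  obtain ⟨s, hs, rfl⟩ := (h.isReflection_iff ha hb hc hab).1 hr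
  exact ⟨a, ha, b, hb, s, hab, hc, hs, rfl, rfl, rfl⟩

theorem isReflection_unique (h : IsChartOf S N A X e l L) {u u' c₁ c₂ : Eucl n} (hu : u ∈ S)
    (hu' : u' ∈ S) (hne : u' ≠ u) (h₁ : IsReflection S N u u' c₁) (h₂ : IsReflection S N u u' c₂) :
    c₁ = c₂ := by
  obtain ⟨a, ha, b, hb, s, hab, hc, hs, rfl, rfl, rfl⟩ := h.exists_refl hu hu' hne h₁
  obtain ⟨a', ha', b', hb', t, -, hc', ht, e1, e2, rfl⟩ := h.exists_refl hu hu' hne h₂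
  obtain rfl := h.injOn ha' ha e1
  obtain rfl := h.injOn hb' hb e2
  rw [h.refl_unique hab hs ht hc hc']

/-- In parameters `b = a + (1 / s) • (a - c)`, with `c` the reflected parameter. Hence `R_u` is an
involution. -/
theorem isReflection_symm (h : IsChartOf S N A X e l L) {u u' u'' : Eucl n} (hu : u ∈ S)
    (hu' : u' ∈ S) (hne : u' ≠ u) (hr : IsReflection S N u u' u'') :
    u'' ≠ u ∧ IsReflection S N u u'' u' := by
  obtain ⟨a, ha, b, hb, s, hab, hc, hs, rfl, rfl, rfl⟩ := h.exists_refl hu hu' hne hr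
  have hs0 := hs.1
  have hac : a ≠ a + s • (a - b) := by
    intro heq
    have : s • (a - b) = 0 := by simpa using heq.symm
    rcases smul_eq_zero.1 this with h1 | h1
    · exact hs0.ne' h1
    · exact hab (sub_eq_zero.1 h1)
  have hb2 : b = a + (1 / s) • (a - (a + s • (a - b))) := by
    have : (1 / s) • (a - (a + s • (a - b))) = -(1 / s * s) • (a - b) := by module
    rw [this, one_div, inv_mul_cancel₀ hs0.ne']
    module
  refine ⟨fun heq => hac (h.injOn ha hc heq.symm), ?_⟩
  refine (h.isReflection_iff ha hc hb hac).2 ⟨1 / s, ⟨by positivity, ?_⟩, hb2⟩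
  rw [← hb2, ← neg_sub, inner_neg_left, hs.2, neg_zero]

/-- The parameter `a` lies between `b` and its reflection, hence no farther from either than they
are from each other; the chart transfers this with a loss of `K`. -/
theorem norm_sub_le_of_isReflection (h : IsChartOf S N A X e l L) (hK : 1 ≤ K) (hLK : L ≤ K * l)
    {u u' u'' : Eucl n} (hu : u ∈ S) (hu' : u' ∈ S) (hne : u' ≠ u)
    (hr : IsReflection S N u u' u'') : ‖u' - u‖ ≤ K * ‖u' - u''‖ ∧ ‖u'' - u‖ ≤ K * ‖u' - u''‖ := by
  obtain ⟨a, ha, b, hb, s, hab, hc, hs, rfl, rfl, rfl⟩ := h.exists_refl hu hu' hne hr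
  have hs0 := hs.1
  have e1 : b - (a + s • (a - b)) = -((1 + s) • (a - b)) := by module
  have e2 : ‖b - (a + s • (a - b))‖ = (1 + s) * ‖a - b‖ := by
    rw [e1, norm_neg, norm_smul, Real.norm_of_nonneg (by positivity)]
  have n0 := norm_nonneg (a - b)
  constructor
  · have := h.lip_of_param hK hLK zero_le_one hb hc hb ha (by
      rw [e2, norm_sub_rev b a]; nlinarith)
    simpa using this
  · have := h.lip_of_param hK hLK zero_le_one hb hc hc ha (by
      rw [e2, add_sub_cancel_left, norm_smul, Real.norm_of_nonneg hs0.le]; nlinarith)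
    simpa using this

theorem isReflection_lipschitz_left (h : IsChartOf S N A X e l L) (hK : 1 ≤ K) (hLK : L ≤ K * l)
    {u u₁ u₂ c₁ c₂ : Eucl n} (hu : u ∈ S) (hu₁ : u₁ ∈ S) (hu₂ : u₂ ∈ S) (hne₁ : u₁ ≠ u)
    (hne₂ : u₂ ≠ u) (h₁ : IsReflection S N u u₁ c₁) (h₂ : IsReflection S N u u₂ c₂) :
    ‖c₁ - c₂‖ ≤ 45 * K ^ 5 * ‖u₁ - u₂‖ := by
  obtain ⟨a, ha, b, hb, s, hab, hc, hs, rfl, rfl, rfl⟩ := h.exists_refl hu hu₁ hne₁ h₁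
  obtain ⟨a', ha', b', hb', t, hab', hc', ht, e1, rfl, rfl⟩ := h.exists_refl hu hu₂ hne₂ h₂
  obtain rfl := h.injOn ha' ha e1
  have h1 := h.refl_lipschitz_left hK hLK ha hb hb' hc hc' hab hab' hs ht
  have h2 := h.lip_of_param hK hLK (by positivity) hb hb' hc hc' h1
  refine h2.trans ?_
  gcongr ?_ * _
  have : 0 ≤ K ^ 5 := by positivity
  nlinarith

theorem isReflection_lipschitz_right (h : IsChartOf S N A X e l L) (hK : 1 ≤ K) (hLK : L ≤ K * l)
    {u' u₁ u₂ c₁ c₂ : Eucl n} (hu' : u' ∈ S) (hu₁ : u₁ ∈ S) (hu₂ : u₂ ∈ S) (hne₁ : u' ≠ u₁)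
    (hne₂ : u' ≠ u₂) (h₁ : IsReflection S N u₁ u' c₁) (h₂ : IsReflection S N u₂ u' c₂) :
    ‖c₁ - c₂‖ ≤ 45 * K ^ 5 * ‖u₁ - u₂‖ := by
  obtain ⟨a, ha, b, hb, s, hab, hc, hs, rfl, rfl, rfl⟩ := h.exists_refl hu₁ hu' hne₁ h₁
  obtain ⟨a', ha', b', hb', t, hab', hc', ht, rfl, e1, rfl⟩ := h.exists_refl hu₂ hu' hne₂ h₂
  obtain rfl := h.injOn hb' hb e1
  have h1 := h.refl_lipschitz_right hK hLK hb ha ha' hc hc' hab hab' hs ht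
  have h2 := h.lip_of_param hK hLK (by positivity) ha ha' hc hc' h1
  refine h2.trans (le_of_eq ?_)
  ring

theorem tendsto_param (h : IsChartOf S N A X e l L) {a : Eucl n} (ha : a ∈ A) :
    Tendsto (param N e) (𝓝[S] (X a)) (𝓝[A] a) := by
  refine tendsto_nhdsWithin_iff.2 ⟨?_, ?_⟩
  · have := h.continuousOn_param (X a) (h.mem ha)
    rwa [ContinuousWithinAt, h.param_apply ha] at this
  · filter_upwards [self_mem_nhdsWithin] with x hx
    obtain ⟨b, hb, rfl⟩ := h.exists_param hx
    rwa [h.param_apply hb]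

theorem relInterior_mem_nhdsWithin (h : IsChartOf S N A X e l L) {a : Eucl n}
    (ha : a ∈ relInterior e A) : relInterior e A ∈ 𝓝[A] a :=
  nhdsWithin_mono a h.affine (SurfaceMaximal.relInterior_mem_nhdsWithin h.affine ha)

theorem eventually_of_param (h : IsChartOf S N A X e l L) {a : Eucl n} (ha : a ∈ A)
    {p : Eucl n → Prop} (hp : ∀ᶠ b in 𝓝[A] a, p (X b)) : ∀ᶠ x in 𝓝[S] (X a), p x := by
  have h1 : ∀ᶠ x in 𝓝[S] (X a), p (X (param N e x)) := (h.tendsto_param ha).eventually hp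
  have h2 : ∀ᶠ x in 𝓝[S] (X a), x ∈ S := self_mem_nhdsWithin
  filter_upwards [h1, h2] with x hx hxS
  obtain ⟨b, hb, rfl⟩ := h.exists_param hxS
  rwa [h.param_apply hb] at hx

/-- The domain of `x ↦ R_x u'` is a neighbourhood of each regular point at which the reflection is
regular. -/
theorem eventually_exists_isReflection (h : IsChartOf S N A X e l L) {u u' u'' : Eucl n}
    (hu : u ∈ regularPart X e A) (hu' : u' ∈ S) (hne : u' ≠ u) (hr : IsReflection S N u u' u'')
    (hu'' : u'' ∈ regularPart X e A) :
    ∀ᶠ x in 𝓝[S] u, x ∈ regularPart X e A ∧ u' ≠ x ∧ ∃ y ∈ regularPart X e A,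
      IsReflection S N x u' y := by
  obtain ⟨a, ha, b, hb, s, hab, hc, hs, rfl, rfl, rfl⟩ :=
    h.exists_refl (h.regularPart_subset hu) hu' hne hr
  have haI : a ∈ relInterior e A := by
    obtain ⟨a', ha', he⟩ := hu
    rwa [← h.injOn ha'.1 ha he]
  have hcI : a + s • (a - b) ∈ relInterior e A := by
    obtain ⟨a', ha', he⟩ := hu''
    rwa [← h.injOn ha'.1 hc he]
  have hv : a - b ≠ 0 := sub_ne_zero.2 hab
  have haff : ∀ x ∈ A, ∀ t : ℝ, ⟪x + t • (x - b), e⟫_ℝ = 1 := by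
    intro x hx t
    rw [inner_add_left, real_inner_smul_left, inner_sub_left, h.affine x hx, h.affine b hb]
    ring
  -- Slightly beyond the reflected parameter `⟪X b - X (·), a⟫` is positive, whereas at `a` it is
  -- negative. For `x` near `a` the same signs hold, and the intermediate value theorem gives a
  -- reflection of `b` in `x`, inside the convex relative interior.
  obtain ⟨τ, hτs, hτI⟩ : ∃ τ > s, a + τ • (a - b) ∈ relInterior e A := by
    have hcont : Tendsto (fun t : ℝ => a + t • (a - b)) (𝓝[>] s)
        (𝓝[{x | ⟪x, e⟫_ℝ = 1}] (a + s • (a - b))) := by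
      refine tendsto_nhdsWithin_iff.2 ⟨?_, Eventually.of_forall fun t => haff a ha t⟩
      have : Continuous fun t : ℝ => a + t • (a - b) := by fun_prop
      exact (this.tendsto s).mono_left nhdsWithin_le_nhds
    have h1 : ∀ᶠ t in 𝓝[>] s, a + t • (a - b) ∈ relInterior e A :=
      hcont (SurfaceMaximal.relInterior_mem_nhdsWithin h.affine hcI)
    have h2 : ∀ᶠ t in 𝓝[>] s, s < t := self_mem_nhdsWithin
    obtain ⟨t, ht1, ht2⟩ := (h1.and h2).exists
    exact ⟨t, ht2, ht1⟩
  have hτ0 : 0 < τ := hs.1.trans hτs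
  have hfpos : 0 < ⟪X b - X (a + τ • (a - b)), a⟫_ℝ := by
    have h1 := h.inner_ray_pos hs.1 hτs hv hc hτI.1
    have h2 := hs.2
    simp only [inner_sub_left] at h1 h2 ⊢
    linarith
  have hcA : Tendsto (fun x => x + τ • (x - b)) (𝓝[A] a)
      (𝓝[{x | ⟪x, e⟫_ℝ = 1}] (a + τ • (a - b))) := by
    refine tendsto_nhdsWithin_iff.2 ⟨?_, ?_⟩
    · have : Continuous fun x : Eucl n => x + τ • (x - b) := by fun_prop
      exact (this.tendsto a).mono_left nhdsWithin_le_nhds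
    · filter_upwards [self_mem_nhdsWithin] with x hx using haff x hx τ
  have hev1 : ∀ᶠ x in 𝓝[A] a, x + τ • (x - b) ∈ relInterior e A :=
    hcA (SurfaceMaximal.relInterior_mem_nhdsWithin h.affine hτI)
  have hev2 : ∀ᶠ x in 𝓝[A] a, 0 < ⟪X b - X (x + τ • (x - b)), x⟫_ℝ := by
    have h1 : Tendsto (fun x => x + τ • (x - b)) (𝓝[A] a) (𝓝[A] (a + τ • (a - b))) :=
      tendsto_nhdsWithin_iff.2 ⟨hcA.mono_right nhdsWithin_le_nhds, hev1.mono fun x hx => hx.1⟩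
    have h2 : Tendsto (fun x => X (x + τ • (x - b))) (𝓝[A] a) (𝓝 (X (a + τ • (a - b)))) :=
      (h.continuousOn _ hτI.1).tendsto.comp h1
    have h3 : Tendsto (fun x => ⟪X b - X (x + τ • (x - b)), x⟫_ℝ) (𝓝[A] a)
        (𝓝 ⟪X b - X (a + τ • (a - b)), a⟫_ℝ) :=
      (tendsto_const_nhds.sub h2).inner (tendsto_id.mono_left nhdsWithin_le_nhds)
    exact h3.eventually_const_lt hfpos
  have hev3 : ∀ᶠ x in 𝓝[A] a, x ≠ b :=
    mem_nhdsWithin_of_mem_nhds (isOpen_ne.mem_nhds hab)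
  refine h.eventually_of_param ha (p := fun x => x ∈ regularPart X e A ∧ X b ≠ x ∧
    ∃ y ∈ regularPart X e A, IsReflection S N x (X b) y) ?_
  filter_upwards [hev1, hev2, hev3, h.relInterior_mem_nhdsWithin haI] with x h1 h2 h3 h4
  have hseg : ∀ t ∈ Icc 0 τ, x + t • (x - b) ∈ relInterior e A := by
    intro t ht
    have := convex_relInterior h.convex h.affine h4 h1 (a := 1 - t / τ) (b := t / τ)
      (by rw [sub_nonneg, div_le_one hτ0]; exact ht.2) (div_nonneg ht.1 hτ0.le) (by ring)
    convert this using 1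
    rw [smul_add, smul_smul, div_mul_cancel₀ _ hτ0.ne']
    module
  have hcontf : ContinuousOn (fun t : ℝ => ⟪X b - X (x + t • (x - b)), x⟫_ℝ) (Icc 0 τ) := by
    refine ContinuousOn.inner (continuousOn_const.sub ?_) continuousOn_const
    exact h.continuousOn.comp (by fun_prop) (fun t ht => (hseg t ht).1)
  have hneg : ⟪X b - X (x + (0 : ℝ) • (x - b)), x⟫_ℝ < 0 := by
    have := h.refl_inner_ne h4.1 hb h3
    rw [zero_smul, add_zero, ← neg_sub, inner_neg_left]
    linarith
  obtain ⟨t, ht, ht0⟩ := intermediate_value_Icc hτ0.le hcontf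
    (show (0 : ℝ) ∈ Icc _ _ from ⟨hneg.le, h2.le⟩)
  have htpos : 0 < t := by
    rcases ht.1.eq_or_lt with h5 | h5
    · rw [← h5] at ht0
      exact absurd ht0 hneg.ne
    · exact h5
  refine ⟨mem_image_of_mem X h4, fun heq => h3 (h.injOn h4.1 hb heq.symm), _,
    mem_image_of_mem X (hseg t ht), ?_⟩
  exact (h.isReflection_iff h4.1 hb (hseg t ht).1 h3).2 ⟨t, ⟨htpos, ht0⟩, rfl⟩

/-- At a regular point the parameter can move in every direction of the hyperplane, and the
derivative of `X` maps these onto the tangent space; no correction by a vector `w₀` is needed. -/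
theorem isCurveDirection (h : IsChartOf S N A X e l L) {u w : Eucl n}
    (hu : u ∈ regularPart X e A) (hw : ⟪N u, w⟫_ℝ = 0) : IsCurveDirection S u w := by
  obtain ⟨a, ha, rfl⟩ := hu
  obtain ⟨D, hD, hDs⟩ := h.deriv a ha.1
  rw [real_inner_comm, h.inner_normal_eq_zero_iff ha.1, real_inner_comm] at hw
  obtain ⟨v, hv, rfl⟩ := hDs w hw
  have hline : HasDerivAt (fun t : ℝ => a + t • v) v 0 := by
    simpa using ((hasDerivAt_id (0 : ℝ)).smul_const v).const_add a
  have hmem : ∀ᶠ t in 𝓝 (0 : ℝ), a + t • v ∈ A := by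
    have hcont : Tendsto (fun t : ℝ => a + t • v) (𝓝 0) (𝓝[{x | ⟪x, e⟫_ℝ = 1}] a) := by
      refine tendsto_nhdsWithin_iff.2 ⟨?_, Eventually.of_forall fun t => ?_⟩
      · have : Continuous fun t : ℝ => a + t • v := by fun_prop
        simpa using this.tendsto 0
      · change ⟪a + t • v, e⟫_ℝ = 1
        rw [inner_add_left, real_inner_smul_left, hv, h.affine a ha.1]; simp
    have := hcont (SurfaceMaximal.relInterior_mem_nhdsWithin h.affine ha)
    exact Filter.Eventually.mono this fun t ht => ht.1
  have hD' : HasFDerivWithinAt X D A (a + (0 : ℝ) • v) := by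
    rw [zero_smul, add_zero]; exact hD
  refine ⟨fun t => X (a + t • v), by simp, ?_, ?_⟩
  · have h1 : HasDerivWithinAt (X ∘ fun t : ℝ => a + t • v) (D v) {t | a + t • v ∈ A} 0 :=
      HasFDerivWithinAt.comp_hasDerivWithinAt 0 hD' hline.hasDerivWithinAt
        (fun t ht => ht)
    exact h1.hasDerivAt hmem
  · filter_upwards [mem_nhdsWithin_of_mem_nhds hmem] with t ht using h.mem ht

/-! ### Surface measure: full mass of the regular part, size of balls, finiteness. -/

section Measure

theorem measure_diff_regularPart (h : IsChartOf S N A X e l L) (hK : 1 ≤ K) (hLK : L ≤ K * l) :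
    (μHE[n - 1] : Measure (Eucl n)) (S \ regularPart X e A) = 0 := by
  have hsub : S \ regularPart X e A ⊆ X '' (A \ relInterior e A) := by
    rintro u ⟨hu, hu'⟩
    obtain ⟨a, ha, rfl⟩ := h.exists_param hu
    exact ⟨a, ⟨ha, fun ha' => hu' ⟨a, ha', rfl⟩⟩, rfl⟩
  refine measure_mono_null hsub ?_
  have h1 := ((h.lipschitzOnWith hK hLK).mono
    (sdiff_subset (t := relInterior e A))).euclideanHausdorffMeasure_image_le (n - 1)
  rw [euclideanHausdorffMeasure_diff_relInterior h.norm_e h.convex h.affine, mul_zero] at h1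
  exact le_antisymm h1 zero_le

theorem measure_inter_closedBall_le (h : IsChartOf S N A X e l L) (hK : 1 ≤ K) (hLK : L ≤ K * l)
    {u : Eucl n} (hu : u ∈ S) (r : ℝ) :
    (μHE[n - 1] : Measure (Eucl n)) (S ∩ Metric.closedBall u r) ≤
      ENNReal.ofReal (K * r) ^ (n - 1) * unitBallVolume (n - 1) := by
  obtain ⟨a, ha, rfl⟩ := h.exists_param hu
  have hl := h.pos
  set B := A ∩ {b | ⟪b, e⟫_ℝ = 1 ∧ ‖b - a‖ ≤ r / l} with hB
  have hsub : S ∩ Metric.closedBall (X a) r ⊆ X '' B := by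
    rintro x ⟨hx, hxr⟩
    obtain ⟨b, hb, rfl⟩ := h.exists_param hx
    refine ⟨b, ⟨hb, h.affine b hb, ?_⟩, rfl⟩
    rw [Metric.mem_closedBall, dist_eq_norm] at hxr
    rw [le_div_iff₀ hl, mul_comm]
    exact (h.antilip hb ha).trans hxr
  refine (measure_mono hsub).trans ?_
  have h1 := ((h.lipschitzOnWith hK hLK).mono
    (inter_subset_left : B ⊆ A)).euclideanHausdorffMeasure_image_le (n - 1)
  refine h1.trans ?_
  have h2 : (μHE[n - 1] : Measure (Eucl n)) B ≤
      ENNReal.ofReal (r / l) ^ (n - 1) * unitBallVolume (n - 1) :=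
    (measure_mono inter_subset_right).trans
      (euclideanHausdorffMeasure_hyperplane_ball_le h.norm_e (h.affine a ha) _)
  refine (mul_le_mul_right h2 _).trans (le_of_eq ?_)
  rw [← mul_assoc, ← mul_pow, ← ENNReal.ofReal, ← ENNReal.ofReal_mul (by positivity)]
  congr 3
  field_simp

theorem surfaceMeasure_univ_lt_top (h : IsChartOf S N A X e l L) (hK : 1 ≤ K) (hLK : L ≤ K * l) :
    surfaceMeasure S univ < ⊤ := by
  rw [surfaceMeasure, Measure.restrict_apply_univ]
  rcases S.eq_empty_or_nonempty with rfl | ⟨u, hu⟩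
  · simp
  · have hl := h.pos
    have hsub : S ⊆ S ∩ Metric.closedBall u (K * l * 4) := by
      intro x hx
      refine ⟨hx, ?_⟩
      obtain ⟨a, ha, rfl⟩ := h.exists_param hu
      obtain ⟨b, hb, rfl⟩ := h.exists_param hx
      rw [Metric.mem_closedBall, dist_eq_norm]
      refine (h.lip' hLK hb ha).trans ?_
      gcongr
      linarith [norm_sub_le b a, h.norm_le a ha, h.norm_le b hb]
    refine (measure_mono hsub).trans_lt ((h.measure_inter_closedBall_le hK hLK hu
      _).trans_lt ?_)
    refine ENNReal.mul_lt_top (ENNReal.pow_lt_top ENNReal.ofReal_lt_top) ?_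
    rw [unitBallVolume]
    exact ENNReal.ofReal_lt_top

theorem surfaceMeasure_eq (h : IsChartOf S N A X e l L) (hK : 1 ≤ K) (hLK : L ≤ K * l) :
    surfaceMeasure S = (μHE[n - 1] : Measure (Eucl n)).restrict (regularPart X e A) := by
  rw [surfaceMeasure]
  refine (Measure.restrict_congr_set ?_).symm
  refine LE.le.eventuallyLE h.regularPart_subset |>.antisymm ?_
  rw [ae_le_set]
  exact h.measure_diff_regularPart hK hLK

theorem ae_mem_regularPart (h : IsChartOf S N A X e l L) (hK : 1 ≤ K) (hLK : L ≤ K * l) :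
    ∀ᵐ u ∂(surfaceMeasure S), u ∈ regularPart X e A := by
  rw [h.surfaceMeasure_eq hK hLK]
  exact ae_restrict_mem h.measurableSet_regularPart

end Measure

end IsChartOf

end SurfaceMaximal

end

/-! ### General tools: Borel graphs, Jacobians of linear maps, Vitali covering. -/

noncomputable section

namespace SurfaceMaximal

open Filter Topology Set

section Graph

variable {α β γ : Type*} [MeasurableSpace α] [StandardBorelSpace α] [MeasurableSpace β]
  [StandardBorelSpace β] [MeasurableSpace γ]

/-- The domain of a function with Borel graph is Borel. -/
theorem measurableSet_image_fst {H : Set (α × β)} (hH : MeasurableSet H)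
    (hinj : ∀ p ∈ H, ∀ q ∈ H, p.1 = q.1 → p.2 = q.2) : MeasurableSet (Prod.fst '' H) :=
  -- Lusin–Souslin: the projection is injective on a graph.
  hH.image_of_measurable_injOn measurable_fst fun p hp q hq h => Prod.ext h (hinj p hp q hq h)

/-- A function that factors measurably through a function with Borel graph is measurable. -/
theorem measurable_indicator_of_graph [Zero γ] {H : Set (α × β)} (hH : MeasurableSet H)
    (hinj : ∀ p ∈ H, ∀ q ∈ H, p.1 = q.1 → p.2 = q.2) {φ : α × β → γ} (hφ : Measurable φ)
    {g : α → γ} (hg : ∀ p ∈ H, g p.1 = φ p) : Measurable ((Prod.fst '' H).indicator g) := by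
  intro B hB
  have heq : (Prod.fst '' H).indicator g ⁻¹' B =
      Prod.fst '' (H ∩ φ ⁻¹' B) ∪ ((Prod.fst '' H)ᶜ ∩ (fun _ => (0 : γ)) ⁻¹' B) := by
    ext x
    by_cases hx : x ∈ Prod.fst '' H
    · have hcompl : x ∉ (Prod.fst '' H)ᶜ ∩ (fun _ => (0 : γ)) ⁻¹' B := fun h => h.1 hx
      rw [mem_preimage, indicator_of_mem hx, mem_union, or_iff_left hcompl]
      obtain ⟨p, hp, rfl⟩ := hx
      constructor
      · intro h
        exact ⟨p, ⟨hp, by rw [mem_preimage, ← hg p hp]; exact h⟩, rfl⟩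
      · rintro ⟨q, ⟨hq, hqB⟩, he⟩
        rw [← he, hg q hq]
        exact hqB
    · have hnot : x ∉ Prod.fst '' (H ∩ φ ⁻¹' B) := fun h => hx (image_mono inter_subset_left h)
      rw [mem_preimage, indicator_of_notMem hx, mem_union, or_iff_right hnot]
      exact ⟨fun h => ⟨hx, h⟩, fun h => h.2⟩
  rw [heq]
  refine (measurableSet_image_fst (hH.inter (hφ hB)) fun p hp q hq => hinj p hp.1 q hq.1).union ?_
  exact (measurableSet_image_fst hH hinj).compl.inter (measurable_const hB)

end Graph

section Jacobian

variable {n : ℕ}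

theorem restrictedJacobian_eq_normDet (T : Submodule ℝ (Eucl n)) (L : Eucl n →L[ℝ] Eucl n) :
    restrictedJacobian T L = (L.toLinearMap ∘ₗ T.subtype).normDet := by
  have h := (L.toLinearMap ∘ₗ T.subtype).normDet_sq
  rw [restrictedJacobian, ← h]
  exact Real.sqrt_sq (LinearMap.normDet_nonneg _)

theorem restrictedJacobian_congr {T : Submodule ℝ (Eucl n)} {L M : Eucl n →L[ℝ] Eucl n}
    (h : ∀ w ∈ T, L w = M w) : restrictedJacobian T L = restrictedJacobian T M := by
  have : L.toLinearMap ∘ₗ T.subtype = M.toLinearMap ∘ₗ T.subtype := by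
    ext1 w
    exact h w w.2
  rw [restrictedJacobian, restrictedJacobian, this]

/-- The Jacobian is the exact factor by which Hausdorff measure of the unit ball is scaled, and the
Lipschitz bound limits that factor. -/
theorem restrictedJacobian_le {T : Submodule ℝ (Eucl n)} {L : Eucl n →L[ℝ] Eucl n} {C : ℝ≥0}
    (h : ∀ w ∈ T, ‖L w‖ ≤ C * ‖w‖) : restrictedJacobian T L ≤ C ^ Module.finrank ℝ T := by
  rw [restrictedJacobian_eq_normDet]
  set f := L.toLinearMap ∘ₗ T.subtype with hf
  have hlip : LipschitzOnWith C f (Metric.ball 0 1) := by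
    apply LipschitzOnWith.of_dist_le_mul
    intro v _ w _
    rw [dist_eq_norm, dist_eq_norm, ← map_sub]
    exact h _ (v - w).2
  have h1 := hlip.euclideanHausdorffMeasure_image_le (Module.finrank ℝ T)
  rw [f.euclideanHausdorffMeasure_image] at h1
  have h2 : (μHE[Module.finrank ℝ T] : Measure T) (Metric.ball 0 1) ≠ 0 :=
    (Metric.measure_ball_pos _ _ one_pos).ne'
  have h3 : (μHE[Module.finrank ℝ T] : Measure T) (Metric.ball 0 1) ≠ ⊤ :=
    measure_ball_lt_top.ne
  have h4 := (ENNReal.mul_le_mul_iff_left h2 h3).1 h1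
  rw [ENNReal.ofReal_le_iff_le_toReal (by simp)] at h4
  simpa using h4

theorem restrictedJacobian_zero {T : Submodule ℝ (Eucl n)} (hT : Module.finrank ℝ T ≠ 0) :
    restrictedJacobian T 0 = 0 := by
  rw [restrictedJacobian_eq_normDet]
  have : (0 : Eucl n →L[ℝ] Eucl n).toLinearMap ∘ₗ T.subtype = 0 := by ext1; rfl
  rw [this, LinearMap.normDet_zero, zero_pow hT]

/-- The Jacobian on the orthogonal complement of a unit vector `ν` with `M ν = 0` as a determinant
on the whole space. -/
theorem restrictedJacobian_orthogonal {ν : Eucl n} (hν : ‖ν‖ = 1) {M : Eucl n →L[ℝ] Eucl n}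
    (hM : M ν = 0) : restrictedJacobian (Submodule.span ℝ {ν})ᗮ M =
      √((M.adjoint ∘L M + (innerSL ℝ ν).smulRight ν).det) := by
  set T := (Submodule.span ℝ {ν})ᗮ with hT
  set B := LinearMap.adjoint (M.toLinearMap ∘ₗ T.subtype) ∘ₗ (M.toLinearMap ∘ₗ T.subtype) with hB
  set A : Eucl n →ₗ[ℝ] Eucl n := (M.adjoint ∘L M + (innerSL ℝ ν).smulRight ν).toLinearMap with hA
  rw [restrictedJacobian]
  congr 1
  change LinearMap.det B = LinearMap.det A
  let eq := Submodule.prodEquivOfIsCompl T Tᗮ (Submodule.isCompl_orthogonal T)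
  have hAa : ∀ x, A x = M.adjoint (M x) + ⟪ν, x⟫_ℝ • ν := fun x => rfl
  -- `M* M + ν ⊗ ν` is block diagonal with respect to `ν^⊥` and the line of `ν`, with blocks `B` and
  -- the identity.
  have key : ∀ x, A (eq x) = eq (B.prodMap LinearMap.id x) := by
    rintro ⟨v, w⟩
    simp only [eq, Submodule.coe_prodEquivOfIsCompl', LinearMap.prodMap_apply, LinearMap.id_apply,
      map_add]
    congr 1
    · have hv : ⟪ν, (v : Eucl n)⟫_ℝ = 0 := Submodule.mem_orthogonal_singleton_iff_inner_right.1 v.2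
      rw [hAa, hv, zero_smul, add_zero]
      have hmem : M.adjoint (M v) ∈ T := by
        refine Submodule.mem_orthogonal_singleton_iff_inner_right.2 ?_
        rw [ContinuousLinearMap.adjoint_inner_right, hM, inner_zero_left]
      have : B v = ⟨M.adjoint (M v), hmem⟩ := by
        refine ext_inner_left ℝ fun x => ?_
        rw [hB, LinearMap.comp_apply, LinearMap.adjoint_inner_right]
        change ⟪M x, M v⟫_ℝ = ⟪(x : Eucl n), M.adjoint (M v)⟫_ℝ
        rw [ContinuousLinearMap.adjoint_inner_right]
      rw [this]
    · have hw : (w : Eucl n) ∈ Submodule.span ℝ {ν} := by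
        exact (Submodule.orthogonal_orthogonal (Submodule.span ℝ {ν})).le w.2
      obtain ⟨c, hc⟩ := Submodule.mem_span_singleton.1 hw
      rw [hAa, ← hc, map_smul, hM, smul_zero, map_zero, zero_add, inner_smul_right,
        real_inner_self_eq_norm_sq, hν]
      simp
  have h1 : A = (eq : (T × Tᗮ) →ₗ[ℝ] Eucl n) ∘ₗ (B.prodMap LinearMap.id) ∘ₗ
      (eq.symm : Eucl n →ₗ[ℝ] (T × Tᗮ)) := by
    ext1 x
    have := key (eq.symm x)
    simpa using this
  rw [h1, LinearMap.det_conj, LinearMap.det_prodMap, LinearMap.det_id, mul_one]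

theorem measurable_det_adjoint_comp : Measurable fun p : Eucl n × (Eucl n →L[ℝ] Eucl n) =>
    √((p.2.adjoint ∘L p.2 + (innerSL ℝ p.1).smulRight p.1).det) := by
  apply Continuous.measurable
  refine Real.continuous_sqrt.comp (ContinuousLinearMap.continuous_det.comp ?_)
  refine Continuous.add ?_ ?_
  · have : Continuous fun M : Eucl n →L[ℝ] Eucl n => M.adjoint :=
      (ContinuousLinearMap.adjoint : (Eucl n →L[ℝ] Eucl n) ≃ₗᵢ⋆[ℝ] _).continuous
    exact (this.comp continuous_snd).clm_comp continuous_snd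
  · have h1 : Continuous fun x : Eucl n => innerSL ℝ x := (innerSL ℝ).continuous
    have h2 := (ContinuousLinearMap.smulRightL ℝ (Eucl n) (Eucl n)).continuous₂
    exact h2.comp ((h1.comp continuous_fst).prodMk continuous_fst)

end Jacobian

section WeakType

variable {α : Type*} [PseudoMetricSpace α] [MeasurableSpace α]

theorem _root_.ENNReal.tsum_mul_rpow_half_le {ι : Type*} (a b : ι → ℝ≥0∞) :
    ∑' i, a i ^ (1 / 2 : ℝ) * b i ^ (1 / 2 : ℝ) ≤
      (∑' i, a i) ^ (1 / 2 : ℝ) * (∑' i, b i) ^ (1 / 2 : ℝ) := by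
  let _ : MeasurableSpace ι := ⊤
  have h := ENNReal.lintegral_mul_le_Lp_mul_Lq (Measure.count : Measure ι)
    (Real.HolderConjugate.two_two) (f := fun i => a i ^ (1 / 2 : ℝ)) (g := fun i => b i ^ (1 / 2 : ℝ))
    (measurable_from_top).aemeasurable (measurable_from_top).aemeasurable
  simp only [lintegral_count, Pi.mul_apply, ← ENNReal.rpow_mul] at h
  norm_num at h
  norm_num
  exact h

/-- Vitali selects disjoint balls of radii `K * δ u` whose fivefold enlargements cover `U`. The
`σ`-mass of each enlargement is a multiple of `δ ^ d`, which the local bound estimates;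
Cauchy–Schwarz over the disjoint balls then sums the products of square roots to the total masses.
-/
theorem weak_type_of_local_bound [OpensMeasurableSpace α] [SecondCountableTopology α]
    {σ μ₁ μ₂ : Measure α} {U : Set α} {d : ℕ} {K : ℝ} (hK : 0 < K) {t c D : ℝ≥0∞}
    (hσ : ∀ u ∈ U, ∀ r : ℝ, σ (Metric.closedBall u r) ≤ D * ENNReal.ofReal r ^ d)
    (hU : ∀ u ∈ U, ∃ δ ∈ Ioo (0 : ℝ) 1, t * ENNReal.ofReal δ ^ d ≤
      c * (μ₁ (Metric.closedBall u (K * δ)) ^ (1 / 2 : ℝ) *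
        μ₂ (Metric.closedBall u (K * δ)) ^ (1 / 2 : ℝ))) :
    t * σ U ≤ D * ENNReal.ofReal (5 * K) ^ d * c *
      (μ₁ univ ^ (1 / 2 : ℝ) * μ₂ univ ^ (1 / 2 : ℝ)) := by
  choose! δ hδ hδt using hU
  obtain ⟨V, hVU, hdisj, hcov⟩ := Vitali.exists_disjoint_subfamily_covering_enlargement_closedBall
    U id (fun u => K * δ u) K (fun u hu => by nlinarith [(hδ u hu).2]) 5 (by norm_num)
  have hr : ∀ u ∈ V, 0 < K * δ u := fun u hu => mul_pos hK (hδ u (hVU hu)).1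
  have hcount : V.Countable := by
    refine hdisj.countable_of_nonempty_interior fun u hu => ?_
    exact ⟨u, Metric.ball_subset_interior_closedBall (Metric.mem_ball_self (hr u hu))⟩
  have : Countable V := hcount.to_subtype
  have hUsub : U ⊆ ⋃ u : V, Metric.closedBall (u : α) (5 * (K * δ u)) := by
    intro x hx
    obtain ⟨b, hb, hsub⟩ := hcov x hx
    exact mem_iUnion.2 ⟨⟨b, hb⟩, hsub (Metric.mem_closedBall_self
      (mul_pos hK (hδ x hx).1).le)⟩
  have hdisj' : Pairwise (Function.onFun Disjoint
      fun u : V => Metric.closedBall (u : α) (K * δ u)) := by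
    intro u v huv
    exact hdisj u.2 v.2 (fun h => huv (Subtype.ext h))
  have hsum : ∀ μ : Measure α, ∑' u : V, μ (Metric.closedBall (u : α) (K * δ u)) ≤ μ univ := by
    intro μ
    rw [← measure_iUnion hdisj' fun u => Metric.isClosed_closedBall.measurableSet]
    exact measure_mono (subset_univ _)
  calc t * σ U ≤ t * ∑' u : V, σ (Metric.closedBall (u : α) (5 * (K * δ u))) := by
        gcongr
        exact (measure_mono hUsub).trans (measure_iUnion_le _)
    _ ≤ t * ∑' u : V, D * ENNReal.ofReal (5 * (K * δ u)) ^ d := by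
        gcongr with u
        exact hσ u (hVU u.2) _
    _ = D * ENNReal.ofReal (5 * K) ^ d * ∑' u : V, t * ENNReal.ofReal (δ u) ^ d := by
        rw [← ENNReal.tsum_mul_left, ← ENNReal.tsum_mul_left]
        refine tsum_congr fun u => ?_
        rw [← mul_assoc 5, ENNReal.ofReal_mul (by positivity), mul_pow]
        ring
    _ ≤ D * ENNReal.ofReal (5 * K) ^ d * ∑' u : V, c *
          (μ₁ (Metric.closedBall (u : α) (K * δ u)) ^ (1 / 2 : ℝ) *
            μ₂ (Metric.closedBall (u : α) (K * δ u)) ^ (1 / 2 : ℝ)) := by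
        exact mul_le_mul_right (ENNReal.tsum_le_tsum fun u : V => hδt u (hVU u.2)) _
    _ = D * ENNReal.ofReal (5 * K) ^ d * c * ∑' u : V,
          (μ₁ (Metric.closedBall (u : α) (K * δ u)) ^ (1 / 2 : ℝ) *
            μ₂ (Metric.closedBall (u : α) (K * δ u)) ^ (1 / 2 : ℝ)) := by
        rw [ENNReal.tsum_mul_left]
        ring
    _ ≤ _ := by
        gcongr
        refine (ENNReal.tsum_mul_rpow_half_le _ _).trans ?_
        gcongr
        · exact hsum μ₁
        · exact hsum μ₂

end WeakType

end SurfaceMaximal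

end

/-! ### Joint measurability of the reflection and of its Jacobian. -/

noncomputable section

namespace SurfaceMaximal

open Filter Topology Set

variable {n : ℕ} {S : Set (Eucl n)} {N : Eucl n → Eucl n} {A : Set (Eucl n)} {X : Eucl n → Eucl n}
  {e : Eucl n} {l L K : ℝ}

theorem IsCurveDirection.exists_eventually_mem {u w : Eucl n} (h : IsCurveDirection S u w) :
    ∃ γ : ℝ → Eucl n, γ 0 = u ∧ HasDerivAt γ w 0 ∧
      ∀ W ∈ 𝓝[S] u, ∀ᶠ t in 𝓝[>] (0 : ℝ), γ t ∈ W := by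
  obtain ⟨γ, h0, h1, h2⟩ := h
  refine ⟨γ, h0, h1, fun W hW => ?_⟩
  have : Tendsto γ (𝓝[>] 0) (𝓝[S] u) := by
    refine tendsto_nhdsWithin_iff.2 ⟨?_, h2⟩
    rw [← h0]
    exact h1.continuousAt.tendsto.mono_left nhdsWithin_le_nhds
  exact this hW

theorem _root_.HasFDerivWithinAt.norm_le_of_curve {E F : Type*} [NormedAddCommGroup E]
    [InnerProductSpace ℝ E] [NormedAddCommGroup F] [NormedSpace ℝ F] {f : E → F} {L : E →L[ℝ] F}
    {s : Set E} {γ : ℝ → E} {w : E} {C : ℝ} (hf : HasFDerivWithinAt f L s (γ 0))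
    (hγ : HasDerivAt γ w 0) (hs : ∀ᶠ t in 𝓝[>] (0 : ℝ), γ t ∈ s)
    (hlip : ∀ᶠ t in 𝓝[>] (0 : ℝ), ‖f (γ t) - f (γ 0)‖ ≤ C * ‖γ t - γ 0‖) :
    ‖L w‖ ≤ C * ‖w‖ := by
  have h1 := (hasDerivWithinAt_iff_tendsto_slope' (by simp)).1 (hf.comp_curve hγ hs)
  have h2 := (hasDerivWithinAt_iff_tendsto_slope' (by simp)).1 (hγ.hasDerivWithinAt (s := Ioi 0))
  refine le_of_tendsto_of_tendsto h1.norm (h2.norm.const_mul C) ?_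
  filter_upwards [hlip, self_mem_nhdsWithin] with t ht ht0
  have ht0' : (0 : ℝ) < t := ht0
  simp only [slope_def_module, sub_zero, norm_smul, norm_inv, Real.norm_eq_abs, abs_of_pos ht0',
    Function.comp_apply]
  rw [mul_left_comm]
  gcongr

/-- Pairs of regular points for which the reflection exists and is regular. -/
def regularPairs (S : Set (Eucl n)) (N : Eucl n → Eucl n) (X : Eucl n → Eucl n) (e : Eucl n)
    (A : Set (Eucl n)) : Set (Eucl n × Eucl n) :=
  {q | q.1 ∈ regularPart X e A ∧ q.2 ∈ regularPart X e A ∧ q.2 ≠ q.1 ∧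
    ∃ y ∈ regularPart X e A, IsReflection S N q.1 q.2 y}

theorem isReflection_reflection {u u' : Eucl n} (h : u' ∈ reflectionDomain S N u) :
    IsReflection S N u u' (reflection S N u u') := by
  rw [reflection, dif_pos ⟨h.2.1, h.2.2⟩]
  exact Exists.choose_spec _

theorem measurableSet_linearIndependent {α : Type*} [MeasurableSpace α] {a b c : α → Eucl n}
    (ha : Measurable a) (hb : Measurable b) (hc : Measurable c) :
    MeasurableSet {p | LinearIndependent ℝ ![a p, b p, c p]} := by
  have hopen : IsOpen {f : Fin 3 → Eucl n | LinearIndependent ℝ f} :=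
    isOpen_setOfPred_linearIndependent
  have hm : Measurable fun p => ![a p, b p, c p] := by
    refine measurable_pi_iff.2 fun i => ?_
    fin_cases i
    · exact ha
    · exact hb
    · exact hc
  exact hm hopen.measurableSet

/-- The Jacobian on `ν^⊥` of a linear map that vanishes on the unit vector `ν`. -/
def normalDet (p : Eucl n × (Eucl n →L[ℝ] Eucl n)) : ℝ :=
  √((p.2.adjoint ∘L p.2 + (innerSL ℝ p.1).smulRight p.1).det)

theorem measurable_normalDet : Measurable (normalDet (n := n)) := measurable_det_adjoint_comp

namespace IsChartOf

theorem reflection_eq (h : IsChartOf S N A X e l L) {u u' y : Eucl n} (hu : u ∈ S) (hu' : u' ∈ S)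
    (hne : u' ≠ u) (hr : IsReflection S N u u' y) : reflection S N u u' = y :=
  h.isReflection_unique hu hu' hne (isReflection_reflection ⟨hu', hne, y, hr⟩) hr

theorem mem_reflectionDomain_of_regularPairs (h : IsChartOf S N A X e l L) {q : Eucl n × Eucl n}
    (hq : q ∈ regularPairs S N X e A) : q.2 ∈ reflectionDomain S N q.1 := by
  obtain ⟨-, h2, h3, y, -, h4⟩ := hq
  exact ⟨h.regularPart_subset h2, h3, y, h4⟩

/-- The normal field, extended by zero off the regular part. -/
theorem measurable_normal (h : IsChartOf S N A X e l L) :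
    Measurable ((regularPart X e A).indicator N) := by
  classical
  have := (h.continuousOn_normal.mono h.regularPart_subset).measurable_piecewise
    (continuousOn_const (c := (0 : Eucl n))) h.measurableSet_regularPart
  have heq := piecewise_eq_indicator (s := regularPart X e A) (f := N)
  exact heq ▸ this

/-- The graph of the reflection over the regular pairs. -/
def reflectionGraph (S : Set (Eucl n)) (N : Eucl n → Eucl n) (X : Eucl n → Eucl n) (e : Eucl n)
    (A : Set (Eucl n)) : Set ((Eucl n × Eucl n) × Eucl n) :=
  {p | p.1.1 ∈ regularPart X e A ∧ p.1.2 ∈ regularPart X e A ∧ p.1.2 ≠ p.1.1 ∧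
    p.2 ∈ regularPart X e A ∧ IsReflection S N p.1.1 p.1.2 p.2}

/-- The reflection is a chosen point, so its measurability has to come from its graph. On regular
triples each defining condition is Borel once `N` is replaced by its measurable cut-off. -/
theorem measurableSet_reflectionGraph (h : IsChartOf S N A X e l L) :
    MeasurableSet (reflectionGraph S N X e A) := by
  set M := (regularPart X e A).indicator N with hM
  have hMm : Measurable M := h.measurable_normal
  have m1 : Measurable fun p : (Eucl n × Eucl n) × Eucl n => p.1.1 := by fun_prop
  have m2 : Measurable fun p : (Eucl n × Eucl n) × Eucl n => p.1.2 := by fun_prop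
  have m3 : Measurable fun p : (Eucl n × Eucl n) × Eucl n => p.2 := by fun_prop
  have heq : reflectionGraph S N X e A =
      {p | p.1.1 ∈ regularPart X e A} ∩ {p | p.1.2 ∈ regularPart X e A} ∩ {p | p.1.2 = p.1.1}ᶜ ∩
      {p | p.2 ∈ regularPart X e A} ∩ {p | p.2 = p.1.2}ᶜ ∩
      {p | ⟪p.1.2 - p.2, M p.1.1⟫_ℝ = 0} ∩
      {p | LinearIndependent ℝ ![M p.1.1, M p.1.2, M p.2]}ᶜ := by
    ext p
    constructor
    · rintro ⟨h1, h2, h3, h4, h5, h6, h7, h8⟩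
      have e1 : M p.1.1 = N p.1.1 := indicator_of_mem h1 N
      have e2 : M p.1.2 = N p.1.2 := indicator_of_mem h2 N
      have e3 : M p.2 = N p.2 := indicator_of_mem h4 N
      refine ⟨⟨⟨⟨⟨⟨h1, h2⟩, h3⟩, h4⟩, h6⟩, ?_⟩, ?_⟩
      · change ⟪p.1.2 - p.2, M p.1.1⟫_ℝ = 0
        rw [e1]; exact h7
      · change ¬ LinearIndependent ℝ ![M p.1.1, M p.1.2, M p.2]
        rw [e1, e2, e3]; exact h8
    · rintro ⟨⟨⟨⟨⟨⟨h1, h2⟩, h3⟩, h4⟩, h6⟩, h7⟩, h8⟩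
      have e1 : M p.1.1 = N p.1.1 := indicator_of_mem (s := regularPart X e A) h1 N
      have e2 : M p.1.2 = N p.1.2 := indicator_of_mem (s := regularPart X e A) h2 N
      have e3 : M p.2 = N p.2 := indicator_of_mem (s := regularPart X e A) h4 N
      change ⟪p.1.2 - p.2, M p.1.1⟫_ℝ = 0 at h7
      change ¬ LinearIndependent ℝ ![M p.1.1, M p.1.2, M p.2] at h8
      rw [e1] at h7
      rw [e1, e2, e3] at h8
      exact ⟨h1, h2, h3, h4, h.regularPart_subset h4, h6, h7, h8⟩
  rw [heq]
  have hR := h.measurableSet_regularPart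
  refine (((((((m1 hR).inter (m2 hR)).inter ?_).inter (m3 hR)).inter ?_).inter ?_).inter ?_)
  · exact (measurableSet_eq_fun m2 m1).compl
  · exact (measurableSet_eq_fun m3 m2).compl
  · exact measurableSet_eq_fun ((m2.sub m3).inner (hMm.comp m1)) measurable_const
  · exact (measurableSet_linearIndependent (hMm.comp m1) (hMm.comp m2) (hMm.comp m3)).compl

theorem image_fst_reflectionGraph :
    Prod.fst '' reflectionGraph S N X e A = regularPairs S N X e A := by
  ext q
  constructor
  · rintro ⟨p, ⟨h1, h2, h3, h4, h5⟩, rfl⟩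
    exact ⟨h1, h2, h3, p.2, h4, h5⟩
  · rintro ⟨h1, h2, h3, y, h4, h5⟩
    exact ⟨(q, y), ⟨h1, h2, h3, h4, h5⟩, rfl⟩

theorem reflectionGraph_unique (h : IsChartOf S N A X e l L) :
    ∀ p ∈ reflectionGraph S N X e A, ∀ q ∈ reflectionGraph S N X e A, p.1 = q.1 → p.2 = q.2 := by
  rintro ⟨p, y⟩ ⟨h1, h2, h3, h4, h5⟩ ⟨q, z⟩ ⟨h1', h2', h3', h4', h5'⟩ hpq
  obtain rfl : p = q := hpq
  exact h.isReflection_unique (h.regularPart_subset h1) (h.regularPart_subset h2) h3 h5 h5'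

theorem measurableSet_regularPairs (h : IsChartOf S N A X e l L) :
    MeasurableSet (regularPairs S N X e A) := by
  rw [← image_fst_reflectionGraph]
  exact measurableSet_image_fst h.measurableSet_reflectionGraph h.reflectionGraph_unique

theorem measurable_reflection (h : IsChartOf S N A X e l L) :
    Measurable ((regularPairs S N X e A).indicator fun q => reflection S N q.1 q.2) := by
  rw [← image_fst_reflectionGraph]
  refine measurable_indicator_of_graph h.measurableSet_reflectionGraph h.reflectionGraph_unique
    measurable_snd ?_
  rintro p ⟨h1, h2, h3, h4, h5⟩
  exact h.reflection_eq (h.regularPart_subset h1) (h.regularPart_subset h2) h3 h5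

/-- The section of the regular pairs at `u'` is a relatively open set. -/
theorem section_mem_nhdsWithin (h : IsChartOf S N A X e l L) {q : Eucl n × Eucl n}
    (hq : q ∈ regularPairs S N X e A) : {x | (x, q.2) ∈ regularPairs S N X e A} ∈ 𝓝[S] q.1 := by
  obtain ⟨h1, h2, h3, y, h4, h5⟩ := hq
  filter_upwards [h.eventually_exists_isReflection h1 (h.regularPart_subset h2) h3 h5 h4]
    with x hx
  exact ⟨hx.1, h2, hx.2.1, hx.2.2⟩

theorem norm_reflection_sub_le (h : IsChartOf S N A X e l L) (hK : 1 ≤ K) (hLK : L ≤ K * l)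
    {u' x y : Eucl n} (hx : x ∈ S) (hy : y ∈ S) (hxd : u' ∈ reflectionDomain S N x)
    (hyd : u' ∈ reflectionDomain S N y) :
    ‖reflection S N x u' - reflection S N y u'‖ ≤ 45 * K ^ 5 * ‖x - y‖ :=
  h.isReflection_lipschitz_right hK hLK hxd.1 hx hy hxd.2.1 hyd.2.1
    (isReflection_reflection hxd) (isReflection_reflection hyd)

/-- In every tangent direction a curve stays in the domain, so the Lipschitz bound for `x ↦ R_x u'`
passes to the derivative on the tangent space. Where that map is not differentiable, `fderivWithin`
is zero by convention and the bound is trivial. -/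
theorem reflectionJacobian_le (h : IsChartOf S N A X e l L) (hK : 1 ≤ K) (hLK : L ≤ K * l)
    {q : Eucl n × Eucl n} (hq : q ∈ regularPairs S N X e A) :
    reflectionJacobian S N q.1 q.2 ≤ (45 * K ^ 5) ^ (n - 1) := by
  have hqS := h.regularPart_subset hq.1
  have hdim : Module.finrank ℝ (tangentSpace N q.1) = n - 1 := by
    obtain ⟨a, ha, hq1⟩ := h.exists_param hqS
    refine finrank_orthogonal_singleton ?_
    rw [← hq1, h.normal a ha, norm_smul, norm_inv, norm_norm,
      inv_mul_cancel₀ (norm_ne_zero_iff.2 (h.ne_zero ha))]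
  set D := {x ∈ S | q.2 ∈ reflectionDomain S N x} with hD
  set f := fun x => reflection S N x q.2 with hf
  have key : ∀ w ∈ tangentSpace N q.1, ‖fderivWithin ℝ f D q.1 w‖ ≤ 45 * K ^ 5 * ‖w‖ := by
    intro w hw
    by_cases hdiff : DifferentiableWithinAt ℝ f D q.1
    · obtain ⟨γ, h0, h1, h2⟩ :=
        (h.isCurveDirection hq.1 (mem_tangentSpace.1 hw)).exists_eventually_mem
      have hγD : ∀ᶠ t in 𝓝[>] (0 : ℝ), γ t ∈ D := by
        filter_upwards [h2 _ (h.section_mem_nhdsWithin hq)] with t ht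
        exact ⟨h.regularPart_subset ht.1, h.mem_reflectionDomain_of_regularPairs ht⟩
      have hder := hdiff.hasFDerivWithinAt
      rw [← h0] at hder ⊢
      refine hder.norm_le_of_curve h1 hγD ?_
      filter_upwards [hγD] with t ht
      refine h.norm_reflection_sub_le hK hLK ht.1 (by rw [h0]; exact hqS) ht.2 ?_
      rw [h0]
      exact h.mem_reflectionDomain_of_regularPairs hq
    · rw [fderivWithin_zero_of_not_differentiableWithinAt hdiff, zero_apply, norm_zero]
      positivity
  have := restrictedJacobian_le (C := ⟨45 * K ^ 5, by positivity⟩) key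
  rw [hdim] at this
  exact this

/-- `S` is flat to first order at each point. -/
theorem hasFDerivWithinAt_inner_normal (h : IsChartOf S N A X e l L) {u : Eucl n} (hu : u ∈ S) :
    HasFDerivWithinAt (fun x => ⟪N u, x⟫_ℝ) (0 : Eucl n →L[ℝ] ℝ) S u := by
  obtain ⟨a, ha, rfl⟩ := h.exists_param hu
  have hl := h.pos
  rw [hasFDerivWithinAt_iff_isLittleO]
  -- Up to sign and the factor `‖a‖⁻¹` this is the height over the tangent plane, quadratic in `‖x -
  -- X a‖` by `inner_upper` and `antilip`.
  have hO : (fun x => ⟪N (X a), x⟫_ℝ - ⟪N (X a), X a⟫_ℝ - (0 : Eucl n →L[ℝ] ℝ) (x - X a))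
      =O[𝓝[S] (X a)] fun x => ‖x - X a‖ ^ 2 := by
    refine Asymptotics.IsBigO.of_bound (‖a‖⁻¹ * (|L| / l ^ 2)) ?_
    filter_upwards [self_mem_nhdsWithin] with x hx
    obtain ⟨b, hb, rfl⟩ := h.exists_param hx
    have h1 := h.inner_upper ha hb
    have h2 := h.support a ha b hb
    have h3 := h.antilip ha hb
    have e1 : ⟪N (X a), X b⟫_ℝ - ⟪N (X a), X a⟫_ℝ - (0 : Eucl n →L[ℝ] ℝ) (X b - X a) =
        -(‖a‖⁻¹ * ⟪X a - X b, a⟫_ℝ) := by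
      rw [zero_apply, sub_zero, ← inner_sub_right, h.normal a ha, real_inner_smul_left,
        ← neg_sub (X a), inner_neg_right, real_inner_comm]
      ring
    rw [e1, norm_neg, norm_mul, norm_inv, norm_norm, Real.norm_of_nonneg h2, norm_pow, norm_norm,
      mul_assoc]
    gcongr
    calc ⟪X a - X b, a⟫_ℝ ≤ L * ‖a - b‖ ^ 2 := h1
      _ ≤ |L| * ‖a - b‖ ^ 2 := by gcongr; exact le_abs_self L
      _ = |L| / l ^ 2 * (l * ‖a - b‖) ^ 2 := by field_simp
      _ ≤ |L| / l ^ 2 * ‖X b - X a‖ ^ 2 := by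
        rw [norm_sub_rev (X b)]
        gcongr
  exact hO.trans_isLittleO
    ((Asymptotics.isLittleO_pow_sub_sub (X a) one_lt_two).mono nhdsWithin_le_nhds)

/-- The quantitative form, along a dense set, of differentiability of `x ↦ R_x u'`. -/
theorem hasFDerivWithinAt_reflection_iff (h : IsChartOf S N A X e l L) (hK : 1 ≤ K)
    (hLK : L ≤ K * l) {t : Set (Eucl n)} (htS : t ⊆ regularPart X e A)
    (ht : regularPart X e A ⊆ closure t) {q : Eucl n × Eucl n}
    (hq : q ∈ regularPairs S N X e A) (M : Eucl n →L[ℝ] Eucl n) :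
    HasFDerivWithinAt (fun x => reflection S N x q.2) M
      {x ∈ S | q.2 ∈ reflectionDomain S N x} q.1 ↔
    ∀ k : ℕ, ∃ j : ℕ, ∀ x ∈ t, (x, q.2) ∈ regularPairs S N X e A →
      ‖x - q.1‖ < 1 / ((j : ℝ) + 1) →
      ‖reflection S N x q.2 - reflection S N q.1 q.2 - M (x - q.1)‖ ≤
        1 / ((k : ℝ) + 1) * ‖x - q.1‖ := by
  set D := {x ∈ S | q.2 ∈ reflectionDomain S N x} with hD
  set G := {x | (x, q.2) ∈ regularPairs S N X e A} with hG
  have hGD : G ⊆ D := fun x hx =>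
    ⟨h.regularPart_subset hx.1, h.mem_reflectionDomain_of_regularPairs hx⟩
  have hGnhds : G ∈ 𝓝[D] q.1 :=
    nhdsWithin_mono _ (fun x hx => hx.1) (h.section_mem_nhdsWithin hq)
  have hcont : ∀ x ∈ G, ContinuousWithinAt (fun x => reflection S N x q.2) D x := by
    intro x hx
    have : LipschitzOnWith ⟨45 * K ^ 5, by positivity⟩ (fun x => reflection S N x q.2) D := by
      apply LipschitzOnWith.of_dist_le_mul
      intro y hy z hz
      rw [dist_eq_norm, dist_eq_norm]
      exact h.norm_reflection_sub_le hK hLK hy.1 hz.1 hy.2 hz.2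
    exact this.continuousOn x (hGD hx)
  rw [hasFDerivWithinAt_iff_isLittleO, Asymptotics.isLittleO_iff]
  constructor
  · intro hder k
    have h1 := hder (c := 1 / ((k : ℝ) + 1)) (by positivity)
    obtain ⟨ε, hε, h2⟩ := Metric.mem_nhdsWithin_iff.1 h1
    obtain ⟨j, hj⟩ := exists_nat_one_div_lt hε
    refine ⟨j, fun x hx hxG hxj => ?_⟩
    refine h2 ⟨?_, hGD hxG⟩
    rw [Metric.mem_ball, dist_eq_norm]
    exact hxj.trans hj
  -- Regular pairs fill a neighbourhood in the domain, `t` accumulates at each of their points, and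
  -- both sides of the inequality are continuous there; so it extends from `t` to all nearby points.
  · intro hk c hc
    obtain ⟨k, hkc⟩ := exists_nat_one_div_lt hc
    obtain ⟨j, hj⟩ := hk k
    have hball : Metric.ball q.1 (1 / ((j : ℝ) + 1)) ∈ 𝓝[D] q.1 :=
      mem_nhdsWithin_of_mem_nhds (Metric.ball_mem_nhds _ (by positivity))
    filter_upwards [hGnhds, hball] with x hxG hxj
    have hne : (𝓝[t] x).NeBot := mem_closure_iff_nhdsWithin_neBot.1 (ht hxG.1)
    have htG : ∀ᶠ y in 𝓝[t] x, y ∈ G :=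
      nhdsWithin_mono x (htS.trans h.regularPart_subset) (h.section_mem_nhdsWithin (q := (x, q.2)) hxG)
    have htball : ∀ᶠ y in 𝓝[t] x, ‖y - q.1‖ < 1 / ((j : ℝ) + 1) := by
      filter_upwards [mem_nhdsWithin_of_mem_nhds (Metric.isOpen_ball.mem_nhds hxj)] with y hy
      rwa [Metric.mem_ball, dist_eq_norm] at hy
    have htt : ∀ᶠ y in 𝓝[t] x, y ∈ t := self_mem_nhdsWithin
    have htD : Tendsto (fun y => y) (𝓝[t] x) (𝓝[D] x) :=
      tendsto_nhdsWithin_iff.2 ⟨tendsto_id.mono_left nhdsWithin_le_nhds,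
        htG.mono fun y hy => hGD hy⟩
    have hid : Tendsto (fun y : Eucl n => y - q.1) (𝓝[t] x) (𝓝 (x - q.1)) :=
      (tendsto_id.mono_left nhdsWithin_le_nhds).sub_const q.1
    have hlim1 : Tendsto (fun y => ‖reflection S N y q.2 - reflection S N q.1 q.2 -
        M (y - q.1)‖) (𝓝[t] x)
        (𝓝 ‖reflection S N x q.2 - reflection S N q.1 q.2 - M (x - q.1)‖) :=
      ((((hcont x hxG).tendsto.comp htD).sub_const _).sub
        ((M.continuous.tendsto _).comp hid)).norm
    have hlim2 := hid.norm.const_mul (1 / ((k : ℝ) + 1))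
    have hle := le_of_tendsto_of_tendsto hlim1 hlim2 (by
      filter_upwards [htG, htball, htt] with y h1 h2 h3 using hj y h3 h1 h2)
    exact hle.trans (by gcongr)

theorem norm_normal (h : IsChartOf S N A X e l L) {u : Eucl n} (hu : u ∈ S) : ‖N u‖ = 1 := by
  obtain ⟨a, ha, rfl⟩ := h.exists_param hu
  rw [h.normal a ha, norm_smul, norm_inv, norm_norm,
    inv_mul_cancel₀ (norm_ne_zero_iff.2 (h.ne_zero ha))]

/-- The pairs at which `x ↦ R_x u'` is differentiable, with the derivative extended by zero in the
normal direction. -/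
def derivativeGraph (S : Set (Eucl n)) (N : Eucl n → Eucl n) (X : Eucl n → Eucl n) (e : Eucl n)
    (A : Set (Eucl n)) : Set ((Eucl n × Eucl n) × (Eucl n →L[ℝ] Eucl n)) :=
  {p | p.1 ∈ regularPairs S N X e A ∧ p.2 (N p.1.1) = 0 ∧
    HasFDerivWithinAt (fun x => reflection S N x p.1.2) p.2
      {x ∈ S | p.1.2 ∈ reflectionDomain S N x} p.1.1}

/-- Tested along a countable dense set, differentiability becomes a countable combination of Borel
conditions on the base pair and the candidate derivative. -/
theorem measurableSet_derivativeGraph (h : IsChartOf S N A X e l L) (hK : 1 ≤ K)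
    (hLK : L ≤ K * l) : MeasurableSet (derivativeGraph S N X e A) := by
  obtain ⟨t, htS, htc, ht⟩ :=
    (TopologicalSpace.IsSeparable.of_separableSpace
      (regularPart X e A)).exists_countable_dense_subset
  set G := regularPairs S N X e A with hG
  have hGm : MeasurableSet G := h.measurableSet_regularPairs
  set R : Eucl n × Eucl n → Eucl n := G.indicator fun q => reflection S N q.1 q.2 with hR
  have hRm : Measurable R := h.measurable_reflection
  set M := (regularPart X e A).indicator N with hM
  have hMm : Measurable M := h.measurable_normal
  have hRG : ∀ q ∈ G, R q = reflection S N q.1 q.2 := fun q hq => indicator_of_mem hq _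
  have heq : derivativeGraph S N X e A = {p | p.1 ∈ G} ∩ {p | p.2 (M p.1.1) = 0} ∩
      ⋂ k : ℕ, ⋃ j : ℕ, ⋂ x ∈ t, ({p | (x, p.1.2) ∈ G}ᶜ ∪
        ({p | ‖x - p.1.1‖ < 1 / ((j : ℝ) + 1)}ᶜ ∪
        {p | ‖R (x, p.1.2) - R p.1 - p.2 (x - p.1.1)‖ ≤ 1 / ((k : ℝ) + 1) * ‖x - p.1.1‖})) := by
    ext p
    by_cases hp : p.1 ∈ G
    · have e1 : M p.1.1 = N p.1.1 := indicator_of_mem hp.1 N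
      simp only [derivativeGraph, mem_ofPred_eq, mem_inter_iff, mem_iInter, mem_iUnion, mem_union,
        mem_compl_iff, e1, ← hG, hp, true_and]
      refine and_congr_right fun _ => ?_
      rw [h.hasFDerivWithinAt_reflection_iff hK hLK htS ht hp]
      refine forall_congr' fun k => exists_congr fun j => forall₂_congr fun x hx => ?_
      by_cases hxG : (x, p.1.2) ∈ G
      · rw [hRG _ hp, hRG _ hxG]
        by_cases hxj : ‖x - p.1.1‖ < 1 / ((j : ℝ) + 1)
        · exact ⟨fun H => Or.inr (Or.inr (H hxG hxj)), fun H _ _ =>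
            (H.resolve_left (not_not.2 hxG)).resolve_left (not_not.2 hxj)⟩
        · exact iff_of_true (fun _ h' => absurd h' hxj) (Or.inr (Or.inl hxj))
      · exact iff_of_true (fun h' => absurd h' hxG) (Or.inl hxG)
    · refine iff_of_false (fun h' => hp h'.1) (fun h' => hp h'.1.1)
  rw [heq]
  have m1 : Measurable fun p : (Eucl n × Eucl n) × (Eucl n →L[ℝ] Eucl n) => p.1 := measurable_fst
  have m2 : Measurable fun p : (Eucl n × Eucl n) × (Eucl n →L[ℝ] Eucl n) => p.2 := measurable_snd
  have mapply : ∀ v : (Eucl n × Eucl n) × (Eucl n →L[ℝ] Eucl n) → Eucl n, Measurable v →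
      Measurable fun p : (Eucl n × Eucl n) × (Eucl n →L[ℝ] Eucl n) => p.2 (v p) := by
    intro v hv
    have hc : Continuous fun r : (Eucl n →L[ℝ] Eucl n) × Eucl n => r.1 r.2 := by fun_prop
    exact hc.measurable.comp (m2.prodMk hv)
  refine ((m1 hGm).inter ?_).inter ?_
  · exact measurableSet_eq_fun (mapply _ (hMm.comp m1.fst)) measurable_const
  · refine MeasurableSet.iInter fun k => MeasurableSet.iUnion fun j =>
      MeasurableSet.biInter htc fun x _ => ?_
    have mx : Measurable fun p : (Eucl n × Eucl n) × (Eucl n →L[ℝ] Eucl n) => (x, p.1.2) :=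
      measurable_const.prodMk m1.snd
    have md : Measurable fun p : (Eucl n × Eucl n) × (Eucl n →L[ℝ] Eucl n) => x - p.1.1 :=
      measurable_const.sub m1.fst
    refine (mx hGm).compl.union (MeasurableSet.union ?_ ?_)
    · exact (measurableSet_lt md.norm measurable_const).compl
    · exact measurableSet_le (((hRm.comp mx).sub (hRm.comp m1)).sub (mapply _ md)).norm
        (md.norm.const_mul _)

theorem eqOn_tangentSpace (h : IsChartOf S N A X e l L) {q : Eucl n × Eucl n}
    (hq : q ∈ regularPairs S N X e A) {M M' : Eucl n →L[ℝ] Eucl n}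
    (hM : HasFDerivWithinAt (fun x => reflection S N x q.2) M
      {x ∈ S | q.2 ∈ reflectionDomain S N x} q.1)
    (hM' : HasFDerivWithinAt (fun x => reflection S N x q.2) M'
      {x ∈ S | q.2 ∈ reflectionDomain S N x} q.1) : ∀ w ∈ tangentSpace N q.1, M w = M' w := by
  intro w hw
  obtain ⟨γ, h0, h1, h2⟩ :=
    (h.isCurveDirection hq.1 (mem_tangentSpace.1 hw)).exists_eventually_mem
  rw [← h0] at hM hM'
  refine hM.eq_of_curve hM' h1 ?_
  filter_upwards [h2 _ (h.section_mem_nhdsWithin hq)] with t ht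
  exact ⟨h.regularPart_subset ht.1, h.mem_reflectionDomain_of_regularPairs ht⟩

theorem derivativeGraph_unique (h : IsChartOf S N A X e l L) :
    ∀ p ∈ derivativeGraph S N X e A, ∀ q ∈ derivativeGraph S N X e A, p.1 = q.1 → p.2 = q.2 := by
  rintro ⟨p, M⟩ ⟨h1, h2, h3⟩ ⟨q, M'⟩ ⟨h1', h2', h3'⟩ hpq
  obtain rfl : p = q := hpq
  have hν := h.norm_normal (h.regularPart_subset h1.1)
  ext1 w
  have hw : w - ⟪N p.1, w⟫_ℝ • N p.1 ∈ tangentSpace N p.1 := by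
    rw [mem_tangentSpace, inner_sub_right, inner_smul_right, real_inner_self_eq_norm_sq, hν]
    ring
  have := h.eqOn_tangentSpace h1 h3 h3' _ hw
  change M (N p.1) = 0 at h2
  change M' (N p.1) = 0 at h2'
  rw [map_sub, map_sub, map_smul, map_smul, h2, h2', smul_zero, sub_zero, sub_zero] at this
  exact this

/-- Since `⟪N u, ·⟫` has derivative zero within `S`, subtracting `⟪N u, ·⟫ T (N u)` from a
derivative `T` leaves a derivative, now vanishing on the normal. This normalisation makes the
derivative unique. -/
theorem mem_image_fst_derivativeGraph (h : IsChartOf S N A X e l L) {q : Eucl n × Eucl n}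
    (hq : q ∈ regularPairs S N X e A)
    (hd : DifferentiableWithinAt ℝ (fun x => reflection S N x q.2)
      {x ∈ S | q.2 ∈ reflectionDomain S N x} q.1) :
    q ∈ Prod.fst '' derivativeGraph S N X e A := by
  have hν := h.norm_normal (h.regularPart_subset hq.1)
  set D := {x ∈ S | q.2 ∈ reflectionDomain S N x} with hD
  obtain ⟨T, hT⟩ := hd
  let c := T (N q.1)
  let g : Eucl n →L[ℝ] Eucl n := (innerSL ℝ (N q.1)).smulRight c
  have hDS : D ⊆ S := fun x hx => hx.1
  have h0 : HasFDerivWithinAt (fun x => g x) (0 : Eucl n →L[ℝ] Eucl n) D q.1 := by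
    have h1 := ((h.hasFDerivWithinAt_inner_normal (h.regularPart_subset hq.1)).mono
      hDS).smul_const c
    refine h1.congr_fderiv ?_
    ext1 x
    simp
  have h1 : HasFDerivWithinAt (fun x => g x) g D q.1 := g.hasFDerivWithinAt
  have h2 := (hT.add h0).sub h1
  have h3 : HasFDerivWithinAt (fun x => reflection S N x q.2) (T - g) D q.1 := by
    have h4 := h2.congr_fderiv (g' := T - g) (by rw [add_zero])
    refine h4.congr (fun x _ => ?_) ?_ <;> simp
  refine ⟨(q, T - g), ⟨hq, ?_, h3⟩, rfl⟩
  change T (N q.1) - ⟪N q.1, N q.1⟫_ℝ • c = 0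
  rw [real_inner_self_eq_norm_sq, hν]
  simp [c]

theorem reflectionJacobian_eq (h : IsChartOf S N A X e l L)
    {p : (Eucl n × Eucl n) × (Eucl n →L[ℝ] Eucl n)} (hp : p ∈ derivativeGraph S N X e A) :
    reflectionJacobian S N p.1.1 p.1.2 = normalDet (N p.1.1, p.2) := by
  obtain ⟨h1, h2, h3⟩ := hp
  rw [normalDet, ← restrictedJacobian_orthogonal (h.norm_normal (h.regularPart_subset h1.1)) h2]
  exact restrictedJacobian_congr
    (h.eqOn_tangentSpace h1 h3.differentiableWithinAt.hasFDerivWithinAt h3)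

/-- Here `fderivWithin` takes its default value zero. The dimension matters: on a zero-dimensional
tangent space the determinant would be one. -/
theorem reflectionJacobian_eq_zero (hn : 2 ≤ n) (h : IsChartOf S N A X e l L)
    {q : Eucl n × Eucl n} (hq : q ∈ regularPairs S N X e A)
    (hq' : q ∉ Prod.fst '' derivativeGraph S N X e A) : reflectionJacobian S N q.1 q.2 = 0 := by
  rw [reflectionJacobian, fderivWithin_zero_of_not_differentiableWithinAt
    (fun hd => hq' (h.mem_image_fst_derivativeGraph hq hd))]
  refine restrictedJacobian_zero ?_
  rw [tangentSpace, finrank_orthogonal_singleton (h.norm_normal (h.regularPart_subset hq.1))]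
  omega

theorem measurable_reflectionJacobian (hn : 2 ≤ n) (h : IsChartOf S N A X e l L) (hK : 1 ≤ K)
    (hLK : L ≤ K * l) :
    Measurable ((regularPairs S N X e A).indicator fun q => reflectionJacobian S N q.1 q.2) := by
  set M := (regularPart X e A).indicator N with hM
  have hMm : Measurable M := h.measurable_normal
  have hφ : Measurable fun p : (Eucl n × Eucl n) × (Eucl n →L[ℝ] Eucl n) =>
      normalDet (M p.1.1, p.2) :=
    measurable_normalDet.comp ((hMm.comp measurable_fst.fst).prodMk measurable_snd)
  have hmeas := measurable_indicator_of_graph (h.measurableSet_derivativeGraph hK hLK)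
    h.derivativeGraph_unique hφ (g := fun q => reflectionJacobian S N q.1 q.2) (by
      intro p hp
      have e1 : M p.1.1 = N p.1.1 := indicator_of_mem hp.1.1 N
      rw [e1]
      exact h.reflectionJacobian_eq hp)
  have heq : (regularPairs S N X e A).indicator (fun q => reflectionJacobian S N q.1 q.2) =
      (Prod.fst '' derivativeGraph S N X e A).indicator
        (fun q => reflectionJacobian S N q.1 q.2) := by
    ext q
    by_cases hq : q ∈ Prod.fst '' derivativeGraph S N X e A
    · rw [indicator_of_mem hq]
      obtain ⟨p, hp, rfl⟩ := hq
      exact indicator_of_mem hp.1 _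
    · rw [indicator_of_notMem hq]
      by_cases hqG : q ∈ regularPairs S N X e A
      · rw [indicator_of_mem hqG, h.reflectionJacobian_eq_zero hn hqG hq]
      · exact indicator_of_notMem hqG _
  rw [heq]
  exact hmeas

end IsChartOf

end SurfaceMaximal

end

/-! ### The averaging and maximal operators: measurability and the weak-type bound. -/

noncomputable section

namespace SurfaceMaximal

open Filter Topology Set

variable {n : ℕ} {S : Set (Eucl n)} {N : Eucl n → Eucl n} {A : Set (Eucl n)} {X : Eucl n → Eucl n}
  {e : Eucl n} {l L K : ℝ} {g₁ g₂ : Eucl n → ℝ≥0∞}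

/-- The bound for the Jacobians of the reflections. -/
def jacobianBound (n : ℕ) (K : ℝ) : ℝ≥0∞ := ENNReal.ofReal (45 * K ^ 5) ^ (n - 1)

/-- The regular pairs `(u, u')` with `‖u' - R_u u'‖ < δ`. -/
def closePairs (S : Set (Eucl n)) (N : Eucl n → Eucl n) (X : Eucl n → Eucl n) (e : Eucl n)
    (A : Set (Eucl n)) (δ : ℝ) : Set (Eucl n × Eucl n) :=
  {q ∈ regularPairs S N X e A | ‖q.2 - reflection S N q.1 q.2‖ < δ}

/-- The integrand of the averaging operator on the regular pairs. -/
def averagingIntegrand (S : Set (Eucl n)) (N : Eucl n → Eucl n) (X : Eucl n → Eucl n) (e : Eucl n)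
    (A : Set (Eucl n)) (g₁ g₂ : Eucl n → ℝ≥0∞) (δ : ℝ) : Eucl n × Eucl n → ℝ≥0∞ :=
  (closePairs S N X e A δ).indicator fun q => g₁ q.2 * g₂ (reflection S N q.1 q.2) *
    ENNReal.ofReal (reflectionJacobian S N q.1 q.2)

namespace IsChartOf

theorem reflection_mem_reflectionDomain (h : IsChartOf S N A X e l L) {u u' : Eucl n} (hu : u ∈ S)
    (hu' : u' ∈ reflectionDomain S N u) : reflection S N u u' ∈ reflectionDomain S N u ∧
      reflection S N u (reflection S N u u') = u' := by
  have hr := isReflection_reflection hu'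
  obtain ⟨h1, h2⟩ := h.isReflection_symm hu hu'.1 hu'.2.1 hr
  exact ⟨⟨hr.1, h1, _, h2⟩, h.reflection_eq hu hr.1 h1 h2⟩

/-- Because `R_u` is an involution, the preimage of `E` lies in the image of a part of `E` under the
Lipschitz map `R_u`. As `E` is arbitrary, null sets pull back to null sets. -/
theorem surfaceMeasure_reflection_preimage_le (h : IsChartOf S N A X e l L) (hK : 1 ≤ K)
    (hLK : L ≤ K * l) {u : Eucl n} (hu : u ∈ S) (E : Set (Eucl n)) :
    surfaceMeasure S {u' ∈ reflectionDomain S N u | reflection S N u u' ∈ E} ≤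
      jacobianBound n K * surfaceMeasure S E := by
  have hlip : LipschitzOnWith (NNReal.mk (45 * K ^ 5) (by positivity)) (reflection S N u)
      (E ∩ reflectionDomain S N u) := by
    apply LipschitzOnWith.of_dist_le_mul
    intro x hx y hy
    rw [dist_eq_norm, dist_eq_norm]
    exact h.isReflection_lipschitz_left hK hLK hu hx.2.1 hy.2.1 hx.2.2.1 hy.2.2.1
      (isReflection_reflection hx.2) (isReflection_reflection hy.2)
  have hsub : {u' ∈ reflectionDomain S N u | reflection S N u u' ∈ E} ⊆
      reflection S N u '' (E ∩ reflectionDomain S N u) := by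
    rintro x ⟨hx, hxE⟩
    obtain ⟨h1, h2⟩ := h.reflection_mem_reflectionDomain hu hx
    exact ⟨_, ⟨hxE, h1⟩, h2⟩
  rw [surfaceMeasure]
  refine (Measure.restrict_apply_le _ _).trans ((measure_mono hsub).trans ?_)
  refine (hlip.euclideanHausdorffMeasure_image_le (n - 1)).trans ?_
  have hconst : (NNReal.mk (45 * K ^ 5) (by positivity) : ℝ≥0∞) ^ (n - 1) = jacobianBound n K := by
    rw [jacobianBound, ENNReal.ofReal_eq_coe_nnreal (by positivity)]
  rw [hconst]
  have hdom : reflectionDomain S N u ⊆ S := fun x hx => hx.1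
  exact mul_le_mul_right ((measure_mono (inter_subset_inter_right E hdom)).trans
    (Measure.le_restrict_apply _ _)) _

theorem ae_reflection (h : IsChartOf S N A X e l L) (hK : 1 ≤ K) (hLK : L ≤ K * l) {u : Eucl n}
    (hu : u ∈ S) {P : Eucl n → Prop} (hP : ∀ᵐ x ∂(surfaceMeasure S), P x) :
    ∀ᵐ u' ∂(surfaceMeasure S), u' ∈ reflectionDomain S N u → P (reflection S N u u') := by
  rw [ae_iff] at hP ⊢
  have h1 := h.surfaceMeasure_reflection_preimage_le hK hLK hu {x | ¬ P x}
  rw [hP, mul_zero] at h1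
  refine measure_mono_null (fun x hx => ?_) (le_antisymm h1 zero_le)
  rw [mem_ofPred_eq, Classical.not_imp] at hx
  exact hx

theorem ae_mem_regularPairs_iff (h : IsChartOf S N A X e l L) (hK : 1 ≤ K) (hLK : L ≤ K * l)
    {u : Eucl n} (hu : u ∈ regularPart X e A) : ∀ᵐ u' ∂(surfaceMeasure S),
      (u' ∈ reflectionDomain S N u ↔ (u, u') ∈ regularPairs S N X e A) := by
  have hae := h.ae_mem_regularPart hK hLK
  filter_upwards [hae, h.ae_reflection hK hLK (h.regularPart_subset hu) hae] with u' h1 h2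
  exact ⟨fun h3 => ⟨hu, h1, h3.2.1, _, h2 h3, isReflection_reflection h3⟩,
    h.mem_reflectionDomain_of_regularPairs⟩

theorem measurableSet_closePairs (h : IsChartOf S N A X e l L) (δ : ℝ) :
    MeasurableSet (closePairs S N X e A δ) := by
  set R : Eucl n × Eucl n → Eucl n :=
    (regularPairs S N X e A).indicator fun q => reflection S N q.1 q.2 with hR
  have hRm : Measurable R := h.measurable_reflection
  have heq : closePairs S N X e A δ = regularPairs S N X e A ∩ {q | ‖q.2 - R q‖ < δ} := by
    ext q
    refine and_congr_right fun hq => ?_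
    have e1 : R q = reflection S N q.1 q.2 := indicator_of_mem hq _
    rw [mem_ofPred_eq, e1]
  rw [heq]
  exact h.measurableSet_regularPairs.inter
    (measurableSet_lt (measurable_snd.sub hRm).norm measurable_const)

theorem measurable_averagingIntegrand (hn : 2 ≤ n) (h : IsChartOf S N A X e l L) (hK : 1 ≤ K)
    (hLK : L ≤ K * l) (hg₁ : Measurable g₁) (hg₂ : Measurable g₂) (δ : ℝ) :
    Measurable (averagingIntegrand S N X e A g₁ g₂ δ) := by
  set R : Eucl n × Eucl n → Eucl n :=
    (regularPairs S N X e A).indicator fun q => reflection S N q.1 q.2 with hR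
  have hRm : Measurable R := h.measurable_reflection
  set J : Eucl n × Eucl n → ℝ :=
    (regularPairs S N X e A).indicator fun q => reflectionJacobian S N q.1 q.2 with hJ
  have hJm : Measurable J := h.measurable_reflectionJacobian hn hK hLK
  have heq : averagingIntegrand S N X e A g₁ g₂ δ = (closePairs S N X e A δ).indicator
      fun q => g₁ q.2 * g₂ (R q) * ENNReal.ofReal (J q) := by
    refine indicator_congr fun q hq => ?_
    have e1 : R q = reflection S N q.1 q.2 := indicator_of_mem hq.1 _
    have e2 : J q = reflectionJacobian S N q.1 q.2 := indicator_of_mem hq.1 _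
    rw [e1, e2]
  rw [heq]
  exact (((hg₁.comp measurable_snd).mul (hg₂.comp hRm)).mul hJm.ennreal_ofReal).indicator
    (h.measurableSet_closePairs δ)

/-- `R_u` pulls null sets back to null sets, so irregular reflections may be dropped and `f₁`, `f₂`
replaced by Borel representatives, the second one even after composition with `R_u`. -/
theorem averagingOperator_eq (h : IsChartOf S N A X e l L) (hK : 1 ≤ K) (hLK : L ≤ K * l)
    {u : Eucl n} (hu : u ∈ regularPart X e A) {f₁ f₂ : Eucl n → ℝ}
    (hf₁ : (fun x => ENNReal.ofReal (f₁ x)) =ᵐ[surfaceMeasure S] g₁)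
    (hf₂ : (fun x => ENNReal.ofReal (f₂ x)) =ᵐ[surfaceMeasure S] g₂) (δ : ℝ) :
    averagingOperator S N δ f₁ f₂ u = ENNReal.ofReal ((δ ^ (n - 1))⁻¹) *
      ∫⁻ u', averagingIntegrand S N X e A g₁ g₂ δ (u, u') ∂(surfaceMeasure S) := by
  rw [averagingOperator]
  congr 1
  set D := {u' | (u, u') ∈ closePairs S N X e A δ} with hD
  have hDm : MeasurableSet D := measurable_prodMk_left (h.measurableSet_closePairs δ)
  have hset : ({u' ∈ reflectionDomain S N u | ‖u' - reflection S N u u'‖ < δ} : Set (Eucl n))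
      =ᵐ[surfaceMeasure S] D := by
    filter_upwards [h.ae_mem_regularPairs_iff hK hLK hu] with u' h1
    exact propext (and_congr_left fun _ => h1)
  rw [setLIntegral_congr hset]
  have hint : ∀ u', averagingIntegrand S N X e A g₁ g₂ δ (u, u') = D.indicator (fun u' =>
      g₁ u' * g₂ (reflection S N u u') * ENNReal.ofReal (reflectionJacobian S N u u')) u' :=
    fun u' => rfl
  simp only [hint]
  rw [lintegral_indicator hDm]
  refine setLIntegral_congr_fun_ae hDm ?_
  filter_upwards [hf₁, h.ae_reflection hK hLK (h.regularPart_subset hu) hf₂] with u' h1 h2 h3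
  rw [h1, h2 (h.mem_reflectionDomain_of_regularPairs h3.1)]

/-- Let rationals `s k` increase to `δ`. Because the condition `‖u' - R_u u'‖ < δ` is strict, the
integrands increase to the one at `δ`, and monotone convergence applies; `s k ≤ δ` only enlarges the
prefactor. -/
theorem averagingOperator_le_iSup (hn : 2 ≤ n) (h : IsChartOf S N A X e l L) (hK : 1 ≤ K)
    (hLK : L ≤ K * l) (hg₁ : Measurable g₁) (hg₂ : Measurable g₂) (u : Eucl n) {δ : ℝ}
    (hδ : δ ∈ Ioo (0 : ℝ) 1) : ENNReal.ofReal ((δ ^ (n - 1))⁻¹) *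
      ∫⁻ u', averagingIntegrand S N X e A g₁ g₂ δ (u, u') ∂(surfaceMeasure S) ≤
    ⨆ r : {r : ℚ // (r : ℝ) ∈ Ioo (0 : ℝ) 1}, ENNReal.ofReal (((r : ℝ) ^ (n - 1))⁻¹) *
      ∫⁻ u', averagingIntegrand S N X e A g₁ g₂ r (u, u') ∂(surfaceMeasure S) := by
  obtain ⟨s, hs, hsδ, hlim⟩ := Real.exists_seq_rat_strictMono_tendsto δ
  have hmono : ∀ q, Monotone fun k => averagingIntegrand S N X e A g₁ g₂ (s k) q := by
    intro q i j hij
    have hle : (s i : ℝ) ≤ s j := by exact_mod_cast hs.monotone hij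
    have hsub : closePairs S N X e A (s i) ⊆ closePairs S N X e A (s j) :=
      fun x hx => ⟨hx.1, hx.2.trans_le hle⟩
    exact indicator_le_indicator_of_subset hsub (fun _ => zero_le) q
  have hsup : ∀ q, averagingIntegrand S N X e A g₁ g₂ δ q ≤
      ⨆ k, averagingIntegrand S N X e A g₁ g₂ (s k) q := by
    intro q
    rw [averagingIntegrand]
    refine indicator_apply_le' (fun hq => ?_) fun _ => zero_le
    obtain ⟨k, hk⟩ := (hlim.eventually_const_lt hq.2).exists
    refine le_iSup_of_le k ?_
    rw [averagingIntegrand,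
      indicator_of_mem (show q ∈ closePairs S N X e A (s k) from ⟨hq.1, hk⟩)]
  have hint : ∫⁻ u', averagingIntegrand S N X e A g₁ g₂ δ (u, u') ∂(surfaceMeasure S) ≤
      ⨆ k, ∫⁻ u', averagingIntegrand S N X e A g₁ g₂ (s k) (u, u') ∂(surfaceMeasure S) := by
    rw [← lintegral_iSup]
    · exact lintegral_mono fun u' => hsup _
    · exact fun k => (h.measurable_averagingIntegrand hn hK hLK hg₁ hg₂ _).comp
        measurable_prodMk_left
    · exact fun i j hij u' => hmono _ hij
  refine (mul_le_mul_right hint _).trans ?_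
  rw [ENNReal.mul_iSup]
  refine iSup_le fun k => ?_
  -- Early terms of the sequence may be nonpositive; their integrands vanish.
  rcases le_or_gt (s k : ℝ) 0 with hk | hk
  · have h0 : ∀ u', averagingIntegrand S N X e A g₁ g₂ (s k) (u, u') = 0 := fun u' =>
      indicator_of_notMem (fun hq => (hq.2.trans_le hk).not_ge (norm_nonneg _)) _
    simp [h0]
  · refine le_iSup_of_le ⟨s k, hk, (hsδ k).trans hδ.2⟩ ?_
    gcongr
    exact (hsδ k).le

theorem aemeasurable_maximalOperator (hn : 2 ≤ n) (h : IsChartOf S N A X e l L) (hK : 1 ≤ K)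
    (hLK : L ≤ K * l) {f₁ f₂ : Eucl n → ℝ} (hg₁ : Measurable g₁) (hg₂ : Measurable g₂)
    (hf₁ : (fun x => ENNReal.ofReal (f₁ x)) =ᵐ[surfaceMeasure S] g₁)
    (hf₂ : (fun x => ENNReal.ofReal (f₂ x)) =ᵐ[surfaceMeasure S] g₂) :
    AEMeasurable (maximalOperator S N f₁ f₂) (surfaceMeasure S) := by
  have : IsFiniteMeasure (surfaceMeasure S) := ⟨h.surfaceMeasure_univ_lt_top hK hLK⟩
  refine ⟨fun u => ⨆ r : {r : ℚ // (r : ℝ) ∈ Ioo (0 : ℝ) 1},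
    ENNReal.ofReal (((r : ℝ) ^ (n - 1))⁻¹) *
      ∫⁻ u', averagingIntegrand S N X e A g₁ g₂ r (u, u') ∂(surfaceMeasure S), ?_, ?_⟩
  · exact Measurable.iSup fun r =>
      (h.measurable_averagingIntegrand hn hK hLK hg₁ hg₂ _).lintegral_prod_right'.const_mul _
  · filter_upwards [h.ae_mem_regularPart hK hLK] with u hu
    have heq := fun δ => h.averagingOperator_eq hK hLK hu hf₁ hf₂ δ
    simp only [maximalOperator, heq]
    refine le_antisymm ?_ ?_
    · exact iSup₂_le fun δ hδ => h.averagingOperator_le_iSup hn hK hLK hg₁ hg₂ u hδ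
    · exact iSup_le fun r => le_iSup₂_of_le (r : ℝ) r.2 le_rfl

/-- The preimage bound says that the push-forward of surface measure under `R_u` is dominated by a
multiple of surface measure. -/
theorem setLIntegral_comp_reflection_le (h : IsChartOf S N A X e l L) (hK : 1 ≤ K)
    (hLK : L ≤ K * l) {u : Eucl n} (hu : u ∈ S) {φ : Eucl n → ℝ≥0∞} (hφ : Measurable φ) :
    ∫⁻ u' in {u' | (u, u') ∈ regularPairs S N X e A}, φ ((regularPairs S N X e A).indicator
        (fun q => reflection S N q.1 q.2) (u, u')) ∂(surfaceMeasure S) ≤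
      jacobianBound n K * ∫⁻ x, φ x ∂(surfaceMeasure S) := by
  set P := {u' | (u, u') ∈ regularPairs S N X e A} with hP
  have hPm : MeasurableSet P := measurable_prodMk_left h.measurableSet_regularPairs
  set R : Eucl n → Eucl n := fun u' => (regularPairs S N X e A).indicator
    (fun q => reflection S N q.1 q.2) (u, u') with hR
  have hRm : Measurable R := h.measurable_reflection.comp measurable_prodMk_left
  have hle : ((surfaceMeasure S).restrict P).map R ≤ jacobianBound n K • surfaceMeasure S := by
    refine Measure.le_iff.2 fun E hE => ?_
    rw [Measure.map_apply hRm hE, Measure.restrict_apply (hRm hE), Measure.smul_apply, smul_eq_mul]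
    refine (measure_mono fun x hx => ?_).trans
      (h.surfaceMeasure_reflection_preimage_le hK hLK hu E)
    refine ⟨h.mem_reflectionDomain_of_regularPairs hx.2, ?_⟩
    have e1 : R x = reflection S N u x := indicator_of_mem hx.2 _
    have := hx.1
    rwa [mem_preimage, e1] at this
  rw [← lintegral_map hφ hRm, ← smul_eq_mul, ← lintegral_smul_measure]
  exact lintegral_mono' hle le_rfl

/-- On close pairs both `u'` and `R_u u'` lie in the ball of radius `K * δ`, so `g₁` and `g₂` may be
cut off there before Cauchy–Schwarz. Bounding the Jacobian costs one `jacobianBound`; undoing `R_u`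
in the `L²` norm of `g₂` costs its square root. -/
theorem lintegral_averagingIntegrand_le (h : IsChartOf S N A X e l L) (hK : 1 ≤ K)
    (hLK : L ≤ K * l) {u : Eucl n} (hu : u ∈ S) (hg₁ : Measurable g₁) (hg₂ : Measurable g₂)
    (δ : ℝ) :
    ∫⁻ u', averagingIntegrand S N X e A g₁ g₂ δ (u, u') ∂(surfaceMeasure S) ≤
      jacobianBound n K * jacobianBound n K ^ (1 / 2 : ℝ) *
      ((surfaceMeasure S).withDensity (fun x => g₁ x ^ (2 : ℝ)) (Metric.closedBall u (K * δ)) ^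
          (1 / 2 : ℝ) *
        (surfaceMeasure S).withDensity (fun x => g₂ x ^ (2 : ℝ)) (Metric.closedBall u (K * δ)) ^
          (1 / 2 : ℝ)) := by
  set B := Metric.closedBall u (K * δ) with hB
  have hBm : MeasurableSet B := Metric.isClosed_closedBall.measurableSet
  set P := {u' | (u, u') ∈ regularPairs S N X e A} with hP
  have hPm : MeasurableSet P := measurable_prodMk_left h.measurableSet_regularPairs
  set R : Eucl n → Eucl n := fun u' => (regularPairs S N X e A).indicator
    (fun q => reflection S N q.1 q.2) (u, u') with hR
  have hRm : Measurable R := h.measurable_reflection.comp measurable_prodMk_left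
  set a : Eucl n → ℝ≥0∞ := B.indicator g₁ with ha
  set b : Eucl n → ℝ≥0∞ := B.indicator g₂ with hb
  have ham : Measurable a := hg₁.indicator hBm
  have hbm : Measurable b := hg₂.indicator hBm
  set b' : Eucl n → ℝ≥0∞ := P.indicator fun u' => b (R u') with hb'
  have hbm' : Measurable b' := (hbm.comp hRm).indicator hPm
  have hsq : ∀ g : Eucl n → ℝ≥0∞, ∀ x, B.indicator g x ^ (2 : ℝ) =
      B.indicator (fun x => g x ^ (2 : ℝ)) x := by
    intro g x
    by_cases hx : x ∈ B
    · rw [indicator_of_mem hx, indicator_of_mem hx]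
    · rw [indicator_of_notMem hx, indicator_of_notMem hx, ENNReal.zero_rpow_of_pos two_pos]
  have hint : ∀ g : Eucl n → ℝ≥0∞, ∫⁻ x, B.indicator g x ^ (2 : ℝ) ∂(surfaceMeasure S) =
      (surfaceMeasure S).withDensity (fun x => g x ^ (2 : ℝ)) B := by
    intro g
    simp only [hsq g]
    rw [lintegral_indicator hBm, withDensity_apply _ hBm]
  have hpt : ∀ u', averagingIntegrand S N X e A g₁ g₂ δ (u, u') ≤
      jacobianBound n K * (a * b') u' := by
    intro u'
    rw [averagingIntegrand]
    refine indicator_apply_le' (fun hq => ?_) fun _ => zero_le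
    have hdom := h.mem_reflectionDomain_of_regularPairs hq.1
    have hR' : R u' = reflection S N u u' := indicator_of_mem hq.1 _
    obtain ⟨h1, h2⟩ := h.norm_sub_le_of_isReflection hK hLK hu hdom.1 hdom.2.1
      (isReflection_reflection hdom)
    have hKδ : K * ‖u' - reflection S N u u'‖ ≤ K * δ := by
      gcongr
      exact hq.2.le
    have hu'B : u' ∈ B := by
      rw [hB, Metric.mem_closedBall, dist_eq_norm]
      exact h1.trans hKδ
    have hRB : reflection S N u u' ∈ B := by
      rw [hB, Metric.mem_closedBall, dist_eq_norm]
      exact h2.trans hKδ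
    have e1 : a u' = g₁ u' := indicator_of_mem hu'B _
    have e2 : b' u' = g₂ (reflection S N u u') := by
      rw [hb', indicator_of_mem (show u' ∈ P from hq.1), hR']
      exact indicator_of_mem hRB _
    rw [Pi.mul_apply, e1, e2, mul_comm (jacobianBound n K)]
    gcongr
    rw [jacobianBound, ← ENNReal.ofReal_pow (by positivity)]
    exact ENNReal.ofReal_le_ofReal (h.reflectionJacobian_le hK hLK hq.1)
  have hb2 : ∫⁻ x, b' x ^ (2 : ℝ) ∂(surfaceMeasure S) ≤
      jacobianBound n K * (surfaceMeasure S).withDensity (fun x => g₂ x ^ (2 : ℝ)) B := by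
    have e1 : ∀ x, b' x ^ (2 : ℝ) = P.indicator (fun u' => b (R u') ^ (2 : ℝ)) x := by
      intro x
      by_cases hx : x ∈ P
      · rw [hb', indicator_of_mem hx, indicator_of_mem hx]
      · rw [hb', indicator_of_notMem hx, indicator_of_notMem hx,
          ENNReal.zero_rpow_of_pos two_pos]
    simp only [e1]
    rw [lintegral_indicator hPm, ← hint g₂]
    exact h.setLIntegral_comp_reflection_le hK hLK hu (hbm.pow_const 2)
  calc ∫⁻ u', averagingIntegrand S N X e A g₁ g₂ δ (u, u') ∂(surfaceMeasure S)
      ≤ ∫⁻ u', jacobianBound n K * (a * b') u' ∂(surfaceMeasure S) := lintegral_mono hpt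
    _ = jacobianBound n K * ∫⁻ u', (a * b') u' ∂(surfaceMeasure S) :=
        lintegral_const_mul _ (ham.mul hbm')
    _ ≤ jacobianBound n K * ((∫⁻ x, a x ^ (2 : ℝ) ∂(surfaceMeasure S)) ^ (1 / 2 : ℝ) *
          (∫⁻ x, b' x ^ (2 : ℝ) ∂(surfaceMeasure S)) ^ (1 / 2 : ℝ)) := by
        gcongr
        exact ENNReal.lintegral_mul_le_Lp_mul_Lq _ Real.HolderConjugate.two_two
          ham.aemeasurable hbm'.aemeasurable
    _ ≤ jacobianBound n K * (((surfaceMeasure S).withDensity (fun x => g₁ x ^ (2 : ℝ)) B) ^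
          (1 / 2 : ℝ) * (jacobianBound n K *
            (surfaceMeasure S).withDensity (fun x => g₂ x ^ (2 : ℝ)) B) ^ (1 / 2 : ℝ)) := by
        gcongr
        exact (hint g₁).le
    _ = _ := by
        rw [ENNReal.mul_rpow_of_nonneg _ _ (by positivity)]
        ring

theorem surfaceMeasure_closedBall_le (h : IsChartOf S N A X e l L) (hK : 1 ≤ K) (hLK : L ≤ K * l)
    {u : Eucl n} (hu : u ∈ S) (r : ℝ) : surfaceMeasure S (Metric.closedBall u r) ≤
      ENNReal.ofReal K ^ (n - 1) * unitBallVolume (n - 1) * ENNReal.ofReal r ^ (n - 1) := by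
  rw [surfaceMeasure, Measure.restrict_apply Metric.isClosed_closedBall.measurableSet, inter_comm]
  refine (h.measure_inter_closedBall_le hK hLK hu r).trans (le_of_eq ?_)
  rw [ENNReal.ofReal_mul (by positivity), mul_pow]
  ring

end IsChartOf

theorem withDensity_univ_rpow_half_le {α : Type*} [MeasurableSpace α] {μ : Measure α} {f : α → ℝ}
    {g : α → ℝ≥0∞} (hg : (fun x => ENNReal.ofReal (f x)) =ᵐ[μ] g) :
    (μ.withDensity fun x => g x ^ (2 : ℝ)) univ ^ (1 / 2 : ℝ) ≤ eLpNorm f 2 μ := by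
  rw [eLpNorm_eq_lintegral_rpow_enorm_toReal two_ne_zero ENNReal.ofNat_ne_top,
    withDensity_apply _ MeasurableSet.univ, Measure.restrict_univ, ENNReal.toReal_ofNat]
  gcongr 1
  refine lintegral_mono_ae ?_
  filter_upwards [hg] with x hx
  rw [← hx]
  gcongr
  exact Real.ofReal_le_enorm _

/-- The constant of the weak type estimate. -/
def weakTypeBound (n : ℕ) (K : ℝ) : ℝ≥0∞ :=
  ENNReal.ofReal K ^ (n - 1) * unitBallVolume (n - 1) * ENNReal.ofReal (5 * K) ^ (n - 1) *
    (jacobianBound n K * jacobianBound n K ^ (1 / 2 : ℝ))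

theorem weakTypeBound_ne_top (n : ℕ) (K : ℝ) : weakTypeBound n K ≠ ⊤ := by
  have h1 : jacobianBound n K ≠ ⊤ := ENNReal.pow_ne_top ENNReal.ofReal_ne_top
  refine ENNReal.mul_ne_top (ENNReal.mul_ne_top (ENNReal.mul_ne_top ?_ ?_) ?_) ?_
  · exact ENNReal.pow_ne_top ENNReal.ofReal_ne_top
  · exact ENNReal.ofReal_ne_top
  · exact ENNReal.pow_ne_top ENNReal.ofReal_ne_top
  · exact ENNReal.mul_ne_top h1 (ENNReal.rpow_ne_top_of_nonneg (by positivity) h1)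

/-- Wherever the supremum exceeds `t`, one scale `δ` already does; multiplying its estimate by `δ ^
(n - 1)` gives the hypothesis of `weak_type_of_local_bound`. -/
theorem IsChartOf.weak_type_maximalOperator (h : IsChartOf S N A X e l L) (hK : 1 ≤ K)
    (hLK : L ≤ K * l) {f₁ f₂ : Eucl n → ℝ} (hg₁ : Measurable g₁) (hg₂ : Measurable g₂)
    (hf₁ : (fun x => ENNReal.ofReal (f₁ x)) =ᵐ[surfaceMeasure S] g₁)
    (hf₂ : (fun x => ENNReal.ofReal (f₂ x)) =ᵐ[surfaceMeasure S] g₂) (t : ℝ≥0∞) :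
    t * surfaceMeasure S {u | t < maximalOperator S N f₁ f₂ u} ≤
      weakTypeBound n K * (eLpNorm f₁ 2 (surfaceMeasure S) * eLpNorm f₂ 2 (surfaceMeasure S)) := by
  set U := {u ∈ regularPart X e A | t < maximalOperator S N f₁ f₂ u} with hU
  have hmono : surfaceMeasure S {u | t < maximalOperator S N f₁ f₂ u} ≤ surfaceMeasure S U := by
    refine measure_mono_ae ?_
    filter_upwards [h.ae_mem_regularPart hK hLK] with u hu hut using ⟨hu, hut⟩
  refine (mul_le_mul_right hmono t).trans ?_
  refine (weak_type_of_local_bound (μ₁ := (surfaceMeasure S).withDensity fun x => g₁ x ^ (2 : ℝ))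
    (μ₂ := (surfaceMeasure S).withDensity fun x => g₂ x ^ (2 : ℝ)) (d := n - 1)
    (by positivity : 0 < K)
    (fun u hu r => h.surfaceMeasure_closedBall_le hK hLK (h.regularPart_subset hu.1) r)
    (c := jacobianBound n K * jacobianBound n K ^ (1 / 2 : ℝ)) ?_).trans ?_
  · rintro u ⟨hu, hut⟩
    rw [maximalOperator] at hut
    obtain ⟨δ, hδ, hlt⟩ := lt_biSup_iff.1 hut
    refine ⟨δ, hδ, ?_⟩
    rw [h.averagingOperator_eq hK hLK hu hf₁ hf₂] at hlt
    refine le_trans ?_ (h.lintegral_averagingIntegrand_le hK hLK (h.regularPart_subset hu)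
      hg₁ hg₂ δ)
    have hpos : 0 < δ ^ (n - 1) := pow_pos hδ.1 _
    calc t * ENNReal.ofReal δ ^ (n - 1) ≤ ENNReal.ofReal ((δ ^ (n - 1))⁻¹) *
          (∫⁻ u', averagingIntegrand S N X e A g₁ g₂ δ (u, u') ∂(surfaceMeasure S)) *
            ENNReal.ofReal δ ^ (n - 1) := by gcongr
      _ = ENNReal.ofReal ((δ ^ (n - 1))⁻¹ * δ ^ (n - 1)) *
          ∫⁻ u', averagingIntegrand S N X e A g₁ g₂ δ (u, u') ∂(surfaceMeasure S) := by
          rw [ENNReal.ofReal_mul (by positivity), ENNReal.ofReal_pow hδ.1.le]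
          ring
      _ = _ := by rw [inv_mul_cancel₀ hpos.ne', ENNReal.ofReal_one, one_mul]
  · rw [weakTypeBound]
    gcongr
    · exact withDensity_univ_rpow_half_le hf₁
    · exact withDensity_univ_rpow_half_le hf₂

end SurfaceMaximal

end

theorem theorem8p1 (n : ℕ) (hn : 2 ≤ n) (Q : ℝ≥0) :
    ∃ C : ℝ≥0, ∀ (S : Set (SurfaceMaximal.Eucl n))
      (N : SurfaceMaximal.Eucl n → SurfaceMaximal.Eucl n),
      SurfaceMaximal.IsStrictlyConvexSurface S N →
      SurfaceMaximal.curvatureQuotient S N ≤ (Q : ℝ≥0∞) →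
      ∀ f₁ f₂ : SurfaceMaximal.Eucl n → ℝ,
        (∀ u ∈ S, 0 ≤ f₁ u) → (∀ u ∈ S, 0 ≤ f₂ u) →
        MemLp f₁ 2 (SurfaceMaximal.surfaceMeasure S) →
        MemLp f₂ 2 (SurfaceMaximal.surfaceMeasure S) →
        AEMeasurable (SurfaceMaximal.maximalOperator S N f₁ f₂)
            (SurfaceMaximal.surfaceMeasure S) ∧
          ∀ t : ℝ≥0,
            (t : ℝ≥0∞) * SurfaceMaximal.surfaceMeasure S
                {u | (t : ℝ≥0∞) < SurfaceMaximal.maximalOperator S N f₁ f₂ u} ≤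
              C * eLpNorm f₁ 2 (SurfaceMaximal.surfaceMeasure S) *
                eLpNorm f₂ 2 (SurfaceMaximal.surfaceMeasure S) := by
  -- `16 Q⁴` is the ratio `L / l` of the chart; adding one ensures `K ≥ 1` for every `Q`.
  refine ⟨(SurfaceMaximal.weakTypeBound n (16 * Q ^ 4 + 1)).toNNReal, ?_⟩
  intro S N hS hQ f₁ f₂ _ _ hf₁ hf₂
  -- An empty `S` offers no base normal `e` for a chart.
  rcases S.eq_empty_or_nonempty with rfl | hne
  · have h0 : SurfaceMaximal.surfaceMeasure (∅ : Set (SurfaceMaximal.Eucl n)) = 0 :=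
      Measure.restrict_empty
    rw [h0]
    exact ⟨aemeasurable_zero_measure, fun t => by simp⟩
  · obtain ⟨A, X, e, l, L, h, hLK⟩ := hS.exists_chart hn hQ hne
    have hK : (1 : ℝ) ≤ 16 * (Q : ℝ) ^ 4 + 1 := by
      have : (0 : ℝ) ≤ 16 * (Q : ℝ) ^ 4 := by positivity
      linarith
    have m₁ := hf₁.aestronglyMeasurable.aemeasurable.ennreal_ofReal
    have m₂ := hf₂.aestronglyMeasurable.aemeasurable.ennreal_ofReal
    refine ⟨h.aemeasurable_maximalOperator hn hK hLK m₁.measurable_mk m₂.measurable_mk m₁.ae_eq_mk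
      m₂.ae_eq_mk, fun t => ?_⟩
    rw [ENNReal.coe_toNNReal (SurfaceMaximal.weakTypeBound_ne_top _ _), mul_assoc]
    exact h.weak_type_maximalOperator hK hLK m₁.measurable_mk m₂.measurable_mk m₁.ae_eq_mk
      m₂.ae_eq_mk t
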